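/- Let $n>1$ be a squarefree integer, $K=\mathbb{Q}(\sqrt n)\subset\mathbb{R}$, $\sigma$ the non-trivial automorphism of $K$, and $\mathbb{Z}_K=\mathbb{Z}\oplus\mathbb{Z}\alpha$ the ring of integers, where $\alpha=\frac{1+\sqrt n}{2}$ if $n\equiv1\pmod 4$ and $\alpha=\sqrt n$ otherwise. Let $\varepsilon$ be the fundamental unit, i.e. the least unit of $\mathbb{Z}_K$ greater than $1$. The group $\mathrm{PSL}_2(\mathbb{Z}_K)$ acts on $\mathcal{H}^2\times\mathcal{H}^2$ ($\mathcal{H}^2$ the upper half-plane, points $(x_1+y_1i,\,x_2+y_2i)$) by $\gamma(p_1,p_2)=(\gamma(p_1),\sigma(\gamma)(p_2))$. Let $\Delta$ be the stabilizer of $(\infty,\infty)$ (the cusp group), let $U$ be the set of its unipotent elements, and put $\tau_z=\begin{pmatrix}1&z\\0&1\end{pmatrix}$ and $\eta_1=\begin{pmatrix}\varepsilon&0\\0&\varepsilon^{-1}\end{pmatrix}$. Let $\delta(p,q)=\frac{|p_1-q_1|^2}{\Im p_1\Im q_1}+\frac{|p_2-q_2|^2}{\Im p_2\Im q_2}$.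 For $y_1,y_2>0$ let $\mathcal{F}(y_1,y_2)$ be the leaf of points with imaginary parts $(y_1,y_2)$, and let $\mathrm{T}(y_1,y_2)$ be the Dirichlet domain of $U$ in $\mathcal{F}(y_1,y_2)$ with respect to $\delta$, centered at $c=(y_1i,y_2i)$: the set of $p\in\mathcal{F}(y_1,y_2)$ with $\delta(c,p)\le\delta(c,\gamma p)$ for all $\gamma\in U$. Let $R_U=\bigcup_{y_1,y_2>0}\mathrm{T}(y_1,y_2)$, $R_D=\{y_2\le y_1<\varepsilon^4y_2\}$, $R_n=R_U\cap R_D$. For $h>0$ let $\mathcal{T}_n(h)=\bigcup_{1\le k<\varepsilon^4}\mathrm{T}(h\sqrt k,\,h/\sqrt k)$ be the cusp section at height $y_1y_2=h^2$. Let $\Psi(x_1+y_1i,x_2+y_2i)=(x_1,x_2,y_1/y_2)\in\mathbb{R}^3$, with third coordinate $k$. A fundamental domain for a group $G$ is a set whose $G$-translates cover the space and such that the intersection of two translates by different elements has no interior. A hypersurface is said to carry a side of a region if some non-empty relatively open piece of it lies in the boundary of the region; the same is said of a line and a planar region. **Theorem.** $R_n$ is a fundamental domain for $\Delta$, and it is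 the disjoint union of the cusp sections $\mathcal{T}_n(h)$, $h>0$. It is also the union over $h>0$ of the sets $\bigcup_{1\le k<\varepsilon^4}\mathrm{T}(hk,h)$, whose images under $\Psi$ are the same as those of the $\mathcal{T}_n(h')$. Every cusp section $\mathcal{T}_n=\mathcal{T}_n(h)$ is described as follows. *The list $L$.* Let $(z_1,z_1')=(1,\alpha)$, and for $i\ge1$ let $z_{i+1}=z_i+z_i'$ and let $z_{i+1}'$ be the element of $\{z_i,z_i'\}$ that is minimal under $|\sigma|$. There is a first index $m$ with $\{z_m,z_m'\}=\{\varepsilon^2,\varepsilon^2\alpha\}$ (the unordered pairs agree), and $m>1$. Let $L=\{\pm z_1,\pm z_1',\dots,\pm z_m,\pm z_m'\}$, together with $\pm\sigma(\alpha)$ if $n\equiv1\pmod4$. *Sides.* $\Psi(\mathcal{T}_n)$ is the set of $(x_1,x_2,k)$ with $1\le k<\varepsilon^4$ and $2zx_1+z^2+k^2(2\sigma(z)x_2+\sigma(z)^2)\ge0$ for all $z\in L$. The planes $k=1$ and $k=\varepsilon^4$ carry sides of it; the cubic surface $2zx_1+z^2+k^2(2\sigma(z)x_2+\sigma(z)^2)=0$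 of an element $z\in\mathbb{Z}_K$ carries a side of it if and only if $z\in L$. The boundary of $\Psi(\mathcal{T}_n)$ is the part of its closure that lies on the two planes and the surfaces with $z\in L$. *Torus shapes.* The closure of $\mathcal{T}_n$ is $\bigcup_{1\le k\le\varepsilon^4}\mathrm{T}(h\sqrt k,h/\sqrt k)$, and $\Psi$ maps it onto the closure of $\Psi(\mathcal{T}_n)$. For every $k\in[1,\varepsilon^4]$, the orthogonal slice of $\overline{\Psi(\mathcal{T}_n)}$ at level $k$ is the projection of $\mathrm{T}(h\sqrt k,h/\sqrt k)$ to the $(x_1,x_2)$-plane. With each point $x$ of the slice that lies on the surface of some $z\in L$ glued to $x+(z,\sigma(z))$ whenever the latter is in the slice, the slice is a flat torus: with $y_1=h\sqrt k$ and $y_2=h/\sqrt k$, the map $(x_1,x_2)\mapsto(x_1/y_1,x_2/y_2)$, which turns $\delta$ on the leaf $\mathcal{F}(y_1,y_2)$ into the squared Euclidean distance, induces a homeomorphism from the glued slice onto the quotient of the Euclidean plane by the lattice $\{(z/y_1,\sigma(z)/y_2)\mid z\in\mathbb{Z}_K\}$. Let $k_i=\sqrt{-z_iz_i'/\sigma(z_iz_i')}$.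 - For $1\le i<m$ we have $1\le k_i<\varepsilon^4$, and the slice at $k=k_i$ is a parallelogram bounded by the sides contributed by $\pm z_i$ and $\pm z_i'$, no other element of $\mathbb{Z}_K$ contributing a side of it. - If $n\not\equiv1\pmod4$, then $k_m=\varepsilon^4$, and the same holds for $i=m$. If $n\equiv1\pmod4$, then $k_m>\varepsilon^4$, and the slice of $\Psi(R_U)$ at $k=k_m$ is the parallelogram bounded by $\pm z_m$ and $\pm z_m'$. - All other slices with $k\in[1,\varepsilon^4]$ are hexagons. *Gluing maps.* For each $z\in L$, $\tau_z\in U$ maps the part of $\overline{\mathcal{T}_n}$ on the surface of $z$ onto the part on the surface of $-z$. Further, $\eta_1\in\Delta$ maps the torus of $\overline{\mathcal{T}_n}$ at $k=1$ onto the one at $k=\varepsilon^4$; on the coordinates $(x_1,x_2)$ it acts by a linear map that induces an Anosov diffeomorphism of the torus $\mathbb{R}^2/\{(z,\sigma(z))\mid z\in\mathbb{Z}_K\}$, i.e. one that preserves this lattice and for which the plane splits into a uniformly contracted and a uniformly expanded invariant subspace. Two points of $\overline{\mathcal{T}_n}$ lie in the same $\Delta$-orbit if and only if they are related by the equivalence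 relation that these side pairings generate. -/

import Mathlib

open scoped NumberField MatrixGroups UpperHalfPlane

namespace HilbertCusp

/-! ### The real quadratic field and its ring of integers -/

/-- The field `ℚ(√n)`, as a subfield of `ℝ`. -/
noncomputable abbrev QuadField (n : ℕ) : IntermediateField ℚ ℝ :=
  IntermediateField.adjoin ℚ {Real.sqrt n}

/-- The ring of integers `ℤ_K` of `K = ℚ(√n)`. -/
abbrev ZK (n : ℕ) : Type := 𝓞 (QuadField n)

/-- The inclusion `ℤ_K → ℝ`, `z ↦ z`. -/
noncomputable def emb (n : ℕ) : ZK n →+* ℝ :=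
  (algebraMap (QuadField n) ℝ).comp (algebraMap (ZK n) (QuadField n))

/-- The restriction of `σ` to `ℤ_K`. -/
noncomputable def conjZK (n : ℕ) (σ : QuadField n ≃ₐ[ℚ] QuadField n) : ZK n →+* ZK n :=
  NumberField.RingOfIntegers.mapRingHom (σ : QuadField n →+* QuadField n)

/-- The map `ℤ_K → ℝ`, `z ↦ σ(z)`. -/
noncomputable def embConj (n : ℕ) (σ : QuadField n ≃ₐ[ℚ] QuadField n) : ZK n →+* ℝ :=
  (emb n).comp (conjZK n σ)

theorem sqrt_mem (n : ℕ) : Real.sqrt n ∈ QuadField n :=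
  IntermediateField.subset_adjoin ℚ _ (Set.mem_singleton _)

/-- `√n` as an element of `ℚ(√n)`. -/
noncomputable def sqrtK (n : ℕ) : QuadField n := ⟨Real.sqrt n, sqrt_mem n⟩

theorem sqrtK_sq (n : ℕ) : sqrtK n ^ 2 = (n : QuadField n) := by
  apply Subtype.ext
  simp [sqrtK]

theorem isIntegral_sqrtK (n : ℕ) : IsIntegral ℤ (sqrtK n) := by
  refine IsIntegral.of_pow (n := 2) (by norm_num) ?_
  rw [sqrtK_sq]
  have h := isIntegral_algebraMap (R := ℤ) (A := QuadField n) (x := (n : ℤ))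
  simpa using h

theorem isIntegral_half (n : ℕ) (h : n % 4 = 1) : IsIntegral ℤ ((1 + sqrtK n) / 2) := by
  refine ⟨(Polynomial.X ^ 2 - (Polynomial.X + Polynomial.C ((n / 4 : ℕ) : ℤ)) : Polynomial ℤ),
    ?_, ?_⟩
  · refine Polynomial.monic_X_pow_sub ?_
    rw [Polynomial.degree_X_add_C]
    norm_num
  · have hn : (n : QuadField n) = 4 * ((n / 4 : ℕ) : QuadField n) + 1 := by
      have h1 : n = 4 * (n / 4) + 1 := by omega
      exact_mod_cast congrArg (Nat.cast : ℕ → QuadField n) h1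
    have hs := sqrtK_sq n
    rw [Polynomial.eval₂_sub, Polynomial.eval₂_add, Polynomial.eval₂_pow,
      Polynomial.eval₂_X, Polynomial.eval₂_C, map_natCast]
    rw [hn] at hs
    linear_combination hs / 4

/-- The generator `α` of `ℤ_K = ℤ ⊕ ℤα`: `(1 + √n)/2` if `n ≡ 1 mod 4`, and `√n` otherwise. -/
noncomputable def alpha (n : ℕ) : ZK n :=
  if h : n % 4 = 1 then ⟨(1 + sqrtK n) / 2, isIntegral_half n h⟩
  else ⟨sqrtK n, isIntegral_sqrtK n⟩

/-- `ε` is the fundamental unit: the least unit of `ℤ_K` greater than `1`. -/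
def IsFundamentalUnit (n : ℕ) (ε : (ZK n)ˣ) : Prop :=
  IsLeast {x : ℝ | ∃ u : (ZK n)ˣ, emb n u = x ∧ 1 < x} (emb n ε)

/-! ### The group `PSL₂(ℤ_K)` and its actions -/

/-- `Γ = PSL₂(ℤ_K)`. -/
abbrev PSL2 (n : ℕ) : Type := Matrix.ProjectiveSpecialLinearGroup (Fin 2) (ZK n)

/-- The class in `PSL₂(ℤ_K)` of a matrix in `SL₂(ℤ_K)`. -/
noncomputable abbrev toPSL (n : ℕ) : SL(2, ZK n) →* PSL2 n :=
  QuotientGroup.mk' (Subgroup.center SL(2, ZK n))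

theorem map_center {R : Type*} [CommRing R] (f : R →+* ℝ) {A : SL(2, R)}
    (hA : A ∈ Subgroup.center SL(2, R)) :
    Matrix.SpecialLinearGroup.map f A = 1 ∨ Matrix.SpecialLinearGroup.map f A = -1 := by
  obtain ⟨r, hr, hA⟩ := Matrix.SpecialLinearGroup.mem_center_iff.1 hA
  have hr2 : f r ^ 2 = 1 := by
    have := congrArg f hr
    simpa using this
  have hval : ∀ i j, (Matrix.SpecialLinearGroup.map f A) i j = if i = j then f r else 0 := by
    intro i j
    have : (A : Matrix (Fin 2) (Fin 2) R) i j = if i = j then r else 0 := by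
      rw [← hA]; simp [Matrix.diagonal_apply]
    simp only [Matrix.SpecialLinearGroup.map_apply_coe, RingHom.mapMatrix_apply, Matrix.map_apply,
      this]
    split_ifs <;> simp
  have hr3 : f r = 1 ∨ f r = -1 := mul_self_eq_one_iff.1 (by rw [← sq]; exact hr2)
  rcases hr3 with h | h
  · left; ext i j; rw [hval i j, h]; fin_cases i <;> fin_cases j <;> simp
  · right; ext i j; rw [hval i j, h]; fin_cases i <;> fin_cases j <;> simp

/-- The componentwise action of `SL₂(ℤ_K)` on `ℍ × ℍ` by Möbius transformations,
`γ (p₁, p₂) = (γ p₁, σ(γ) p₂)`. -/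
noncomputable def slAction (n : ℕ) (σ : QuadField n ≃ₐ[ℚ] QuadField n) :
    SL(2, ZK n) →* Equiv.Perm (ℍ × ℍ) where
  toFun A :=
    (MulAction.toPerm (Matrix.SpecialLinearGroup.map (emb n) A) : Equiv.Perm ℍ).prodCongr
      (MulAction.toPerm (Matrix.SpecialLinearGroup.map (embConj n σ) A) : Equiv.Perm ℍ)
  map_one' := by ext p <;> simp
  map_mul' A B := by ext p <;> simp [mul_smul]

theorem neg_one_smul_upper (z : ℍ) : (-1 : SL(2, ℝ)) • z = z := by
  ext
  simp [UpperHalfPlane.specialLinearGroup_apply]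

/-- The action of `PSL₂(ℤ_K)` on `ℍ × ℍ`. -/
noncomputable def act (n : ℕ) (σ : QuadField n ≃ₐ[ℚ] QuadField n) :
    PSL2 n →* Equiv.Perm (ℍ × ℍ) :=
  QuotientGroup.lift _ (slAction n σ) (by
    intro A hA
    ext1 p
    obtain ⟨a, b⟩ := p
    rcases map_center (emb n) hA with h1 | h1 <;> rcases map_center (embConj n σ) hA with h2 | h2 <;>
      simp [slAction, h1, h2, neg_one_smul_upper])

/-- The same formula on `∂ℍ × ∂ℍ`, where `∂ℍ = ℝ ∪ {∞}`. -/
noncomputable def slBoundaryAction (n : ℕ) (σ : QuadField n ≃ₐ[ℚ] QuadField n) :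
    SL(2, ZK n) →* Equiv.Perm (OnePoint ℝ × OnePoint ℝ) where
  toFun A :=
    (MulAction.toPerm (Matrix.SpecialLinearGroup.toGL
      (Matrix.SpecialLinearGroup.map (emb n) A)) : Equiv.Perm (OnePoint ℝ)).prodCongr
    (MulAction.toPerm (Matrix.SpecialLinearGroup.toGL
      (Matrix.SpecialLinearGroup.map (embConj n σ) A)) : Equiv.Perm (OnePoint ℝ))
  map_one' := by ext1 p; obtain ⟨a, b⟩ := p; simp
  map_mul' A B := by ext1 p; obtain ⟨a, b⟩ := p; simp [mul_smul]

theorem neg_one_smul_onePoint (x : OnePoint ℝ) :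
    Matrix.SpecialLinearGroup.toGL (-1 : SL(2, ℝ)) • x = x := by
  induction x using OnePoint.rec with
  | infty => simp [OnePoint.smul_infty_eq_ite]
  | coe t => simp [OnePoint.smul_some_eq_ite]

/-- The action of `PSL₂(ℤ_K)` on `∂ℍ × ∂ℍ`. -/
noncomputable def boundaryAct (n : ℕ) (σ : QuadField n ≃ₐ[ℚ] QuadField n) :
    PSL2 n →* Equiv.Perm (OnePoint ℝ × OnePoint ℝ) :=
  QuotientGroup.lift _ (slBoundaryAction n σ) (by
    intro A hA
    ext1 p
    obtain ⟨a, b⟩ := p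
    rcases map_center (emb n) hA with h1 | h1 <;> rcases map_center (embConj n σ) hA with h2 | h2 <;>
      simp [slBoundaryAction, h1, h2, neg_one_smul_onePoint])

/-- The cusp group `Δ`: the stabilizer of `(∞, ∞)` in `PSL₂(ℤ_K)`. -/
noncomputable def cuspGroup (n : ℕ) (σ : QuadField n ≃ₐ[ℚ] QuadField n) : Subgroup (PSL2 n) :=
  (MulAction.stabilizer (Equiv.Perm (OnePoint ℝ × OnePoint ℝ))
    ((OnePoint.infty, OnePoint.infty) : OnePoint ℝ × OnePoint ℝ)).comap (boundaryAct n σ)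

/-- The set `U` of unipotent elements of the cusp group. -/
def unipotents (n : ℕ) (σ : QuadField n ≃ₐ[ℚ] QuadField n) : Set (PSL2 n) :=
  {γ | γ ∈ cuspGroup n σ ∧ ∃ A : SL(2, ZK n), toPSL n A = γ ∧
    IsNilpotent ((A : Matrix (Fin 2) (Fin 2) (ZK n)) - 1)}

/-- `τ_z`, the class of `(1 z; 0 1)`. -/
noncomputable def tau (n : ℕ) (z : ZK n) : PSL2 n :=
  toPSL n ⟨!![1, z; 0, 1], by simp [Matrix.det_fin_two]⟩

/-- `η₁`, the class of `diag(ε, ε⁻¹)`. -/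
noncomputable def eta (n : ℕ) (ε : (ZK n)ˣ) : PSL2 n :=
  toPSL n ⟨!![(ε : ZK n), 0; 0, ((ε⁻¹ : (ZK n)ˣ) : ZK n)], by simp [Matrix.det_fin_two]⟩

/-! ### Fundamental domains -/

/-- `R` is a fundamental domain for `G`: its `G`-translates cover `ℍ × ℍ`, and the intersection of
two different translates has no interior. -/
def IsFundamentalDomain (n : ℕ) (σ : QuadField n ≃ₐ[ℚ] QuadField n) (G : Subgroup (PSL2 n))
    (R : Set (ℍ × ℍ)) : Prop :=
  (⋃ g ∈ G, act n σ g '' R) = Set.univ ∧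
    ∀ g ∈ G, ∀ g' ∈ G, g ≠ g' → interior (act n σ g '' R ∩ act n σ g' '' R) = ∅

/-- The semimetric `δ(p, q) = |p₁ - q₁|² / (Im p₁ Im q₁) + |p₂ - q₂|² / (Im p₂ Im q₂)`. -/
noncomputable def delta (p q : ℍ × ℍ) : ℝ :=
  ‖(p.1 : ℂ) - (q.1 : ℂ)‖ ^ 2 / (p.1.im * q.1.im) +
    ‖(p.2 : ℂ) - (q.2 : ℂ)‖ ^ 2 / (p.2.im * q.2.im)

/-- The leaf `F(y₁, y₂)` (empty unless `y₁, y₂ > 0`). -/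
def leaf (y₁ y₂ : ℝ) : Set (ℍ × ℍ) := {p | p.1.im = y₁ ∧ p.2.im = y₂}

/-- The point `(y₁ i, y₂ i)` of the leaf `F(y₁, y₂)` that contains `p`. -/
noncomputable def axisPoint (p : ℍ × ℍ) : ℍ × ℍ :=
  (⟨⟨0, p.1.im⟩, p.1.im_pos⟩, ⟨⟨0, p.2.im⟩, p.2.im_pos⟩)

/-- The points whose `δ`-distance to `c` is minimal along their orbit under `G`. -/
def dirichletDomain (n : ℕ) (σ : QuadField n ≃ₐ[ℚ] QuadField n) (G : Set (PSL2 n)) (c : ℍ × ℍ) :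
    Set (ℍ × ℍ) :=
  {p | ∀ γ ∈ G, delta c p ≤ delta c (act n σ γ p)}

/-- `T(y₁, y₂)`: the Dirichlet domain of `U` in the leaf `F(y₁, y₂)`, with respect to `δ` and
centered at `(y₁ i, y₂ i)`. -/
def torus (n : ℕ) (σ : QuadField n ≃ₐ[ℚ] QuadField n) (y₁ y₂ : ℝ) : Set (ℍ × ℍ) :=
  {p | p ∈ leaf y₁ y₂ ∧ p ∈ dirichletDomain n σ (unipotents n σ) (axisPoint p)}

/-- `R_U`, the union of all the `T(y₁, y₂)`. -/
def regionU (n : ℕ) (σ : QuadField n ≃ₐ[ℚ] QuadField n) : Set (ℍ × ℍ) :=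
  ⋃ (y₁ : ℝ) (y₂ : ℝ) (_ : 0 < y₁) (_ : 0 < y₂), torus n σ y₁ y₂

/-- `R_D = {y₂ ≤ y₁ < ε⁴ y₂}`. -/
def regionD (n : ℕ) (ε : (ZK n)ˣ) : Set (ℍ × ℍ) :=
  {p | p.2.im ≤ p.1.im ∧ p.1.im < emb n ε ^ 4 * p.2.im}

/-- `R_n = R_U ∩ R_D`. -/
def region (n : ℕ) (σ : QuadField n ≃ₐ[ℚ] QuadField n) (ε : (ZK n)ˣ) : Set (ℍ × ℍ) :=
  regionU n σ ∩ regionD n ε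

/-- The cusp section `𝒯_n(h)`: the tori at height `y₁ y₂ = h²` and at level `y₁ / y₂ = k` in
`[1, ε⁴)`. -/
def cuspSection (n : ℕ) (σ : QuadField n ≃ₐ[ℚ] QuadField n) (ε : (ZK n)ˣ) (h : ℝ) : Set (ℍ × ℍ) :=
  ⋃ k ∈ Set.Ico (1 : ℝ) (emb n ε ^ 4), torus n σ (h * Real.sqrt k) (h / Real.sqrt k)

/-- The tori `T(hk, h)` with `1 ≤ k < ε⁴`: the same levels, along the line `y₂ = h`. -/
def flatSection (n : ℕ) (σ : QuadField n ≃ₐ[ℚ] QuadField n) (ε : (ZK n)ˣ) (h : ℝ) : Set (ℍ × ℍ) :=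
  ⋃ k ∈ Set.Ico (1 : ℝ) (emb n ε ^ 4), torus n σ (h * k) h

/-! ### The picture in `ℝ³` -/

/-- `π (x₁ + y₁ i, x₂ + y₂ i) = (x₁, x₂)`. -/
noncomputable def proj (p : ℍ × ℍ) : ℝ × ℝ := (p.1.re, p.2.re)

/-- `Ψ (x₁ + y₁ i, x₂ + y₂ i) = (x₁, x₂, y₁ / y₂)`. -/
noncomputable def Psi (p : ℍ × ℍ) : ℝ × ℝ × ℝ := (p.1.re, p.2.re, p.1.im / p.2.im)

/-- The cubic polynomial `2 z x₁ + z² + k² (2 σ(z) x₂ + σ(z)²)` at the point `(x₁, x₂, k)`. -/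
noncomputable def cubic (n : ℕ) (σ : QuadField n ≃ₐ[ℚ] QuadField n) (z : ZK n) (q : ℝ × ℝ × ℝ) : ℝ :=
  2 * emb n z * q.1 + emb n z ^ 2 +
    q.2.2 ^ 2 * (2 * embConj n σ z * q.2.1 + embConj n σ z ^ 2)

/-- The cubic surface contributed by `z`. -/
def surface (n : ℕ) (σ : QuadField n ≃ₐ[ℚ] QuadField n) (z : ZK n) : Set (ℝ × ℝ × ℝ) :=
  {q | cubic n σ z q = 0}

/-- The plane at level `k`. -/
def plane (k : ℝ) : Set (ℝ × ℝ × ℝ) := {q | q.2.2 = k}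

/-- The orthogonal slice of `R` at level `k`. -/
def slice (R : Set (ℝ × ℝ × ℝ)) (k : ℝ) : Set (ℝ × ℝ) := {x | (x.1, x.2, k) ∈ R}

/-- `S` (a hypersurface) carries a side of `R`: a non-empty relatively open piece of `S` lies in
the boundary of `R`. -/
def IsSide {X : Type*} [TopologicalSpace X] (S R : Set X) : Prop :=
  ∃ V : Set X, IsOpen V ∧ (S ∩ V).Nonempty ∧ S ∩ V ⊆ frontier R

/-- One step of the recursion: `(z, z')` is sent to `z + z'` together with whichever of `z, z'` is
the smaller under `|σ|`. -/
noncomputable def euclidStep (n : ℕ) (σ : QuadField n ≃ₐ[ℚ] QuadField n) (w : ZK n × ZK n) :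
    ZK n × ZK n :=
  (w.1 + w.2, open Classical in if |embConj n σ w.1| ≤ |embConj n σ w.2| then w.1 else w.2)

/-- The pair `(z_i, z_i')`, for `i ≥ 1`; it starts with `(z_1, z_1') = (1, α)`. -/
noncomputable def zpair (n : ℕ) (σ : QuadField n ≃ₐ[ℚ] QuadField n) (i : ℕ) : ZK n × ZK n :=
  (euclidStep n σ)^[i - 1] (1, alpha n)

/-- The indices `i ≥ 1` with `{z_i, z_i'} = {ε² · 1, ε² · α}`, at which the recursion may stop. -/
def stopIndices (n : ℕ) (σ : QuadField n ≃ₐ[ℚ] QuadField n) (ε : (ZK n)ˣ) : Set ℕ :=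
  {i | 1 ≤ i ∧ ({(zpair n σ i).1, (zpair n σ i).2} : Set (ZK n)) =
    {(ε : ZK n) ^ 2, (ε : ZK n) ^ 2 * alpha n}}

/-- The list `L = {± z_1, ± z_1', …, ± z_m, ± z_m'}`, with `± σ(α)` added if `n ≡ 1 mod 4`. -/
def sideList (n : ℕ) (σ : QuadField n ≃ₐ[ℚ] QuadField n) (m : ℕ) : Set (ZK n) :=
  {w | (∃ i, 1 ≤ i ∧ i ≤ m ∧ (w = (zpair n σ i).1 ∨ w = -(zpair n σ i).1 ∨
      w = (zpair n σ i).2 ∨ w = -(zpair n σ i).2)) ∨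
    (n % 4 = 1 ∧ (w = conjZK n σ (alpha n) ∨ w = -conjZK n σ (alpha n)))}

/-- The level `k = √(- z_i z_i' / σ(z_i z_i'))`. -/
noncomputable def level (n : ℕ) (σ : QuadField n ≃ₐ[ℚ] QuadField n) (i : ℕ) : ℝ :=
  Real.sqrt (-(emb n ((zpair n σ i).1 * (zpair n σ i).2)) /
    embConj n σ ((zpair n σ i).1 * (zpair n σ i).2))

/-! ### Shapes of the slices -/

/-- A convex hexagon: a compact convex set with interior points and exactly six vertices. -/
def IsHexagon (P : Set (ℝ × ℝ)) : Prop :=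
  IsCompact P ∧ Convex ℝ P ∧ (interior P).Nonempty ∧ (Set.extremePoints ℝ P).ncard = 6

/-- A non-degenerate parallelogram. -/
def IsParallelogram (P : Set (ℝ × ℝ)) : Prop :=
  ∃ a u v : ℝ × ℝ, LinearIndependent ℝ ![u, v] ∧ P = convexHull ℝ {a, a + u, a + v, a + u + v}

/-- The planar set `P`, at level `k`, is a parallelogram whose boundary is covered by the surfaces
of `± z` and `± z'`, these being all the surfaces that carry a side of it. -/
def IsParallelogramBoundedBy (n : ℕ) (σ : QuadField n ≃ₐ[ℚ] QuadField n) (P : Set (ℝ × ℝ)) (k : ℝ)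
    (z z' : ZK n) : Prop :=
  IsParallelogram P ∧
  {w | IsSide (slice (surface n σ w) k) P} = {z, -z, z', -z'} ∧
  frontier P = ⋃ w ∈ ({z, -z, z', -z'} : Set (ZK n)), P ∩ slice (surface n σ w) k

/-- The isometry of the leaf `F(y₁, y₂)`, with the distance `√δ` and in the coordinates
`(x₁, x₂)`, onto the Euclidean plane. -/
noncomputable def leafChart (y₁ y₂ : ℝ) (x : ℝ × ℝ) : EuclideanSpace ℝ (Fin 2) :=
  !₂[x.1 / y₁, x.2 / y₂]

/-- The lattice of translations by which `U` acts on `F(y₁, y₂)`, seen in the Euclidean plane. -/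
noncomputable def leafLattice (n : ℕ) (σ : QuadField n ≃ₐ[ℚ] QuadField n) (y₁ y₂ : ℝ) :
    Submodule ℤ (EuclideanSpace ℝ (Fin 2)) :=
  Submodule.span ℤ (Set.range fun z : ZK n => leafChart y₁ y₂ (emb n z, embConj n σ z))

/-- Side pairings of a slice `P` at level `k`: a point on the surface of `z ∈ L` is glued to its
translate by `(z, σ(z))`. -/
def sliceGlue (n : ℕ) (σ : QuadField n ≃ₐ[ℚ] QuadField n) (L : Set (ZK n)) (P : Set (ℝ × ℝ)) (k : ℝ)
    (x x' : P) : Prop :=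
  ∃ z ∈ L, (x : ℝ × ℝ) ∈ slice (surface n σ z) k ∧
    (x' : ℝ × ℝ) = (x : ℝ × ℝ) + (emb n z, embConj n σ z)

/-- The slice `P` at level `k = y₁ / y₂`, with its sides glued, is a flat torus: it is the quotient
of the Euclidean plane by a lattice of translations, through the isometry `leafChart`. -/
def IsFlatTorus (n : ℕ) (σ : QuadField n ≃ₐ[ℚ] QuadField n) (L : Set (ZK n)) (P : Set (ℝ × ℝ))
    (y₁ y₂ : ℝ) : Prop :=
  (∃ _ : DiscreteTopology (leafLattice n σ y₁ y₂), IsZLattice ℝ (leafLattice n σ y₁ y₂)) ∧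
  (∀ p ∈ leaf y₁ y₂, ∀ q ∈ leaf y₁ y₂,
    delta p q = dist (leafChart y₁ y₂ (proj p)) (leafChart y₁ y₂ (proj q)) ^ 2) ∧
  ∃ Φ : Quot (sliceGlue n σ L P (y₁ / y₂)) ≃ₜ
      EuclideanSpace ℝ (Fin 2) ⧸ (leafLattice n σ y₁ y₂).toAddSubgroup,
    ∀ x : P, Φ (Quot.mk _ x) = QuotientAddGroup.mk (leafChart y₁ y₂ x)

/-! ### Gluing -/

/-- Side pairings of (the closure of) a cusp section `T`: for `z ∈ L` the points of the surface of
`z` are moved by `τ_z`, and the points at level `1` are moved by `η₁`. -/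
def sectionGlue (n : ℕ) (σ : QuadField n ≃ₐ[ℚ] QuadField n) (ε : (ZK n)ˣ) (L : Set (ZK n))
    (T : Set (ℍ × ℍ)) (p q : ℍ × ℍ) : Prop :=
  p ∈ T ∧ q ∈ T ∧
    ((∃ z ∈ L, Psi p ∈ surface n σ z ∧ q = act n σ (tau n z) p) ∨
      (Psi p ∈ plane 1 ∧ q = act n σ (eta n ε) p))

/-- The linear map `A` induces an Anosov diffeomorphism of the torus `ℝ² / Λ`: it preserves `Λ`,
and the plane has an `A`-invariant splitting into a uniformly contracted and a uniformly expanded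
part. -/
def IsAnosov (Λ : Set (ℝ × ℝ)) (A : (ℝ × ℝ) ≃L[ℝ] (ℝ × ℝ)) : Prop :=
  A '' Λ = Λ ∧
  ∃ Es Eu : Submodule ℝ (ℝ × ℝ), IsCompl Es Eu ∧ A '' (Es : Set (ℝ × ℝ)) = Es ∧
    A '' (Eu : Set (ℝ × ℝ)) = Eu ∧
    ∃ C : ℝ, 0 < C ∧ ∃ r : ℝ, 0 < r ∧ r < 1 ∧
      (∀ v ∈ Es, ∀ j : ℕ, ‖A^[j] v‖ ≤ C * r ^ j * ‖v‖) ∧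
      (∀ v ∈ Eu, ∀ j : ℕ, ‖A.symm^[j] v‖ ≤ C * r ^ j * ‖v‖)

end HilbertCusp

open HilbertCusp

namespace HilbertCusp

/-! ### Arithmetic of `ℤ_K` -/

/-! On the leaf at level `k = y₁ / y₂`, the group `U` acts by the lattice of the vectors `(z,
σ(z))`, and up to a scalar `δ` is the squared distance of the metric `x₁² + k² x₂²`. The polynomial
`cubic z` is the increase of `x₁² + k² x₂²` under translation by `(z, σ(z))`. Hence the Dirichlet
domain is the Voronoi cell of the lattice for the form `B_k(v, w) = v w + k² σ(v) σ(w)`, and the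
theorem describes how this cell changes with `k`.

In dimension two a Voronoi cell is governed by an obtuse superbase (Selling): a basis `z, z'` with
`B(z, z') ≤ 0`, `B(z, z + z') ≥ 0` and `B(z', z + z') ≥ 0`. Every lattice vector is a natural
combination of two neighbours among `±z, ±z', ±(z + z')`, and neighbours have `B ≥ 0`, so the six
inequalities imply all others (`IsObtuse.cubic_nonneg`). The cell is a hexagon if the three
conditions are strict, and a parallelogram if `B(z, z') = 0`.

For a basis with `z, z' > 0` and `σ(z) σ(z') < 0`, `B_k(z, z')` decreases in `k` and vanishes at
exactly one level. The pair becomes obtuse there and remains an obtuse superbase until the level of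
its successor under `euclidStep`: one of the two acuteness conditions holds at every level, and the
other expires exactly when the successor becomes orthogonal. Thus the levels `k_i` increase, and
`z_i, z_i'` describe the cell on `[k_i, k_{i+1}]`. The levels tend to infinity because the
determinant of the pair is invariant while `z_i z_i'` grows.

Multiplication by `ε²` turns `B_k` into `B_{ε⁴ k}` up to a scalar, so `ε², ε² α` is an orthogonal
reduced pair at level `ε⁴ k_1`. Such a pair is determined by the Voronoi-relevant vectors at its
level (`IsObtuse.eq_of_orthogonal`), so it occurs in the sequence (`exists_mem_stopIndices`). If `n
≢ 1 mod 4`, then `k_1 = 1` and the sequence covers `[1, ε⁴]` exactly. If `n ≡ 1 mod 4`, then `k_1 >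
1`, and `[1, k_1]` is covered by the preceding pair `1, α - 1 = -σ(α)`; this is why `±σ(α)` enters
`L`.

A relevant vector carries a side because its midpoint lies on its own surface and strictly inside
all the other inequalities. Closures and boundaries follow by scaling towards or away from the axis
`x = 0`, along which each cubic is affine. For the fundamental domain and the gluing, a cusp element
with unit `u` multiplies the level by `u⁴`: a power of `ε` normalises the level, translations do the
rest, and two equivalent points of one cell differ by at most two side pairings
(`IsObtuse.exists_path`). -/

theorem emb_injective (n : ℕ) : Function.Injective (emb n) := by
  intro x y h
  exact NumberField.RingOfIntegers.ext (Subtype.ext h)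

theorem embConj_injective (n : ℕ) (σ : QuadField n ≃ₐ[ℚ] QuadField n) :
    Function.Injective (embConj n σ) := by
  intro x y h
  have h1 : σ (x : QuadField n) = σ (y : QuadField n) := Subtype.ext h
  exact NumberField.RingOfIntegers.ext (σ.injective h1)

theorem emb_ne_zero {n : ℕ} {z : ZK n} (hz : z ≠ 0) : emb n z ≠ 0 :=
  (map_ne_zero_iff _ (emb_injective n)).2 hz

theorem embConj_ne_zero {n : ℕ} {σ : QuadField n ≃ₐ[ℚ] QuadField n} {z : ZK n} (hz : z ≠ 0) :
    embConj n σ z ≠ 0 :=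
  (map_ne_zero_iff _ (embConj_injective n σ)).2 hz

theorem conj_sqrtK {n : ℕ} {σ : QuadField n ≃ₐ[ℚ] QuadField n} (hσ : σ ≠ 1) :
    σ (sqrtK n) = -sqrtK n := by
  have h : σ (sqrtK n) ^ 2 = sqrtK n ^ 2 := by rw [← map_pow, sqrtK_sq, map_natCast]
  rcases sq_eq_sq_iff_eq_or_eq_neg.1 h with h | h
  · exfalso
    apply hσ
    have : (σ : QuadField n →ₐ[ℚ] QuadField n) = AlgHom.id ℚ (QuadField n) := by
      refine IntermediateField.algHom_ext_of_eq_adjoin ℚ (s := {Real.sqrt n}) rfl ?_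
      intro x hx
      obtain rfl := Set.mem_singleton_iff.1 hx
      exact h
    ext1 x
    exact DFunLike.congr_fun this x
  · exact h

theorem exists_rat_add_mul_sqrtK (n : ℕ) (x : QuadField n) :
    ∃ p q : ℚ, x = (p : QuadField n) + (q : QuadField n) * sqrtK n := by
  have hint : IsIntegral ℚ (Real.sqrt n) := by
    refine IsIntegral.of_pow (n := 2) (by norm_num) ?_
    rw [Real.sq_sqrt (Nat.cast_nonneg n)]
    have h := isIntegral_algebraMap (R := ℚ) (A := ℝ) (x := (n : ℚ))
    simpa using h
  have key : ∀ y ∈ Algebra.adjoin ℚ {Real.sqrt n}, ∃ p q : ℚ, y = (p : ℝ) + q * Real.sqrt n := by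
    intro y hy
    induction hy using Algebra.adjoin_induction with
    | mem y hy => exact ⟨0, 1, by simp [Set.mem_singleton_iff.1 hy]⟩
    | algebraMap r => exact ⟨r, 0, by simp⟩
    | add y z _ _ hy hz =>
      obtain ⟨p, q, rfl⟩ := hy
      obtain ⟨p', q', rfl⟩ := hz
      exact ⟨p + p', q + q', by push_cast; ring⟩
    | mul y z _ _ hy hz =>
      obtain ⟨p, q, rfl⟩ := hy
      obtain ⟨p', q', rfl⟩ := hz
      refine ⟨p * p' + n * (q * q'), p * q' + q * p', ?_⟩
      have := Real.sq_sqrt (Nat.cast_nonneg (α := ℝ) n)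
      push_cast
      linear_combination (q : ℝ) * q' * this
  have hx : (x : ℝ) ∈ Algebra.adjoin ℚ {Real.sqrt n} := by
    rw [← IntermediateField.adjoin_simple_toSubalgebra_of_isAlgebraic hint.isAlgebraic]
    exact x.2
  obtain ⟨p, q, h⟩ := key _ hx
  refine ⟨p, q, Subtype.ext ?_⟩
  rw [h]
  simp [sqrtK]

theorem exists_int_eq_of_isIntegral {K : Type*} [Field K] [CharZero K] {r : ℚ}
    (h : IsIntegral ℤ (r : K)) : ∃ a : ℤ, (a : ℚ) = r := by
  have h1 : IsIntegral ℤ r := by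
    refine (isIntegral_algHom_iff (Rat.castHom K).toIntAlgHom (Rat.castHom K).injective).1 ?_
    simpa using h
  obtain ⟨a, ha⟩ := IsIntegrallyClosed.isIntegral_iff.1 h1
  exact ⟨a, by simpa using ha⟩

/-- The square of the denominator is coprime to that of the numerator, so it divides `n`;
squarefreeness makes it `1`. -/
theorem exists_int_eq_of_squarefree {n : ℕ} (hn : Squarefree n) {r : ℚ} {M : ℤ}
    (h : n * r ^ 2 = M) : ∃ a : ℤ, (a : ℚ) = r := by
  have hd : (r.den : ℚ) ≠ 0 := by exact_mod_cast r.den_nz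
  have h1 : (n : ℤ) * r.num ^ 2 = M * (r.den : ℤ) ^ 2 := by
    have : (n : ℚ) * r.num ^ 2 = M * (r.den : ℚ) ^ 2 := by
      rw [← h]
      nth_rewrite 2 [← Rat.num_div_den r]
      field_simp
    exact_mod_cast this
  have h2 : ((r.den : ℤ) ^ 2) ∣ (n : ℤ) * r.num ^ 2 := ⟨M, by rw [h1]; ring⟩
  have hc : IsCoprime ((r.den : ℤ) ^ 2) (r.num ^ 2) := by
    refine IsCoprime.pow ?_
    rw [Int.isCoprime_iff_gcd_eq_one, Int.gcd_comm]
    simpa [Int.gcd] using r.reduced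
  have h3 : (r.den : ℤ) ^ 2 ∣ (n : ℤ) := hc.dvd_of_dvd_mul_right h2
  have h4 : r.den * r.den ∣ n := by
    rw [← sq]; exact_mod_cast h3
  have h5 : r.den = 1 := Nat.isUnit_iff.1 (hn _ h4)
  exact ⟨r.num, (Rat.den_eq_one_iff r).1 h5⟩

theorem not_four_dvd_of_squarefree {n : ℕ} (hn : Squarefree n) : n % 4 ≠ 0 := by
  intro h
  have h1 : 2 * 2 ∣ n := by omega
  have := Nat.isUnit_iff.1 (hn 2 h1)
  omega

theorem coe_alpha_of_one {n : ℕ} (h : n % 4 = 1) :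
    algebraMap (ZK n) (QuadField n) (alpha n) = (1 + sqrtK n) / 2 := by
  have e : alpha n = ⟨(1 + sqrtK n) / 2, isIntegral_half n h⟩ := dif_pos h
  rw [e]; rfl

theorem coe_alpha_of_ne_one {n : ℕ} (h : n % 4 ≠ 1) :
    algebraMap (ZK n) (QuadField n) (alpha n) = sqrtK n := by
  have e : alpha n = ⟨sqrtK n, isIntegral_sqrtK n⟩ := dif_neg h
  rw [e]; rfl

/-- For `z = p + q√n`, the trace `2p` and the norm `p² - n q²` are integers. As `n` is squarefree,
`2q` is an integer too, so `z = (A + D√n) / 2` with `A² ≡ n D² mod 4`, and parity decides between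
the two forms of `α`. -/
theorem exists_int_add_mul_alpha {n : ℕ} (hn : Squarefree n)
    {σ : QuadField n ≃ₐ[ℚ] QuadField n} (hσ : σ ≠ 1) (z : ZK n) :
    ∃ a b : ℤ, z = a + b * alpha n := by
  obtain ⟨p, q, hz⟩ := exists_rat_add_mul_sqrtK n (z : QuadField n)
  have hc : σ (z : QuadField n) = (p : QuadField n) - q * sqrtK n := by
    rw [hz, map_add, map_mul, conj_sqrtK hσ]
    simp [sub_eq_add_neg]
  have hi : IsIntegral ℤ (z : QuadField n) := z.isIntegral_coe
  have hi' : IsIntegral ℤ (σ (z : QuadField n)) := (conjZK n σ z).isIntegral_coe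
  have ht : IsIntegral ℤ (((2 * p : ℚ)) : QuadField n) := by
    have h := hi.add hi'
    rw [hc, hz] at h
    have e : (((2 * p : ℚ)) : QuadField n) =
        (p : QuadField n) + q * sqrtK n + (p - q * sqrtK n) := by push_cast; ring
    rwa [e]
  have hN : IsIntegral ℤ (((p ^ 2 - n * q ^ 2 : ℚ)) : QuadField n) := by
    have h := hi.mul hi'
    rw [hc, hz] at h
    have e : (((p ^ 2 - n * q ^ 2 : ℚ)) : QuadField n) =
        ((p : QuadField n) + q * sqrtK n) * (p - q * sqrtK n) := by
      have := sqrtK_sq n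
      push_cast
      linear_combination (q : QuadField n) ^ 2 * this
    rwa [e]
  obtain ⟨A, hA⟩ := exists_int_eq_of_isIntegral ht
  obtain ⟨N, hN⟩ := exists_int_eq_of_isIntegral hN
  obtain ⟨D, hD⟩ := exists_int_eq_of_squarefree hn (r := 2 * q) (M := A ^ 2 - 4 * N) (by
    push_cast; rw [hA, hN]; ring)
  have hp : p = A / 2 := by rw [hA]; ring
  have hq : q = D / 2 := by rw [hD]; ring
  have hrel : A ^ 2 - (n : ℤ) * D ^ 2 = 4 * N := by
    have : (A : ℚ) ^ 2 - n * D ^ 2 = 4 * N := by rw [hA, hN, hD]; ring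
    exact_mod_cast this
  have h4 := not_four_dvd_of_squarefree hn
  by_cases h1 : n % 4 = 1
  · have hpar : ∃ a : ℤ, A = D + 2 * a := by
      have h2 : Even (A ^ 2 - D ^ 2) := by
        have : (n : ℤ) = 4 * ((n / 4 : ℕ) : ℤ) + 1 := by omega
        refine ⟨2 * N + 2 * ((n / 4 : ℕ) : ℤ) * D ^ 2, ?_⟩
        rw [this] at hrel
        linear_combination hrel
      rw [Int.even_sub, Int.even_pow' two_ne_zero, Int.even_pow' two_ne_zero, ← Int.even_sub] at h2
      obtain ⟨a, ha⟩ := h2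
      exact ⟨a, by linarith⟩
    obtain ⟨a, rfl⟩ := hpar
    refine ⟨a, D, NumberField.RingOfIntegers.ext ?_⟩
    rw [hz, hp, hq]
    simp only [map_add, map_mul, map_intCast, coe_alpha_of_one h1]
    push_cast
    ring
  · have hpar : Even A ∧ Even D := by
      have hmod : ((A : ZMod 4)) ^ 2 - (n : ZMod 4) * (D : ZMod 4) ^ 2 = 0 := by
        have := congrArg (Int.cast : ℤ → ZMod 4) hrel
        push_cast at this
        rw [this]
        have h40 : (4 : ZMod 4) = 0 := by decide
        rw [h40, zero_mul]
      have hcast : (n : ZMod 4) = 2 ∨ (n : ZMod 4) = 3 := by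
        have h3 : n % 4 = 2 ∨ n % 4 = 3 := by omega
        rw [← ZMod.natCast_mod n 4]
        rcases h3 with h3 | h3 <;> rw [h3] <;> decide
      -- Evenness is expressed as `2 * a = 0` in `ZMod 4`, which leaves a finite check.
      have key : ∀ a d m : ZMod 4, (m = 2 ∨ m = 3) → a ^ 2 - m * d ^ 2 = 0 →
          2 * a = 0 ∧ 2 * d = 0 := by decide
      obtain ⟨ha, hd⟩ := key _ _ _ hcast hmod
      have conv : ∀ t : ℤ, (2 : ZMod 4) * (t : ZMod 4) = 0 → Even t := by
        intro t ht
        have h5 : ((2 * t : ℤ) : ZMod 4) = 0 := by push_cast; exact ht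
        have h6 := (ZMod.intCast_zmod_eq_zero_iff_dvd _ 4).1 h5
        obtain ⟨s, hs⟩ := h6
        exact ⟨s, by push_cast at hs; omega⟩
      exact ⟨conv _ ha, conv _ hd⟩
    obtain ⟨⟨a, rfl⟩, ⟨d, rfl⟩⟩ := hpar
    refine ⟨a, d, NumberField.RingOfIntegers.ext ?_⟩
    rw [hz, hp, hq]
    simp only [map_add, map_mul, map_intCast, coe_alpha_of_ne_one h1]
    push_cast
    ring

theorem emb_alpha_of_one {n : ℕ} (h : n % 4 = 1) : emb n (alpha n) = (1 + Real.sqrt n) / 2 := by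
  change ((algebraMap (ZK n) (QuadField n) (alpha n) : QuadField n) : ℝ) = _
  rw [coe_alpha_of_one h]
  have h2 : ((2 : QuadField n) : ℝ) = 2 := rfl
  simp [sqrtK, h2]

theorem emb_alpha_of_ne_one {n : ℕ} (h : n % 4 ≠ 1) : emb n (alpha n) = Real.sqrt n := by
  change ((algebraMap (ZK n) (QuadField n) (alpha n) : QuadField n) : ℝ) = _
  rw [coe_alpha_of_ne_one h]
  rfl

theorem embConj_alpha_of_one {n : ℕ} {σ : QuadField n ≃ₐ[ℚ] QuadField n} (hσ : σ ≠ 1)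
    (h : n % 4 = 1) : embConj n σ (alpha n) = (1 - Real.sqrt n) / 2 := by
  change ((σ (algebraMap (ZK n) (QuadField n) (alpha n)) : QuadField n) : ℝ) = _
  rw [coe_alpha_of_one h, map_div₀, map_add, conj_sqrtK hσ, map_one, map_ofNat]
  have h2 : ((2 : QuadField n) : ℝ) = 2 := rfl
  simp [sqrtK, h2, sub_eq_add_neg]

theorem embConj_alpha_of_ne_one {n : ℕ} {σ : QuadField n ≃ₐ[ℚ] QuadField n} (hσ : σ ≠ 1)
    (h : n % 4 ≠ 1) : embConj n σ (alpha n) = -Real.sqrt n := by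
  change ((σ (algebraMap (ZK n) (QuadField n) (alpha n)) : QuadField n) : ℝ) = _
  rw [coe_alpha_of_ne_one h, conj_sqrtK hσ]
  simp [sqrtK]

theorem conjZK_alpha_of_one {n : ℕ} {σ : QuadField n ≃ₐ[ℚ] QuadField n} (hσ : σ ≠ 1)
    (h : n % 4 = 1) : conjZK n σ (alpha n) = 1 - alpha n := by
  apply emb_injective n
  rw [map_sub, map_one, emb_alpha_of_one h]
  have := embConj_alpha_of_one hσ h
  change emb n (conjZK n σ (alpha n)) = _ at this
  rw [this]; ring

theorem two_lt_sqrt_of_one {n : ℕ} (hn : 1 < n) (h : n % 4 = 1) : 2 < Real.sqrt n := by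
  refine Real.lt_sqrt_of_sq_lt ?_
  have h1 : 5 ≤ n := by omega
  have : (5 : ℝ) ≤ n := by exact_mod_cast h1
  linarith

theorem one_lt_sqrt {n : ℕ} (hn : 1 < n) : 1 < Real.sqrt n := by
  refine Real.lt_sqrt_of_sq_lt ?_
  have : (1 : ℝ) < n := by exact_mod_cast hn
  linarith

theorem one_lt_emb_alpha {n : ℕ} (hn : 1 < n) : 1 < emb n (alpha n) := by
  by_cases h : n % 4 = 1
  · rw [emb_alpha_of_one h]; linarith [two_lt_sqrt_of_one hn h]
  · rw [emb_alpha_of_ne_one h]; exact one_lt_sqrt hn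

theorem embConj_alpha_neg {n : ℕ} (hn : 1 < n) {σ : QuadField n ≃ₐ[ℚ] QuadField n} (hσ : σ ≠ 1) :
    embConj n σ (alpha n) < 0 := by
  by_cases h : n % 4 = 1
  · rw [embConj_alpha_of_one hσ h]; linarith [two_lt_sqrt_of_one hn h]
  · rw [embConj_alpha_of_ne_one hσ h]; linarith [one_lt_sqrt hn]

/-! ### Norms and units -/

theorem exists_int_eq_emb_mul_embConj {n : ℕ} (hn : Squarefree n)
    {σ : QuadField n ≃ₐ[ℚ] QuadField n} (hσ : σ ≠ 1) (z : ZK n) :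
    ∃ N : ℤ, emb n z * embConj n σ z = N := by
  obtain ⟨a, b, rfl⟩ := exists_int_add_mul_alpha hn hσ z
  have hs := Real.sq_sqrt (Nat.cast_nonneg (α := ℝ) n)
  simp only [map_add, map_mul, map_intCast]
  by_cases h : n % 4 = 1
  · rw [emb_alpha_of_one h, embConj_alpha_of_one hσ h]
    -- Here the truncated quotient `n / 4` equals `(n - 1) / 4`.
    refine ⟨a ^ 2 + a * b - b ^ 2 * ((n / 4 : ℕ) : ℤ), ?_⟩
    have hn4 : (n : ℝ) = 4 * ((n / 4 : ℕ) : ℝ) + 1 := by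
      have h1 : n = 4 * (n / 4) + 1 := by omega
      exact_mod_cast congrArg (Nat.cast : ℕ → ℝ) h1
    rw [Int.cast_sub, Int.cast_mul, Int.cast_natCast]
    push_cast
    linear_combination (-(b : ℝ) ^ 2 / 4) * hs - (b : ℝ) ^ 2 / 4 * hn4
  · rw [emb_alpha_of_ne_one h, embConj_alpha_of_ne_one hσ h]
    refine ⟨a ^ 2 - b ^ 2 * n, ?_⟩
    push_cast
    linear_combination (-(b : ℝ) ^ 2) * hs

/-- The norms of `u` and `u⁻¹` are integers with product `1`. -/
theorem abs_emb_mul_embConj_unit {n : ℕ} (hn : Squarefree n)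
    {σ : QuadField n ≃ₐ[ℚ] QuadField n} (hσ : σ ≠ 1) (u : (ZK n)ˣ) :
    |emb n u * embConj n σ u| = 1 := by
  obtain ⟨N, hN⟩ := exists_int_eq_emb_mul_embConj hn hσ (u : ZK n)
  obtain ⟨M, hM⟩ := exists_int_eq_emb_mul_embConj hn hσ ((u⁻¹ : (ZK n)ˣ) : ZK n)
  have h : N * M = 1 := by
    have : (N : ℝ) * M = 1 := by
      rw [← hN, ← hM]
      calc _ = (emb n u * emb n ((u⁻¹ : (ZK n)ˣ) : ZK n)) *
            (embConj n σ u * embConj n σ ((u⁻¹ : (ZK n)ˣ) : ZK n)) := by ring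
        _ = 1 := by rw [← map_mul, ← map_mul]; simp
    exact_mod_cast this
  rw [hN]
  have := Int.isUnit_iff.1 (IsUnit.of_mul_eq_one _ h)
  rcases this with h | h <;> simp [h]

theorem emb_mul_emb_inv {n : ℕ} (u : (ZK n)ˣ) :
    emb n u * emb n ((u⁻¹ : (ZK n)ˣ) : ZK n) = 1 := by
  rw [← map_mul]; simp

theorem sq_emb_mul_sq_embConj_unit {n : ℕ} (hn : Squarefree n)
    {σ : QuadField n ≃ₐ[ℚ] QuadField n} (hσ : σ ≠ 1) (u : (ZK n)ˣ) :
    emb n u ^ 2 * embConj n σ u ^ 2 = 1 := by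
  rw [← mul_pow, ← sq_abs, abs_emb_mul_embConj_unit hn hσ u, one_pow]

theorem IsFundamentalUnit.one_lt {n : ℕ} {ε : (ZK n)ˣ} (hε : IsFundamentalUnit n ε) :
    1 < emb n ε := by
  obtain ⟨u, hu, h⟩ := hε.1
  exact h

theorem IsFundamentalUnit.le {n : ℕ} {ε : (ZK n)ˣ} (hε : IsFundamentalUnit n ε) {u : (ZK n)ˣ}
    (hu : 1 < emb n u) : emb n ε ≤ emb n u :=
  hε.2 ⟨u, rfl, hu⟩

theorem IsFundamentalUnit.le_abs {n : ℕ} {ε : (ZK n)ˣ} (hε : IsFundamentalUnit n ε) {u : (ZK n)ˣ}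
    (hu : 1 < |emb n u|) : emb n ε ≤ |emb n u| := by
  rcases le_total 0 (emb n u) with h | h
  · rw [abs_of_nonneg h] at hu ⊢; exact hε.le hu
  · rw [abs_of_nonpos h] at hu ⊢
    have h1 : emb n ((-u : (ZK n)ˣ) : ZK n) = -emb n u := by simp
    rw [← h1] at hu ⊢
    exact hε.le hu

end HilbertCusp

namespace HilbertCusp

/-! ### Reduced bases of `ℤ_K` for the forms `z² + k² σ(z)²` -/

/-- The symmetric bilinear form `v w + k² σ(v) σ(w)`. -/
noncomputable def form (n : ℕ) (σ : QuadField n ≃ₐ[ℚ] QuadField n) (k : ℝ) (v w : ZK n) : ℝ :=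
  emb n v * emb n w + k ^ 2 * (embConj n σ v * embConj n σ w)

variable {n : ℕ} {σ : QuadField n ≃ₐ[ℚ] QuadField n} {k : ℝ} {z z' v w : ZK n}

theorem form_comm (k : ℝ) (v w : ZK n) : form n σ k v w = form n σ k w v := by
  simp only [form]; ring

theorem form_neg_left (k : ℝ) (v w : ZK n) : form n σ k (-v) w = -form n σ k v w := by
  simp only [form, map_neg]; ring

theorem form_neg_right (k : ℝ) (v w : ZK n) : form n σ k v (-w) = -form n σ k v w := by
  simp only [form, map_neg]; ring

theorem form_add_left (k : ℝ) (u v w : ZK n) :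
    form n σ k (u + v) w = form n σ k u w + form n σ k v w := by
  simp only [form, map_add]; ring

theorem form_add_right (k : ℝ) (u v w : ZK n) :
    form n σ k u (v + w) = form n σ k u v + form n σ k u w := by
  simp only [form, map_add]; ring

theorem form_sub_right (k : ℝ) (u v w : ZK n) :
    form n σ k u (v - w) = form n σ k u v - form n σ k u w := by
  simp only [form, map_sub]; ring

theorem form_self_pos (k : ℝ) (hz : z ≠ 0) : 0 < form n σ k z z := by
  have h : 0 < emb n z ^ 2 := by have := emb_ne_zero hz; positivity
  have : 0 ≤ (k * embConj n σ z) ^ 2 := sq_nonneg _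
  simp only [form]
  nlinarith

/-- In `z`, the cubic is a linear function plus `form z z`. When `a, b` are natural numbers, the two
cubics on the right are non-negative and `form v w ≥ 0`, every summand is non-negative; this is the
source of all the implications between the inequalities. -/
theorem cubic_comb (a b : ℤ) (v w : ZK n) (q : ℝ × ℝ × ℝ) :
    cubic n σ (a * v + b * w) q = a * cubic n σ v q + b * cubic n σ w q +
      (a ^ 2 - a) * form n σ q.2.2 v v + (b ^ 2 - b) * form n σ q.2.2 w w +
      2 * (a * b) * form n σ q.2.2 v w := by
  simp only [cubic, form, map_add, map_mul, map_intCast]; ring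

/-- The midpoint of `0` and `-(v, σ(v))`, at level `k`. -/
noncomputable def mid (n : ℕ) (σ : QuadField n ≃ₐ[ℚ] QuadField n) (v : ZK n) (k : ℝ) : ℝ × ℝ × ℝ :=
  (-(emb n v) / 2, -(embConj n σ v) / 2, k)

/-- Translates relevance of `v` into cubics: at the midpoint the cubic of `v` is `0`, and those of
the other non-zero elements are positive exactly when `v` is relevant. -/
theorem cubic_mid (v w : ZK n) (k : ℝ) :
    cubic n σ w (mid n σ v k) = form n σ k w (w - v) := by
  simp only [cubic, form, mid, map_sub]; ring

/-! ### Reduced pairs and obtuse superbases -/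

variable (n σ) in
/-- A positive basis of `ℤ_K` whose conjugates have opposite signs. -/
structure IsReducedPair (z z' : ZK n) : Prop where
  pos : 0 < emb n z
  pos' : 0 < emb n z'
  neg : embConj n σ z * embConj n σ z' < 0
  span : ∀ v : ZK n, ∃ a b : ℤ, v = a * z + b * z'

theorem ne_zero_of_emb_pos (h : 0 < emb n z) : z ≠ 0 := by
  rintro rfl; simp at h

theorem IsReducedPair.symm (h : IsReducedPair n σ z z') : IsReducedPair n σ z' z :=
  ⟨h.pos', h.pos, by rw [mul_comm]; exact h.neg, fun v => by
    obtain ⟨a, b, hv⟩ := h.span v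
    exact ⟨b, a, by rw [hv]; ring⟩⟩

theorem IsReducedPair.add_pos (h : IsReducedPair n σ z z') : 0 < emb n (z + z') := by
  rw [map_add]; exact _root_.add_pos h.pos h.pos'

variable (n σ) in
/-- At level `k`, `z`, `z'`, `-(z + z')` is an obtuse superbase of `ℤ_K`. -/
structure IsObtuse (k : ℝ) (z z' : ZK n) : Prop extends IsReducedPair n σ z z' where
  obtuse : form n σ k z z' ≤ 0
  acute : 0 ≤ form n σ k z (z + z')
  acute' : 0 ≤ form n σ k z' (z + z')

theorem IsObtuse.symm (h : IsObtuse n σ k z z') : IsObtuse n σ k z' z :=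
  ⟨h.toIsReducedPair.symm, by rw [form_comm]; exact h.obtuse, by rw [add_comm]; exact h.acute',
    by rw [add_comm]; exact h.acute⟩

/-- The six partial sums of the superbase `z`, `z'`, `-(z + z')`. -/
def six (z z' : ZK n) : Set (ZK n) := {z, z', z + z', -z, -z', -(z + z')}

theorem IsReducedPair.ne_zero_of_mem_six (h : IsReducedPair n σ z z') (hv : v ∈ six z z') :
    v ≠ 0 := by
  have h1 := ne_zero_of_emb_pos h.pos
  have h2 := ne_zero_of_emb_pos h.pos'
  have h3 := ne_zero_of_emb_pos h.add_pos
  simp only [six, Set.mem_insert_iff, Set.mem_singleton_iff] at hv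
  rcases hv with rfl | rfl | rfl | rfl | rfl | rfl
  exacts [h1, h2, h3, neg_ne_zero.2 h1, neg_ne_zero.2 h2, neg_ne_zero.2 h3]

/-- Every lattice vector lies in the cone spanned by two neighbours among the six vectors. -/
theorem exists_nat_comb (a b : ℤ) (z z' : ZK n) : ∃ (p q : ZK n) (i j : ℕ),
    (a * z + b * z' = (i : ℤ) * p + (j : ℤ) * q) ∧
    ((p = z ∧ q = z + z') ∨ (p = z' ∧ q = z + z') ∨ (p = z' ∧ q = -z) ∨
      (p = -z ∧ q = -(z + z')) ∨ (p = -z' ∧ q = -(z + z')) ∨ (p = -z' ∧ q = z)) := by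
  -- Opposite signs give the cones on `∓z', ±z`. Equal signs are split by the order of `a` and `b`,
  -- as in `a z + b z' = (b - a) z' + a (z + z')`.
  rcases le_total 0 a with ha | ha <;> rcases le_total 0 b with hb | hb
  · rcases le_total a b with hab | hab
    · refine ⟨z', z + z', (b - a).toNat, a.toNat, ?_, by simp⟩
      rw [Int.toNat_of_nonneg (by omega), Int.toNat_of_nonneg ha]; push_cast; ring
    · refine ⟨z, z + z', (a - b).toNat, b.toNat, ?_, by simp⟩
      rw [Int.toNat_of_nonneg (by omega), Int.toNat_of_nonneg hb]; push_cast; ring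
  · refine ⟨-z', z, (-b).toNat, a.toNat, ?_, by simp⟩
    rw [Int.toNat_of_nonneg (by omega), Int.toNat_of_nonneg ha]; push_cast; ring
  · refine ⟨z', -z, b.toNat, (-a).toNat, ?_, by simp⟩
    rw [Int.toNat_of_nonneg hb, Int.toNat_of_nonneg (by omega)]; push_cast; ring
  · rcases le_total a b with hab | hab
    · refine ⟨-z, -(z + z'), (b - a).toNat, (-b).toNat, ?_, by simp⟩
      rw [Int.toNat_of_nonneg (by omega), Int.toNat_of_nonneg (by omega)]; push_cast; ring
    · refine ⟨-z', -(z + z'), (a - b).toNat, (-a).toNat, ?_, by simp⟩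
      rw [Int.toNat_of_nonneg (by omega), Int.toNat_of_nonneg (by omega)]; push_cast; ring

/-- For neighbours among the six vectors, `form p q` is one of `-form z z'`, `form z (z + z')`,
`form z' (z + z')`, which the definition of an obtuse superbase makes non-negative. -/
theorem IsObtuse.exists_nat_comb (h : IsObtuse n σ k z z') (v : ZK n) :
    ∃ p ∈ six z z', ∃ q ∈ six z z', ∃ i j : ℕ, v = (i : ℤ) * p + (j : ℤ) * q ∧
      0 ≤ form n σ k p q := by
  obtain ⟨a, b, rfl⟩ := h.span v
  obtain ⟨p, q, i, j, e, hpq⟩ := HilbertCusp.exists_nat_comb a b z z'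
  have h1 := h.obtuse
  have h2 := h.acute
  have h3 := h.acute'
  have h4 := form_comm (σ := σ) k z' z
  refine ⟨p, ?_, q, ?_, i, j, e, ?_⟩ <;>
    rcases hpq with ⟨e1, e2⟩ | ⟨e1, e2⟩ | ⟨e1, e2⟩ | ⟨e1, e2⟩ | ⟨e1, e2⟩ | ⟨e1, e2⟩ <;>
    first
    | (simp only [e1, e2, form_neg_left, form_neg_right]; linarith)
    | (simp [e1, e2, six])

theorem natCast_sq_sub_nonneg (i : ℕ) : (0 : ℝ) ≤ ((i : ℤ) : ℝ) ^ 2 - ((i : ℤ) : ℝ) := by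
  rcases Nat.eq_zero_or_pos i with rfl | hi
  · simp
  · have : (1 : ℝ) ≤ i := by exact_mod_cast hi
    push_cast
    nlinarith

/-- The six inequalities of an obtuse superbase imply all the others. -/
theorem IsObtuse.cubic_nonneg (h : IsObtuse n σ k z z') {q : ℝ × ℝ × ℝ} (hq : q.2.2 = k)
    (hc : ∀ p ∈ six z z', 0 ≤ cubic n σ p q) (v : ZK n) : 0 ≤ cubic n σ v q := by
  obtain ⟨u, hu, w, hw, i, j, rfl, huw⟩ := h.exists_nat_comb v
  -- All summands are non-negative, since `i² ≥ i` for natural `i`.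
  rw [cubic_comb, hq]
  have h1 := hc u hu
  have h2 := hc w hw
  have h3 := form_self_pos (σ := σ) k (h.ne_zero_of_mem_six hu)
  have h4 := form_self_pos (σ := σ) k (h.ne_zero_of_mem_six hw)
  have h5 := natCast_sq_sub_nonneg i
  have h6 := natCast_sq_sub_nonneg j
  positivity

/-- The equality case: each summand of `cubic_comb` vanishes, so both coefficients are `0` or `1`.
If both are `1`, the mixed term forces `u` and `w` to be orthogonal; then `v` is the diagonal of a
rectangle and its surface only touches the cell at a vertex. -/
theorem IsObtuse.cubic_eq_zero (h : IsObtuse n σ k z z') {q : ℝ × ℝ × ℝ} (hq : q.2.2 = k)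
    (hc : ∀ p ∈ six z z', 0 ≤ cubic n σ p q) (h0 : cubic n σ v q = 0) :
    v = 0 ∨ v ∈ six z z' ∨ ∃ u ∈ six z z', ∃ w ∈ six z z', v = u + w ∧ form n σ k u w = 0 ∧
      cubic n σ u q = 0 ∧ cubic n σ w q = 0 := by
  obtain ⟨u, hu, w, hw, i, j, rfl, huw⟩ := h.exists_nat_comb v
  rw [cubic_comb, hq] at h0
  have h1 := hc u hu
  have h2 := hc w hw
  have h3 := form_self_pos (σ := σ) k (h.ne_zero_of_mem_six hu)
  have h4 := form_self_pos (σ := σ) k (h.ne_zero_of_mem_six hw)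
  have h5 := natCast_sq_sub_nonneg i
  have h6 := natCast_sq_sub_nonneg j
  have hi0 : (0 : ℝ) ≤ ((i : ℤ) : ℝ) := by positivity
  have hj0 : (0 : ℝ) ≤ ((j : ℤ) : ℝ) := by positivity
  have t1 := mul_nonneg hi0 h1
  have t2 := mul_nonneg hj0 h2
  have t3 := mul_nonneg h5 h3.le
  have t4 := mul_nonneg h6 h4.le
  have t5 := mul_nonneg (mul_nonneg zero_le_two (mul_nonneg hi0 hj0)) huw
  have zero_or_one : ∀ {l : ℕ} {c : ℝ}, 0 < c → (((l : ℤ) : ℝ) ^ 2 - ((l : ℤ) : ℝ)) * c = 0 →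
      l = 0 ∨ l = 1 := by
    intro l c hc0 hl
    rcases mul_eq_zero.1 hl with hl | hl
    · have hl' : (l : ℝ) * ((l : ℝ) - 1) = 0 := by push_cast at hl; linarith
      rcases mul_eq_zero.1 hl' with hl' | hl'
      · left; exact_mod_cast hl'
      · right; have : (l : ℝ) = 1 := by linarith
        exact_mod_cast this
    · exact absurd hl hc0.ne'
  rcases zero_or_one (l := i) h3 (by linarith) with rfl | rfl <;>
    rcases zero_or_one (l := j) h4 (by linarith) with rfl | rfl
  · left; simp
  · right; left; simpa using hw
  · right; left; simpa using hu
  · right; right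
    refine ⟨u, hu, w, hw, by simp, ?_, ?_, ?_⟩ <;> norm_num at * <;> linarith

/-! ### Relevant vectors -/

variable (n σ) in
/-- `v` is relevant at level `k`: the midpoint of `v` is strictly closer to `0` and `v` than to the
other lattice points. -/
def IsRelevant (k : ℝ) (v : ZK n) : Prop :=
  v ≠ 0 ∧ ∀ w : ZK n, w ≠ 0 → w ≠ v → 0 < form n σ k w (w - v)

theorem IsRelevant.neg (h : IsRelevant n σ k v) : IsRelevant n σ k (-v) := by
  refine ⟨neg_ne_zero.2 h.1, fun w hw hwv => ?_⟩
  have := h.2 (-w) (neg_ne_zero.2 hw) (by rintro rfl; simp at hwv)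
  rw [form_neg_left, ← form_neg_right] at this
  convert this using 2
  ring

theorem IsRelevant.cubic_mid_nonneg (h : IsRelevant n σ k v) (w : ZK n) :
    0 ≤ cubic n σ w (mid n σ v k) := by
  rw [cubic_mid]
  by_cases hw : w = 0
  · simp [hw, form]
  by_cases hwv : w = v
  · simp [hwv, form]
  exact (h.2 w hw hwv).le

/-- The equality case is applied at the midpoint of `v`. A decomposition `v = u + w` would put this
midpoint on the surface of `u ≠ v`, against relevance. -/
theorem IsObtuse.mem_six_of_isRelevant (h : IsObtuse n σ k z z') (hv : IsRelevant n σ k v) :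
    v ∈ six z z' := by
  have h0 : cubic n σ v (mid n σ v k) = 0 := by simp [cubic_mid, form]
  rcases h.cubic_eq_zero rfl (fun p _ => hv.cubic_mid_nonneg p) h0 with h1 | h1 |
    ⟨u, hu, w, hw, rfl, -, h1, -⟩
  · exact absurd h1 hv.1
  · exact h1
  · have hu0 := h.ne_zero_of_mem_six hu
    have hw0 := h.ne_zero_of_mem_six hw
    rw [cubic_mid] at h1
    exact absurd h1 (hv.2 u hu0 (by simpa using hw0)).ne'

/-- Relevance needs testing only against the six vectors: any other vanishing at the midpoint is a
sum of two orthogonal vectors of the six whose cubics vanish there. Both would equal `v`, making `v`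
orthogonal to itself. -/
theorem IsObtuse.isRelevant (h : IsObtuse n σ k z z') (hv : v ∈ six z z')
    (hf : ∀ p ∈ six z z', p ≠ v → 0 < form n σ k p (p - v)) : IsRelevant n σ k v := by
  have hc : ∀ p ∈ six z z', 0 ≤ cubic n σ p (mid n σ v k) := by
    intro p hp
    rw [cubic_mid]
    by_cases hpv : p = v
    · simp [hpv, form]
    · exact (hf p hp hpv).le
  have huniq : ∀ p ∈ six z z', cubic n σ p (mid n σ v k) = 0 → p = v := by
    intro p hp h0
    by_contra hpv
    rw [cubic_mid] at h0
    exact (hf p hp hpv).ne' h0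
  refine ⟨h.ne_zero_of_mem_six hv, fun w hw hwv => ?_⟩
  rw [← cubic_mid]
  refine lt_of_le_of_ne (h.cubic_nonneg rfl hc w) (fun h0 => ?_)
  rcases h.cubic_eq_zero rfl hc h0.symm with h1 | h1 | ⟨p, hp, q, hq, rfl, hpq, h1, h2⟩
  · exact hw h1
  · exact hwv (huniq w h1 h0.symm)
  · rw [huniq p hp h1, huniq q hq h2] at hpq
    exact (form_self_pos k (h.ne_zero_of_mem_six hv)).ne' hpq

/-- Relevance tested against `z` reads `-form z z' > 0`: the diagonal of a rectangle is not
relevant. -/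
theorem IsRelevant.form_ne_zero (h : IsRelevant n σ k (z + z')) (hz : z ≠ 0) (hz' : z' ≠ 0) :
    form n σ k z z' ≠ 0 := by
  have := h.2 z hz (by simpa using hz')
  rw [form_sub_right, form_add_right] at this
  linarith

theorem IsObtuse.isRelevant_left (h : IsObtuse n σ k z z') (h2 : 0 < form n σ k z (z + z'))
    (h3 : 0 < form n σ k z' (z + z')) : IsRelevant n σ k z := by
  have p1 := form_self_pos (σ := σ) k (ne_zero_of_emb_pos h.pos)
  have p2 := form_self_pos (σ := σ) k (ne_zero_of_emb_pos h.pos')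
  have h1 := h.obtuse
  refine h.isRelevant (by simp [six]) ?_
  intro p hp hpv
  have h4 := form_comm (σ := σ) k z' z
  rw [form_add_right] at h2 h3
  simp only [six, Set.mem_insert_iff, Set.mem_singleton_iff] at hp
  rcases hp with hp | hp | hp | hp | hp | hp
  · exact absurd hp hpv
  all_goals
    rw [hp]
    simp only [form_sub_right, form_neg_left, form_neg_right, form_add_left, form_add_right]
    linarith

theorem IsObtuse.isRelevant_add (h : IsObtuse n σ k z z') (h1 : form n σ k z z' < 0)
    (h2 : 0 < form n σ k z (z + z')) (h3 : 0 < form n σ k z' (z + z')) :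
    IsRelevant n σ k (z + z') := by
  have p1 := form_self_pos (σ := σ) k (ne_zero_of_emb_pos h.pos)
  have p2 := form_self_pos (σ := σ) k (ne_zero_of_emb_pos h.pos')
  refine h.isRelevant (by simp [six]) ?_
  intro p hp hpv
  have h4 := form_comm (σ := σ) k z' z
  rw [form_add_right] at h2 h3
  simp only [six, Set.mem_insert_iff, Set.mem_singleton_iff] at hp
  rcases hp with hp | hp | hp | hp | hp | hp
  case inr.inr.inl => exact absurd hp hpv
  all_goals
    rw [hp]
    simp only [form_sub_right, form_neg_left, form_neg_right, form_add_left, form_add_right]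
    linarith

/-! ### Levels -/

variable (n σ) in
/-- The level at which `z` and `z'` are orthogonal. -/
noncomputable def orthLevel (z z' : ZK n) : ℝ :=
  Real.sqrt (-(emb n (z * z')) / embConj n σ (z * z'))

theorem orthLevel_comm (z z' : ZK n) : orthLevel n σ z z' = orthLevel n σ z' z := by
  rw [orthLevel, orthLevel, mul_comm]

theorem IsReducedPair.arg_pos (h : IsReducedPair n σ z z') :
    0 < -(emb n (z * z')) / embConj n σ (z * z') := by
  rw [map_mul, map_mul]
  exact div_pos_of_neg_of_neg (neg_neg_of_pos (mul_pos h.pos h.pos')) h.neg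

theorem IsReducedPair.orthLevel_pos (h : IsReducedPair n σ z z') : 0 < orthLevel n σ z z' :=
  Real.sqrt_pos.2 h.arg_pos

theorem IsReducedPair.sq_orthLevel (h : IsReducedPair n σ z z') :
    orthLevel n σ z z' ^ 2 * (embConj n σ z * embConj n σ z') = -(emb n z * emb n z') := by
  rw [orthLevel, Real.sq_sqrt h.arg_pos.le, map_mul, map_mul]
  exact div_mul_cancel₀ _ h.neg.ne

/-- The factor in front is positive, so the form decreases in `k²` and changes sign at `orthLevel`.
Every comparison of levels below is read off from the sign of a form. -/
theorem IsReducedPair.form_eq (h : IsReducedPair n σ z z') (k : ℝ) :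
    form n σ k z z' = -(embConj n σ z * embConj n σ z') * (orthLevel n σ z z' ^ 2 - k ^ 2) := by
  rw [form]
  linear_combination h.sq_orthLevel

theorem IsReducedPair.form_neg_iff (h : IsReducedPair n σ z z') (hk : 0 < k) :
    form n σ k z z' < 0 ↔ orthLevel n σ z z' < k := by
  rw [h.form_eq, ← sq_lt_sq₀ h.orthLevel_pos.le hk.le, ← sub_neg (b := k ^ 2)]
  have hn := neg_pos.2 h.neg
  exact ⟨fun hm => (pos_iff_neg_of_mul_neg hm).1 hn, mul_neg_of_pos_of_neg hn⟩

theorem IsReducedPair.form_pos_iff (h : IsReducedPair n σ z z') (hk : 0 < k) :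
    0 < form n σ k z z' ↔ k < orthLevel n σ z z' := by
  rw [h.form_eq, ← sq_lt_sq₀ hk.le h.orthLevel_pos.le, ← sub_pos (b := k ^ 2)]
  exact mul_pos_iff_of_pos_left (neg_pos.2 h.neg)

theorem IsReducedPair.form_nonpos_iff (h : IsReducedPair n σ z z') (hk : 0 < k) :
    form n σ k z z' ≤ 0 ↔ orthLevel n σ z z' ≤ k := by
  rw [← not_lt, h.form_pos_iff hk, not_lt]

theorem IsReducedPair.form_nonneg_iff (h : IsReducedPair n σ z z') (hk : 0 < k) :
    0 ≤ form n σ k z z' ↔ k ≤ orthLevel n σ z z' := by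
  rw [← not_lt, h.form_neg_iff hk, not_lt]

theorem IsReducedPair.form_orthLevel (h : IsReducedPair n σ z z') :
    form n σ (orthLevel n σ z z') z z' = 0 := by
  rw [h.form_eq]; ring

/-! ### One step of the recursion -/

/-- Equality together with opposite signs would give `σ(z + z') = 0`, although `z + z' > 0`. So the
minimum in the recursion is never a tie. -/
theorem IsReducedPair.abs_lt (h : IsReducedPair n σ z z')
    (hle : |embConj n σ z| ≤ |embConj n σ z'|) : |embConj n σ z| < |embConj n σ z'| := by
  refine lt_of_le_of_ne hle fun he => ?_
  rcases abs_eq_abs.1 he with h1 | h1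
  · have h2 := h.neg
    rw [h1] at h2
    nlinarith
  · have h2 : embConj n σ (z + z') = 0 := by rw [map_add, h1]; ring
    exact embConj_ne_zero (σ := σ) (ne_zero_of_emb_pos h.add_pos) h2

/-- The conjugate of the sum has the sign of the larger conjugate. This is why `euclidStep` keeps
the smaller one: the signs of the new pair are again opposite. -/
theorem IsReducedPair.add_mul_neg (h : IsReducedPair n σ z z')
    (hle : |embConj n σ z| ≤ |embConj n σ z'|) :
    (embConj n σ z + embConj n σ z') * embConj n σ z < 0 ∧
      0 < (embConj n σ z + embConj n σ z') * embConj n σ z' := by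
  have h1 := sq_lt_sq.2 (h.abs_lt hle)
  have h2 := h.neg
  have h3 : (embConj n σ z * embConj n σ z') ^ 2 = embConj n σ z ^ 2 * embConj n σ z' ^ 2 := by ring
  have h4 := abs_mul_abs_self (embConj n σ z)
  have h5 := h.abs_lt hle
  have h6 : |embConj n σ z * embConj n σ z'| = -(embConj n σ z * embConj n σ z') :=
    abs_of_neg h2
  rw [abs_mul] at h6
  have h7 : 0 < |embConj n σ z| := by
    rw [abs_pos]; exact embConj_ne_zero (ne_zero_of_emb_pos h.pos)
  have h8 := abs_mul_abs_self (embConj n σ z')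
  constructor <;> nlinarith

theorem IsReducedPair.add (h : IsReducedPair n σ z z')
    (hle : |embConj n σ z| ≤ |embConj n σ z'|) : IsReducedPair n σ (z + z') z := by
  refine ⟨h.add_pos, h.pos, ?_, fun v => ?_⟩
  · rw [map_add]; exact (h.add_mul_neg hle).1
  · obtain ⟨a, b, hv⟩ := h.span v
    exact ⟨b, a - b, by rw [hv]; push_cast; ring⟩

/-- Both embeddings of `z'` and `z + z'` agree in sign, so this condition holds at every level. Only
the other acuteness condition depends on `k`, and it concerns precisely the successor pair `z + z',
z`. -/
theorem IsReducedPair.acute_of_abs_le (h : IsReducedPair n σ z z')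
    (hle : |embConj n σ z| ≤ |embConj n σ z'|) : 0 < form n σ k z' (z + z') := by
  have h1 := (h.add_mul_neg hle).2
  have h2 := mul_pos h.pos' h.add_pos
  rw [form, map_add (embConj n σ), mul_comm (embConj n σ z')]
  have := sq_nonneg k
  positivity

theorem IsReducedPair.step (h : IsReducedPair n σ z z') :
    IsReducedPair n σ (euclidStep n σ (z, z')).1 (euclidStep n σ (z, z')).2 := by
  simp only [euclidStep]
  split_ifs with hle
  · exact h.add hle
  · rw [add_comm]; exact h.symm.add (le_of_not_ge hle)

theorem IsReducedPair.acute_of_le (h : IsReducedPair n σ z z') (hk : 0 < k)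
    (hk' : k ≤ orthLevel n σ (euclidStep n σ (z, z')).1 (euclidStep n σ (z, z')).2) :
    0 ≤ form n σ k z (z + z') ∧ 0 ≤ form n σ k z' (z + z') := by
  simp only [euclidStep] at hk'
  split_ifs at hk' with hle
  · have := (h.add hle).form_nonneg_iff hk
    exact ⟨by rw [form_comm]; exact this.2 hk', (h.acute_of_abs_le hle).le⟩
  · have hle := le_of_not_ge hle
    have := (h.symm.add hle).form_nonneg_iff hk
    rw [add_comm z z'] at *
    exact ⟨(h.symm.acute_of_abs_le hle).le, by rw [form_comm]; exact this.2 hk'⟩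

theorem IsReducedPair.acute_of_lt (h : IsReducedPair n σ z z') (hk : 0 < k)
    (hk' : k < orthLevel n σ (euclidStep n σ (z, z')).1 (euclidStep n σ (z, z')).2) :
    0 < form n σ k z (z + z') ∧ 0 < form n σ k z' (z + z') := by
  simp only [euclidStep] at hk'
  split_ifs at hk' with hle
  · have := (h.add hle).form_pos_iff hk
    exact ⟨by rw [form_comm]; exact this.2 hk', h.acute_of_abs_le hle⟩
  · have hle := le_of_not_ge hle
    have := (h.symm.add hle).form_pos_iff hk
    rw [add_comm z z'] at *
    exact ⟨h.symm.acute_of_abs_le hle, by rw [form_comm]; exact this.2 hk'⟩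

theorem IsReducedPair.isObtuse (h : IsReducedPair n σ z z') (hk : orthLevel n σ z z' ≤ k)
    (hk' : k ≤ orthLevel n σ (euclidStep n σ (z, z')).1 (euclidStep n σ (z, z')).2) :
    IsObtuse n σ k z z' := by
  have h0 := h.orthLevel_pos.trans_le hk
  exact ⟨h, (h.form_nonpos_iff h0).2 hk, (h.acute_of_le h0 hk').1, (h.acute_of_le h0 hk').2⟩

/-- Where `z` and `z'` are orthogonal, the form of the successor pair is the square length of the
kept element. It is still positive, so the successor becomes orthogonal only later. -/
theorem IsReducedPair.orthLevel_lt_step (h : IsReducedPair n σ z z') :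
    orthLevel n σ z z' <
      orthLevel n σ (euclidStep n σ (z, z')).1 (euclidStep n σ (z, z')).2 := by
  have h0 := h.form_orthLevel
  simp only [euclidStep]
  split_ifs with hle
  · refine ((h.add hle).form_pos_iff h.orthLevel_pos).1 ?_
    rw [form_add_left, form_comm _ z' z, h0]
    linarith [form_self_pos (σ := σ) (orthLevel n σ z z') (ne_zero_of_emb_pos h.pos)]
  · have hle := le_of_not_ge hle
    have := (h.symm.add hle).form_pos_iff h.orthLevel_pos
    rw [add_comm z' z] at this
    refine this.1 ?_
    rw [form_add_left, h0]
    linarith [form_self_pos (σ := σ) (orthLevel n σ z z') (ne_zero_of_emb_pos h.pos')]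

/-- Because the conjugates have opposite signs, the quantity is the absolute determinant of the
pair, and the step is unimodular. -/
theorem IsReducedPair.invariant_step (h : IsReducedPair n σ z z') :
    emb n (euclidStep n σ (z, z')).1 * |embConj n σ (euclidStep n σ (z, z')).2| +
      emb n (euclidStep n σ (z, z')).2 * |embConj n σ (euclidStep n σ (z, z')).1| =
    emb n z * |embConj n σ z'| + emb n z' * |embConj n σ z| := by
  have key : ∀ {a b : ℝ}, a * b < 0 → |a| ≤ |b| → |a + b| = |b| - |a| := by
    intro a b hab hle
    rcases mul_neg_iff.1 hab with ⟨ha, hb⟩ | ⟨ha, hb⟩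
    · rw [abs_of_pos ha, abs_of_neg hb] at *
      rw [abs_of_nonpos (by linarith)]; ring
    · rw [abs_of_neg ha, abs_of_pos hb] at *
      rw [abs_of_nonneg (by linarith)]; ring
  simp only [euclidStep]
  split_ifs with hle
  · rw [map_add, map_add, key h.neg hle]; ring
  · rw [map_add, map_add, add_comm (embConj n σ z), key h.symm.neg (le_of_not_ge hle)]; ring

/-- The square of the level is `z z' / |σ(z) σ(z')|`, and `z z' |σ(z) σ(z')| ≤ D²` because both
terms of the determinant are at most `D`. Hence the level is at least `z z' / D`. -/
theorem IsReducedPair.le_orthLevel (h : IsReducedPair n σ z z') {D t : ℝ} (ht : 0 ≤ t) (hD : 0 < D)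
    (hD' : emb n z * |embConj n σ z'| + emb n z' * |embConj n σ z| = D)
    (ht' : t ≤ emb n z * emb n z') : t / D ≤ orthLevel n σ z z' := by
  have h1 := h.pos
  have h2 := h.pos'
  have p1 : 0 < |embConj n σ z| := abs_pos.2 (embConj_ne_zero (ne_zero_of_emb_pos h1))
  have p2 : 0 < |embConj n σ z'| := abs_pos.2 (embConj_ne_zero (ne_zero_of_emb_pos h2))
  have b1 : emb n z * |embConj n σ z'| ≤ D := by nlinarith
  have b2 : emb n z' * |embConj n σ z| ≤ D := by nlinarith
  have hs := h.sq_orthLevel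
  have h6 : |embConj n σ z| * |embConj n σ z'| = -(embConj n σ z * embConj n σ z') := by
    rw [← abs_mul, abs_of_neg h.neg]
  have hprod : (emb n z * emb n z') * (|embConj n σ z| * |embConj n σ z'|) ≤ D ^ 2 := by
    have := mul_le_mul b1 b2 (by positivity) hD.le
    nlinarith
  refine (sq_le_sq₀ (by positivity) h.orthLevel_pos.le).1 ?_
  rw [div_pow, div_le_iff₀ (by positivity)]
  have hs' : orthLevel n σ z z' ^ 2 * (|embConj n σ z| * |embConj n σ z'|) = emb n z * emb n z' := by
    rw [h6]; linarith
  have hE : 0 < emb n z * emb n z' := by positivity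
  calc t ^ 2 ≤ (emb n z * emb n z') ^ 2 := by gcongr
    _ = orthLevel n σ z z' ^ 2 * ((emb n z * emb n z') * (|embConj n σ z| * |embConj n σ z'|)) := by
      rw [sq (emb n z * emb n z')]; nth_rewrite 1 [← hs']; ring
    _ ≤ orthLevel n σ z z' ^ 2 * D ^ 2 := by gcongr

/-- An orthogonal reduced pair is the first member of every superbase that is obtuse at its level
and acute at the long diagonal. -/
theorem IsObtuse.eq_of_orthogonal (h : IsObtuse n σ k z z') (h2 : 0 < form n σ k z (z + z'))
    (h3 : 0 < form n σ k z' (z + z')) {u u' : ZK n} (hu : IsReducedPair n σ u u')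
    (h0 : form n σ k u u' = 0) (hne : u ≠ u') : (z = u ∧ z' = u') ∨ (z = u' ∧ z' = u) := by
  have pu := form_self_pos (σ := σ) k (ne_zero_of_emb_pos hu.pos)
  have pu' := form_self_pos (σ := σ) k (ne_zero_of_emb_pos hu.pos')
  have ho : IsObtuse n σ k u u' := ⟨hu, h0.le, by rw [form_add_right, h0]; linarith,
    by rw [form_add_right, form_comm k u' u, h0]; linarith⟩
  have hu2 : 0 < form n σ k u (u + u') := by rw [form_add_right, h0]; linarith
  have hu3 : 0 < form n σ k u' (u + u') := by
    rw [form_add_right, form_comm k u' u, h0]; linarith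
  have r1 : IsRelevant n σ k u := ho.isRelevant_left hu2 hu3
  have r2 : IsRelevant n σ k u' :=
    ho.symm.isRelevant_left (by rw [add_comm]; exact hu3) (by rw [add_comm]; exact hu2)
  have pos_mem : ∀ {v : ZK n}, 0 < emb n v → IsRelevant n σ k v →
      v = z ∨ v = z' ∨ (v = z + z' ∧ form n σ k z z' ≠ 0) := by
    intro v hv hr
    have hm := h.mem_six_of_isRelevant hr
    simp only [six, Set.mem_insert_iff, Set.mem_singleton_iff] at hm
    have a1 := h.pos
    have a2 := h.pos'
    have a3 := h.add_pos
    rcases hm with hm | hm | hm | hm | hm | hm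
    · exact Or.inl hm
    · exact Or.inr (Or.inl hm)
    · subst hm
      exact Or.inr (Or.inr ⟨rfl, hr.form_ne_zero (ne_zero_of_emb_pos a1) (ne_zero_of_emb_pos a2)⟩)
    all_goals
      rw [hm, map_neg] at hv
      linarith
  -- Both `u` and `u'` lie in `{z, z', z + z'}`. Neither is `z + z'`, which is not orthogonal to `z`
  -- or `z'` by `h2` and `h3`.
  rcases pos_mem hu.pos r1 with rfl | rfl | ⟨rfl, hz⟩ <;>
    rcases pos_mem hu.pos' r2 with rfl | rfl | ⟨rfl, hz'⟩
  · exact absurd rfl hne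
  · exact Or.inl ⟨rfl, rfl⟩
  · exact absurd h0 h2.ne'
  · exact Or.inr ⟨rfl, rfl⟩
  · exact absurd rfl hne
  · exact absurd h0 h3.ne'
  · rw [form_comm] at h0; exact absurd h0 h2.ne'
  · rw [form_comm] at h0; exact absurd h0 h3.ne'
  · exact absurd rfl hne

end HilbertCusp

namespace HilbertCusp

variable {n : ℕ} {σ : QuadField n ≃ₐ[ℚ] QuadField n} {k : ℝ} {z z' v w : ZK n}

theorem IsObtuse.isRelevant_of_strict (h : IsObtuse n σ k z z') (h1 : form n σ k z z' < 0)
    (h2 : 0 < form n σ k z (z + z')) (h3 : 0 < form n σ k z' (z + z')) (hv : v ∈ six z z') :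
    IsRelevant n σ k v := by
  have r1 := h.isRelevant_left h2 h3
  have r2 := h.symm.isRelevant_left (by rwa [add_comm]) (by rwa [add_comm])
  have r3 := h.isRelevant_add h1 h2 h3
  simp only [six, Set.mem_insert_iff, Set.mem_singleton_iff] at hv
  rcases hv with rfl | rfl | rfl | rfl | rfl | rfl
  exacts [r1, r2, r3, r1.neg, r2.neg, r3.neg]

/-! ### The sequence of pairs -/

theorem zpair_one : zpair n σ 1 = (1, alpha n) := rfl

theorem zpair_succ {i : ℕ} (hi : 1 ≤ i) : zpair n σ (i + 1) = euclidStep n σ (zpair n σ i) := by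
  obtain ⟨j, rfl⟩ : ∃ j, i = j + 1 := ⟨i - 1, by omega⟩
  simp only [zpair, Nat.add_sub_cancel]
  exact Function.iterate_succ_apply' _ _ _

theorem zpair_succ_fst {i : ℕ} (hi : 1 ≤ i) :
    (zpair n σ (i + 1)).1 = (zpair n σ i).1 + (zpair n σ i).2 := by
  rw [zpair_succ hi]; rfl

theorem zpair_succ_snd {i : ℕ} (hi : 1 ≤ i) :
    (zpair n σ (i + 1)).2 = (zpair n σ i).1 ∨ (zpair n σ (i + 1)).2 = (zpair n σ i).2 := by
  rw [zpair_succ hi]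
  simp only [euclidStep]
  split_ifs
  · exact Or.inl rfl
  · exact Or.inr rfl

theorem isReducedPair_one_alpha (hn : 1 < n) (hsq : Squarefree n) (hσ : σ ≠ 1) :
    IsReducedPair n σ 1 (alpha n) := by
  refine ⟨by simp, zero_lt_one.trans (one_lt_emb_alpha hn), ?_, fun v => ?_⟩
  · rw [map_one, one_mul]; exact embConj_alpha_neg hn hσ
  · obtain ⟨a, b, h⟩ := exists_int_add_mul_alpha hsq hσ v
    exact ⟨a, b, by rw [h, mul_one]⟩

theorem isReducedPair_zpair (hn : 1 < n) (hsq : Squarefree n) (hσ : σ ≠ 1) (i : ℕ) :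
    IsReducedPair n σ (zpair n σ i).1 (zpair n σ i).2 := by
  have key : ∀ j, IsReducedPair n σ (zpair n σ (j + 1)).1 (zpair n σ (j + 1)).2 := by
    intro j
    induction j with
    | zero => exact isReducedPair_one_alpha hn hsq hσ
    | succ j ih => rw [zpair_succ (by omega)]; exact ih.step
  -- Index `0` gives the pair of index `1`, because `i - 1` is truncated.
  rcases Nat.eq_zero_or_pos i with rfl | hi
  · exact key 0
  · obtain ⟨j, rfl⟩ : ∃ j, i = j + 1 := ⟨i - 1, by omega⟩
    exact key j

theorem level_eq (i : ℕ) : level n σ i = orthLevel n σ (zpair n σ i).1 (zpair n σ i).2 := rfl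

theorem level_lt_succ (hn : 1 < n) (hsq : Squarefree n) (hσ : σ ≠ 1) {i : ℕ} (hi : 1 ≤ i) :
    level n σ i < level n σ (i + 1) := by
  rw [level_eq, level_eq, zpair_succ hi]
  exact (isReducedPair_zpair hn hsq hσ i).orthLevel_lt_step

theorem level_lt (hn : 1 < n) (hsq : Squarefree n) (hσ : σ ≠ 1) {i j : ℕ} (hi : 1 ≤ i)
    (hij : i < j) : level n σ i < level n σ j := by
  induction j, hij using Nat.le_induction with
  | base => exact level_lt_succ hn hsq hσ hi
  | succ j hj ih => exact ih.trans (level_lt_succ hn hsq hσ (by omega))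

theorem level_le (hn : 1 < n) (hsq : Squarefree n) (hσ : σ ≠ 1) {i j : ℕ} (hi : 1 ≤ i)
    (hij : i ≤ j) : level n σ i ≤ level n σ j := by
  rcases hij.eq_or_lt with rfl | h
  · exact le_rfl
  · exact (level_lt hn hsq hσ hi h).le

/-- The determinant `D` is constant, while the first entry grows at least linearly and the second
stays at least `1`; so `le_orthLevel` bounds the levels below by a linear function of the index. -/
theorem exists_level_gt (hn : 1 < n) (hsq : Squarefree n) (hσ : σ ≠ 1) (t : ℝ) :
    ∃ i, 1 ≤ i ∧ t < level n σ i := by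
  set D : ℝ := emb n 1 * |embConj n σ (alpha n)| + emb n (alpha n) * |embConj n σ 1| with hDdef
  have hα := one_lt_emb_alpha hn
  have hD : 0 < D := by
    have := abs_nonneg (embConj n σ (alpha n))
    rw [hDdef, map_one, map_one, abs_one]
    linarith
  have key : ∀ j : ℕ, ((j : ℝ) + 1 ≤ emb n (zpair n σ (j + 1)).1 ∧
      1 ≤ emb n (zpair n σ (j + 1)).2) ∧
      emb n (zpair n σ (j + 1)).1 * |embConj n σ (zpair n σ (j + 1)).2| +
        emb n (zpair n σ (j + 1)).2 * |embConj n σ (zpair n σ (j + 1)).1| = D := by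
    intro j
    induction j with
    | zero => exact ⟨⟨by simp [zpair_one], hα.le⟩, rfl⟩
    | succ j ih =>
      obtain ⟨⟨h1, h2⟩, h3⟩ := ih
      have hj : (0 : ℝ) ≤ j := Nat.cast_nonneg j
      refine ⟨⟨?_, ?_⟩, ?_⟩
      · rw [zpair_succ_fst (by omega), map_add]; push_cast; linarith
      · rcases zpair_succ_snd (σ := σ) (i := j + 1) (by omega) with h | h <;> rw [h] <;> linarith
      · rw [zpair_succ (by omega), ← h3]
        exact (isReducedPair_zpair hn hsq hσ (j + 1)).invariant_step
  obtain ⟨j, hj⟩ := exists_nat_gt (t * D)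
  obtain ⟨⟨h1, h2⟩, h3⟩ := key j
  refine ⟨j + 1, by omega, ?_⟩
  have hj0 : (0 : ℝ) ≤ j := Nat.cast_nonneg j
  have := (isReducedPair_zpair hn hsq hσ (j + 1)).le_orthLevel (t := j) hj0 hD h3 (by nlinarith)
  refine lt_of_lt_of_le ?_ this
  rwa [lt_div_iff₀ hD]

/-! ### Multiplication by `ε²` -/

theorem emb_sq_mul (ε : (ZK n)ˣ) (v : ZK n) :
    emb n ((ε : ZK n) ^ 2 * v) = emb n ε ^ 2 * emb n v := by
  rw [map_mul, map_pow]

theorem emb_sq_mul_embConj_sq_mul (hsq : Squarefree n) (hσ : σ ≠ 1) (ε : (ZK n)ˣ) (v : ZK n) :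
    emb n ε ^ 2 * embConj n σ ((ε : ZK n) ^ 2 * v) = embConj n σ v := by
  rw [map_mul, map_pow, ← mul_assoc, sq_emb_mul_sq_embConj_unit hsq hσ ε, one_mul]

theorem IsReducedPair.unit_sq_mul (h : IsReducedPair n σ z z') (ε : (ZK n)ˣ) :
    IsReducedPair n σ ((ε : ZK n) ^ 2 * z) ((ε : ZK n) ^ 2 * z') := by
  have h1 : emb n ε ≠ 0 := emb_ne_zero ε.ne_zero
  have h2 : embConj n σ ε ≠ 0 := embConj_ne_zero ε.ne_zero
  refine ⟨?_, ?_, ?_, fun v => ?_⟩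
  · rw [emb_sq_mul]; have := h.pos; positivity
  · rw [emb_sq_mul]; have := h.pos'; positivity
  · have : embConj n σ ((ε : ZK n) ^ 2 * z) * embConj n σ ((ε : ZK n) ^ 2 * z') =
        embConj n σ ε ^ 4 * (embConj n σ z * embConj n σ z') := by
      simp only [map_mul, map_pow]; ring
    rw [this]
    exact mul_neg_of_pos_of_neg (by positivity) h.neg
  · obtain ⟨a, b, hv⟩ := h.span (((ε⁻¹ : (ZK n)ˣ) : ZK n) ^ 2 * v)
    refine ⟨a, b, ?_⟩
    have hu : (ε : ZK n) ^ 2 * ((ε⁻¹ : (ZK n)ˣ) : ZK n) ^ 2 = 1 := by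
      rw [← mul_pow, Units.mul_inv, one_pow]
    calc v = (ε : ZK n) ^ 2 * (((ε⁻¹ : (ZK n)ˣ) : ZK n) ^ 2 * v) := by
          rw [← mul_assoc, hu, one_mul]
      _ = _ := by rw [hv]; ring

/-- Since `ε² σ(ε)² = 1`, scaling the level by `ε⁴` compensates for the conjugate. This makes the
sequence of pairs periodic up to multiplication by `ε²`. -/
theorem form_unit_sq_mul (hsq : Squarefree n) (hσ : σ ≠ 1) (ε : (ZK n)ˣ) (k : ℝ) (v w : ZK n) :
    form n σ (emb n ε ^ 4 * k) ((ε : ZK n) ^ 2 * v) ((ε : ZK n) ^ 2 * w) =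
      emb n ε ^ 4 * form n σ k v w := by
  have h1 := emb_sq_mul_embConj_sq_mul hsq hσ ε v
  have h2 := emb_sq_mul_embConj_sq_mul hsq hσ ε w
  simp only [form, emb_sq_mul]
  rw [← h1, ← h2]; ring

theorem IsReducedPair.eq_orthLevel (h : IsReducedPair n σ z z') (hk : 0 < k)
    (h0 : form n σ k z z' = 0) : orthLevel n σ z z' = k :=
  le_antisymm ((h.form_nonpos_iff hk).1 h0.le) ((h.form_nonneg_iff hk).1 h0.ge)

theorem IsReducedPair.orthLevel_unit_sq_mul (h : IsReducedPair n σ z z') (hsq : Squarefree n)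
    (hσ : σ ≠ 1) (ε : (ZK n)ˣ) :
    orthLevel n σ ((ε : ZK n) ^ 2 * z) ((ε : ZK n) ^ 2 * z') =
      emb n ε ^ 4 * orthLevel n σ z z' := by
  have h1 : emb n ε ≠ 0 := emb_ne_zero ε.ne_zero
  have h2 := h.orthLevel_pos
  refine (h.unit_sq_mul ε).eq_orthLevel (by positivity) ?_
  rw [form_unit_sq_mul hsq hσ, h.form_orthLevel, mul_zero]

/-! ### The end of the recursion -/

/-- The pair `ε², ε² α` is reduced and orthogonal at `κ = ε⁴ k_1`. The last pair of the sequence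
with level at most `κ` is an obtuse superbase at `κ` with strict acuteness, so
`IsObtuse.eq_of_orthogonal` identifies the two. -/
theorem exists_mem_stopIndices (hn : 1 < n) (hsq : Squarefree n) (hσ : σ ≠ 1) {ε : (ZK n)ˣ}
    (hε : IsFundamentalUnit n ε) : (stopIndices n σ ε).Nonempty := by
  set κ := emb n ε ^ 4 * level n σ 1 with hκ
  have hred := (isReducedPair_one_alpha hn hsq hσ).unit_sq_mul ε
  have hκ' : orthLevel n σ ((ε : ZK n) ^ 2 * 1) ((ε : ZK n) ^ 2 * alpha n) = κ :=
    (isReducedPair_one_alpha hn hsq hσ).orthLevel_unit_sq_mul hsq hσ ε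
  have hκ0 : 0 < κ := hκ' ▸ hred.orthLevel_pos
  have hl1 : 0 < level n σ 1 := (isReducedPair_zpair hn hsq hσ 1).orthLevel_pos
  have h1κ : level n σ 1 ≤ κ := le_mul_of_one_le_left hl1.le (one_le_pow₀ hε.one_lt.le)
  classical
  have hex : ∃ i, κ < level n σ (i + 1) := by
    obtain ⟨i, hi, h⟩ := exists_level_gt hn hsq hσ κ
    exact ⟨i - 1, by rwa [Nat.sub_add_cancel hi]⟩
  obtain ⟨j, hj⟩ : ∃ j, Nat.find hex = j + 1 := by
    refine Nat.exists_eq_succ_of_ne_zero fun h0 => ?_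
    have := Nat.find_spec hex
    rw [h0] at this
    exact absurd h1κ (not_le.2 this)
  have hlt := Nat.find_spec hex
  have hle := Nat.find_min hex (m := j) (by omega)
  rw [hj] at hlt
  rw [not_lt] at hle
  have hr := isReducedPair_zpair hn hsq hσ (j + 1)
  rw [level_eq, zpair_succ (by omega)] at hlt
  have hacute := hr.acute_of_lt hκ0 hlt
  have hobt := hr.isObtuse hle hlt.le
  have h0 : form n σ κ ((ε : ZK n) ^ 2 * 1) ((ε : ZK n) ^ 2 * alpha n) = 0 :=
    hκ' ▸ hred.form_orthLevel
  have hne : (ε : ZK n) ^ 2 * 1 ≠ (ε : ZK n) ^ 2 * alpha n := by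
    intro he
    have hu : (ε : ZK n) ^ 2 ≠ 0 := pow_ne_zero 2 ε.ne_zero
    have := congrArg (emb n) (mul_left_cancel₀ hu he)
    rw [map_one] at this
    exact (one_lt_emb_alpha hn).ne this
  refine ⟨j + 1, by omega, ?_⟩
  rw [Set.pair_eq_pair_iff]
  have := hobt.eq_of_orthogonal hacute.1 hacute.2 hred h0 hne
  rwa [mul_one] at this

section Stop

variable {ε : (ZK n)ˣ} {m : ℕ}

theorem one_lt_of_mem_stopIndices (hn : 1 < n) (hε : IsFundamentalUnit n ε)
    (hm : m ∈ stopIndices n σ ε) : 1 < m := by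
  refine lt_of_le_of_ne hm.1 ?_
  rintro rfl
  have h2 := hm.2
  rw [Set.pair_eq_pair_iff, zpair_one] at h2
  have h1 := hε.one_lt
  have ha := one_lt_emb_alpha hn
  rcases h2 with ⟨h, -⟩ | ⟨h, -⟩ <;> have h := congrArg (emb n) h <;>
    simp only [map_one, map_pow, map_mul] at h <;> nlinarith

theorem level_stop (hn : 1 < n) (hsq : Squarefree n) (hσ : σ ≠ 1)
    (hm : m ∈ stopIndices n σ ε) : level n σ m = emb n ε ^ 4 * level n σ 1 := by
  have h := (isReducedPair_one_alpha hn hsq hσ).orthLevel_unit_sq_mul hsq hσ ε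
  rw [mul_one] at h
  have h2 := hm.2
  rw [Set.pair_eq_pair_iff] at h2
  rw [level_eq, level_eq, zpair_one, ← h]
  rcases h2 with ⟨h1, h2⟩ | ⟨h1, h2⟩ <;> rw [h1, h2]
  exact orthLevel_comm _ _

theorem level_one_of_ne_one (hn : 1 < n) (hsq : Squarefree n) (hσ : σ ≠ 1) (h : n % 4 ≠ 1) :
    level n σ 1 = 1 := by
  refine (isReducedPair_one_alpha hn hsq hσ).eq_orthLevel one_pos ?_
  simp only [form, map_one, emb_alpha_of_ne_one h, embConj_alpha_of_ne_one hσ h]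
  ring

theorem embConj_alpha_sub_one (hσ : σ ≠ 1) (h : n % 4 = 1) :
    embConj n σ (alpha n - 1) = -emb n (alpha n) := by
  rw [map_sub, map_one, embConj_alpha_of_one hσ h, emb_alpha_of_one h]; ring

/-- For `n ≡ 1 mod 4` the first level exceeds `1`, and the levels below it need the pair that
precedes `(1, α)`. Its level is below `1`, and its step is `(1, α)` with the entries swapped. -/
theorem isReducedPair_one_alpha_sub_one (hn : 1 < n) (hsq : Squarefree n) (hσ : σ ≠ 1)
    (h : n % 4 = 1) : IsReducedPair n σ 1 (alpha n - 1) := by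
  have h0 := isReducedPair_one_alpha hn hsq hσ
  have ha := one_lt_emb_alpha hn
  refine ⟨h0.pos, by rw [map_sub, map_one]; linarith, ?_, fun v => ?_⟩
  · rw [embConj_alpha_sub_one hσ h, map_one]; linarith
  · obtain ⟨a, b, hv⟩ := h0.span v
    exact ⟨a + b, b, by rw [hv]; push_cast; ring⟩

theorem orthLevel_one_alpha_sub_one_lt (hn : 1 < n) (hsq : Squarefree n) (hσ : σ ≠ 1)
    (h : n % 4 = 1) : orthLevel n σ 1 (alpha n - 1) < 1 := by
  refine ((isReducedPair_one_alpha_sub_one hn hsq hσ h).form_neg_iff one_pos).1 ?_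
  simp only [form, embConj_alpha_sub_one hσ h, map_one, map_sub]
  linarith

theorem euclidStep_one_alpha_sub_one (hn : 1 < n) (hσ : σ ≠ 1) (h : n % 4 = 1) :
    euclidStep n σ (1, alpha n - 1) = (alpha n, 1) := by
  have ha := one_lt_emb_alpha hn
  have h1 : |embConj n σ 1| ≤ |embConj n σ (alpha n - 1)| := by
    rw [embConj_alpha_sub_one hσ h, map_one, abs_one, abs_neg, abs_of_pos (by linarith)]
    exact ha.le
  simp only [euclidStep, h1, if_true]
  rw [add_sub_cancel]

theorem one_lt_level_one_of_one (hn : 1 < n) (hσ : σ ≠ 1) (hsq : Squarefree n) (h : n % 4 = 1) :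
    1 < level n σ 1 := by
  refine ((isReducedPair_one_alpha hn hsq hσ).form_pos_iff one_pos).1 ?_
  simp only [form, map_one, emb_alpha_of_one h, embConj_alpha_of_one hσ h]
  linarith

theorem one_le_level (hn : 1 < n) (hsq : Squarefree n) (hσ : σ ≠ 1) {i : ℕ} (hi : 1 ≤ i) :
    1 ≤ level n σ i := by
  refine le_trans ?_ (level_le hn hsq hσ le_rfl hi)
  by_cases h : n % 4 = 1
  · exact (one_lt_level_one_of_one hn hσ hsq h).le
  · exact (level_one_of_ne_one hn hsq hσ h).ge

theorem level_stop_of_ne_one (hn : 1 < n) (hsq : Squarefree n) (hσ : σ ≠ 1)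
    (hm : m ∈ stopIndices n σ ε) (h : n % 4 ≠ 1) : level n σ m = emb n ε ^ 4 := by
  rw [level_stop hn hsq hσ hm, level_one_of_ne_one hn hsq hσ h, mul_one]

theorem lt_level_stop_of_one (hn : 1 < n) (hsq : Squarefree n) (hσ : σ ≠ 1)
    (hε : IsFundamentalUnit n ε) (hm : m ∈ stopIndices n σ ε) (h : n % 4 = 1) :
    emb n ε ^ 4 < level n σ m := by
  rw [level_stop hn hsq hσ hm]
  have h1 := hε.one_lt
  exact lt_mul_of_one_lt_right (by positivity) (one_lt_level_one_of_one hn hσ hsq h)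

theorem level_lt_of_lt_stop (hn : 1 < n) (hsq : Squarefree n) (hσ : σ ≠ 1)
    (hε : IsFundamentalUnit n ε) (hm : m ∈ stopIndices n σ ε) {i : ℕ} (hi : 1 ≤ i) (him : i < m) :
    level n σ i < emb n ε ^ 4 := by
  by_cases h : n % 4 = 1
  · obtain ⟨j, rfl⟩ : ∃ j, m = j + 1 := ⟨m - 1, by omega⟩
    have hj : 1 ≤ j := by omega
    -- It suffices to treat `j = m - 1`. Its pair is `ε²` times `{1, α - 1}`, because `z_m` is a sum
    -- and must be the larger element `ε² α`; hence its level is `ε⁴` times a number below `1`.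
    refine (level_le hn hsq hσ hi (by omega : i ≤ j)).trans_lt ?_
    have h1 := hε.one_lt
    have key : level n σ j = emb n ε ^ 4 * orthLevel n σ 1 (alpha n - 1) := by
      rw [← (isReducedPair_one_alpha_sub_one hn hsq hσ h).orthLevel_unit_sq_mul hsq hσ ε, level_eq]
      have hr := isReducedPair_zpair hn hsq hσ j
      have p1 := hr.pos
      have p2 := hr.pos'
      have ha := one_lt_emb_alpha hn
      have h2 := hm.2
      rw [Set.pair_eq_pair_iff, zpair_succ_fst hj] at h2
      rcases h2 with ⟨e1, e2⟩ | ⟨e1, e2⟩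
      -- The sum cannot be `ε²`: it exceeds both summands, and one of them would be `ε² α > ε²`.
      · exfalso
        have e1' := congrArg (emb n) e1
        have e2' := congrArg (emb n) e2
        simp only [map_add, map_mul, map_pow] at e1' e2'
        have hlt : emb n ε ^ 2 < emb n ε ^ 2 * emb n (alpha n) :=
          lt_mul_of_one_lt_right (by positivity) ha
        rcases zpair_succ_snd (σ := σ) hj with e3 | e3 <;> rw [e3] at e2' <;> linarith
      · rcases zpair_succ_snd (σ := σ) hj with e3 | e3 <;> rw [e3] at e2
        · rw [e2] at e1 ⊢
          rw [eq_sub_of_add_eq' e1]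
          congr 1 <;> ring
        · rw [e2] at e1 ⊢
          rw [eq_sub_of_add_eq e1, orthLevel_comm]
          congr 1 <;> ring
    rw [key]
    exact mul_lt_of_lt_one_right (by positivity) (orthLevel_one_alpha_sub_one_lt hn hsq hσ h)
  · rw [← level_stop_of_ne_one hn hsq hσ hm h]
    exact level_lt hn hsq hσ hi him

/-! ### The list `L` -/

theorem neg_mem_sideList (hv : v ∈ sideList n σ m) : -v ∈ sideList n σ m := by
  rcases hv with ⟨i, h1, h2, h⟩ | ⟨h1, h⟩
  · refine Or.inl ⟨i, h1, h2, ?_⟩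
    rcases h with h | h | h | h <;> simp [h]
  · refine Or.inr ⟨h1, ?_⟩
    rcases h with h | h <;> simp [h]

theorem six_zpair_subset_sideList {i : ℕ} (hi : 1 ≤ i) (him : i < m) :
    six (zpair n σ i).1 (zpair n σ i).2 ⊆ sideList n σ m := by
  have h1 : (zpair n σ i).1 ∈ sideList n σ m := Or.inl ⟨i, hi, him.le, by simp⟩
  have h2 : (zpair n σ i).2 ∈ sideList n σ m := Or.inl ⟨i, hi, him.le, by simp⟩
  have h3 : (zpair n σ i).1 + (zpair n σ i).2 ∈ sideList n σ m :=
    Or.inl ⟨i + 1, by omega, him, by rw [zpair_succ_fst hi]; simp⟩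
  intro v hv
  simp only [six, Set.mem_insert_iff, Set.mem_singleton_iff] at hv
  rcases hv with rfl | rfl | rfl | rfl | rfl | rfl
  exacts [h1, h2, h3, neg_mem_sideList h1, neg_mem_sideList h2, neg_mem_sideList h3]

theorem six_one_alpha_sub_one_subset_sideList (hσ : σ ≠ 1) (h : n % 4 = 1) (hm : 1 ≤ m) :
    six 1 (alpha n - 1) ⊆ sideList n σ m := by
  have h1 : (1 : ZK n) ∈ sideList n σ m := Or.inl ⟨1, le_rfl, hm, by simp [zpair_one]⟩
  have h2 : alpha n - 1 ∈ sideList n σ m :=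
    Or.inr ⟨h, by rw [conjZK_alpha_of_one hσ h]; simp⟩
  have h3 : (1 : ZK n) + (alpha n - 1) ∈ sideList n σ m :=
    Or.inl ⟨1, le_rfl, hm, by simp [zpair_one]⟩
  intro v hv
  simp only [six, Set.mem_insert_iff, Set.mem_singleton_iff] at hv
  rcases hv with rfl | rfl | rfl | rfl | rfl | rfl
  exacts [h1, h2, h3, neg_mem_sideList h1, neg_mem_sideList h2, neg_mem_sideList h3]

theorem finite_sideList (n : ℕ) (σ : QuadField n ≃ₐ[ℚ] QuadField n) (m : ℕ) :
    (sideList n σ m).Finite := by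
  have hfin : (⋃ i ∈ Set.Icc 1 m, ({(zpair n σ i).1, -(zpair n σ i).1, (zpair n σ i).2,
      -(zpair n σ i).2} : Set (ZK n))).Finite :=
    Set.Finite.biUnion (Set.finite_Icc 1 m) fun i _ => Set.toFinite _
  refine (hfin.union (Set.toFinite {conjZK n σ (alpha n), -conjZK n σ (alpha n)})).subset ?_
  rintro v (⟨i, h1, h2, h⟩ | ⟨-, h⟩)
  · exact Or.inl (Set.mem_biUnion (x := i) ⟨h1, h2⟩ (by simpa using h))
  · exact Or.inr (by simpa using h)

theorem exists_between_steps {f : ℕ → ℝ} {m : ℕ} (hm : 1 < m) (h1 : f 1 ≤ k) (h2 : k ≤ f m) :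
    ∃ i, 1 ≤ i ∧ i < m ∧ f i ≤ k ∧ k ≤ f (i + 1) := by
  induction m, hm using Nat.le_induction with
  | base => exact ⟨1, le_rfl, by omega, h1, h2⟩
  | succ m hm ih =>
    rcases le_total k (f m) with h | h
    · obtain ⟨i, a, b, c, d⟩ := ih h
      exact ⟨i, a, by omega, c, d⟩
    · exact ⟨m, by omega, by omega, h, h2⟩

/-- At every level of the cusp section there is an obtuse superbase with partial sums in `L`. -/
theorem exists_isObtuse (hn : 1 < n) (hsq : Squarefree n) (hσ : σ ≠ 1)
    (hε : IsFundamentalUnit n ε) (hm : m ∈ stopIndices n σ ε)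
    (hk : k ∈ Set.Icc (1 : ℝ) (emb n ε ^ 4)) :
    ∃ z z' : ZK n, IsObtuse n σ k z z' ∧ six z z' ⊆ sideList n σ m ∧
      ((∀ i, 1 ≤ i → i < m → k ≠ level n σ i) → (n % 4 ≠ 1 → k ≠ emb n ε ^ 4) →
        form n σ k z z' < 0 ∧ 0 < form n σ k z (z + z') ∧ 0 < form n σ k z' (z + z')) := by
  have hm1 := one_lt_of_mem_stopIndices hn hε hm
  have hk0 : 0 < k := one_pos.trans_le hk.1
  -- The sequence serves the levels in `[k_1, k_m]`. What remains is `[1, k_1]` for `n ≡ 1 mod 4`,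
  -- where `1, α - 1` is used.
  have main : level n σ 1 ≤ k → k ≤ level n σ m → (n % 4 = 1 → k ≠ level n σ m) →
    ∃ z z' : ZK n, IsObtuse n σ k z z' ∧ six z z' ⊆ sideList n σ m ∧
      ((∀ i, 1 ≤ i → i < m → k ≠ level n σ i) → (n % 4 ≠ 1 → k ≠ emb n ε ^ 4) →
        form n σ k z z' < 0 ∧ 0 < form n σ k z (z + z') ∧ 0 < form n σ k z' (z + z')) := by
    intro h1 h2 h3
    obtain ⟨i, hi, him, ha, hb⟩ := exists_between_steps hm1 h1 h2
    have hr := isReducedPair_zpair hn hsq hσ i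
    have hb' := hb
    rw [level_eq (i + 1), zpair_succ hi] at hb'
    refine ⟨_, _, hr.isObtuse ha hb', six_zpair_subset_sideList hi him, fun hne hne' => ?_⟩
    have hlt : k < level n σ (i + 1) := by
      refine lt_of_le_of_ne hb ?_
      rcases (Nat.succ_le_of_lt him).eq_or_lt with he | hlt
      · by_cases h : n % 4 = 1
        · have := h3 h
          rwa [← he] at this
        · have := hne' h
          rwa [← level_stop_of_ne_one hn hsq hσ hm h, ← he] at this
      · exact hne _ (by omega) hlt
    rw [level_eq, zpair_succ hi] at hlt
    exact ⟨(hr.form_neg_iff hk0).2 (lt_of_le_of_ne ha (hne i hi him).symm), hr.acute_of_lt hk0 hlt⟩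
  by_cases h : n % 4 = 1
  · have hlast := lt_level_stop_of_one hn hsq hσ hε hm h
    rcases le_total (level n σ 1) k with h1 | h1
    · exact main h1 (hk.2.trans hlast.le) fun _ => (hk.2.trans_lt hlast).ne
    · have hr := isReducedPair_one_alpha_sub_one hn hsq hσ h
      have ho := orthLevel_one_alpha_sub_one_lt hn hsq hσ h
      have hstep := euclidStep_one_alpha_sub_one hn hσ h
      have hl : level n σ 1 = orthLevel n σ (euclidStep n σ (1, alpha n - 1)).1
          (euclidStep n σ (1, alpha n - 1)).2 := by
        rw [hstep]; exact orthLevel_comm _ _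
      refine ⟨_, _, hr.isObtuse (ho.le.trans hk.1) (hl ▸ h1),
        six_one_alpha_sub_one_subset_sideList hσ h hm1.le, fun hne _ => ?_⟩
      exact ⟨(hr.form_neg_iff hk0).2 (ho.trans_le hk.1),
        hr.acute_of_lt hk0 (hl ▸ lt_of_le_of_ne h1 (hne 1 le_rfl hm1))⟩
  · exact main (by rw [level_one_of_ne_one hn hsq hσ h]; exact hk.1)
      (by rw [level_stop_of_ne_one hn hsq hσ hm h]; exact hk.2) (fun h' => absurd h' h)

/-- Every element of `L` is relevant at some level in the interior of the cusp section. -/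
theorem exists_isRelevant (hn : 1 < n) (hsq : Squarefree n) (hσ : σ ≠ 1)
    (hε : IsFundamentalUnit n ε) (hm : m ∈ stopIndices n σ ε) (hv : v ∈ sideList n σ m) :
    ∃ k ∈ Set.Ioo (1 : ℝ) (emb n ε ^ 4), IsRelevant n σ k v := by
  have hm1 := one_lt_of_mem_stopIndices hn hε hm
  have main : ∀ {i : ℕ}, 1 ≤ i → i < m → ∀ {v : ZK n}, v ∈ six (zpair n σ i).1 (zpair n σ i).2 →
      ∃ k ∈ Set.Ioo (1 : ℝ) (emb n ε ^ 4), IsRelevant n σ k v := by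
    intro i hi him v hv
    have hr := isReducedPair_zpair hn hsq hσ i
    -- Strictly between `k_i` and `k_{i+1}`, and below `ε⁴`, all three conditions on the superbase
    -- are strict.
    obtain ⟨k, hk1, hk2⟩ := exists_between
      (lt_min (level_lt_succ hn hsq hσ hi) (level_lt_of_lt_stop hn hsq hσ hε hm hi him))
    have hk3 := hk2.trans_le (min_le_left _ _)
    have hk4 : 1 < k := (one_le_level hn hsq hσ hi).trans_lt hk1
    rw [level_eq (i + 1), zpair_succ hi] at hk3
    have hac := hr.acute_of_lt (by linarith) hk3
    exact ⟨k, ⟨hk4, hk2.trans_le (min_le_right _ _)⟩, (hr.isObtuse hk1.le hk3.le).isRelevant_of_strict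
      ((hr.form_neg_iff (by linarith)).2 hk1) hac.1 hac.2 hv⟩
  have pm : ∀ {i : ℕ}, 1 ≤ i → i ≤ m → ∀ {u : ZK n}, (u = (zpair n σ i).1 ∨ u = (zpair n σ i).2) →
      ∃ k ∈ Set.Ioo (1 : ℝ) (emb n ε ^ 4), IsRelevant n σ k u := by
    intro i hi him u hu
    -- The elements of index `m` are already among the six vectors of index `m - 1`.
    rcases him.eq_or_lt with rfl | him
    · obtain ⟨j, rfl⟩ : ∃ j, i = j + 1 := ⟨i - 1, by omega⟩
      have hj : 1 ≤ j := by omega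
      refine main hj (by omega) ?_
      rcases hu with rfl | rfl
      · rw [zpair_succ_fst hj]; simp [six]
      · rcases zpair_succ_snd (σ := σ) hj with e | e <;> rw [e] <;> simp [six]
    · refine main hi him ?_
      rcases hu with rfl | rfl <;> simp [six]
  have hneg : ∀ {v : ZK n}, (∃ k ∈ Set.Ioo (1 : ℝ) (emb n ε ^ 4), IsRelevant n σ k v) →
      ∃ k ∈ Set.Ioo (1 : ℝ) (emb n ε ^ 4), IsRelevant n σ k (-v) := by
    rintro v ⟨k, hk, h⟩
    exact ⟨k, hk, h.neg⟩
  rcases hv with ⟨i, hi, him, h⟩ | ⟨h, hv⟩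
  · rcases h with rfl | rfl | rfl | rfl
    · exact pm hi him (Or.inl rfl)
    · exact hneg (pm hi him (Or.inl rfl))
    · exact pm hi him (Or.inr rfl)
    · exact hneg (pm hi him (Or.inr rfl))
  · have hr := isReducedPair_one_alpha_sub_one hn hsq hσ h
    have ho := orthLevel_one_alpha_sub_one_lt hn hsq hσ h
    obtain ⟨k, hk1, hk2⟩ := exists_between (lt_min (one_lt_level_one_of_one hn hσ hsq h)
      (one_lt_pow₀ hε.one_lt four_ne_zero))
    have hk3 := hk2.trans_le (min_le_left _ _)
    have hl : level n σ 1 = orthLevel n σ (euclidStep n σ (1, alpha n - 1)).1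
        (euclidStep n σ (1, alpha n - 1)).2 := by
      rw [euclidStep_one_alpha_sub_one hn hσ h]; exact orthLevel_comm _ _
    rw [hl] at hk3
    have hac := hr.acute_of_lt (by linarith) hk3
    have hrel : ∀ v ∈ six 1 (alpha n - 1), IsRelevant n σ k v := fun v hv =>
      (hr.isObtuse (ho.trans hk1).le hk3.le).isRelevant_of_strict
        ((hr.form_neg_iff (by linarith)).2 (ho.trans hk1)) hac.1 hac.2 hv
    refine ⟨k, ⟨hk1, hk2.trans_le (min_le_right _ _)⟩, hrel v ?_⟩
    rw [conjZK_alpha_of_one hσ h] at hv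
    rcases hv with rfl | rfl <;> simp [six]

theorem ne_zero_of_mem_sideList (hn : 1 < n) (hsq : Squarefree n) (hσ : σ ≠ 1)
    (hε : IsFundamentalUnit n ε) (hm : m ∈ stopIndices n σ ε) (hv : v ∈ sideList n σ m) :
    v ≠ 0 := by
  obtain ⟨k, -, h⟩ := exists_isRelevant hn hsq hσ hε hm hv
  exact h.1

end Stop

end HilbertCusp

namespace HilbertCusp

/-! ### Centrally symmetric hexagons and parallelograms -/

/-- The hexagon `|s| ≤ A`, `|t| ≤ B`, `|s + t| ≤ A + B - 2 g`. -/
def hexagon (A B g : ℝ) : Set (ℝ × ℝ) :=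
  {p | |p.1| ≤ A ∧ |p.2| ≤ B ∧ |p.1 + p.2| ≤ A + B - 2 * g}

theorem convex_setOf_abs_le (f : ℝ × ℝ →ₗ[ℝ] ℝ) (M : ℝ) : Convex ℝ {p | |f p| ≤ M} := by
  have : {p | |f p| ≤ M} = f ⁻¹' Set.Icc (-M) M := by ext p; simp [abs_le]
  rw [this]
  exact (convex_Icc _ _).linear_preimage f

theorem convex_hexagon (A B g : ℝ) : Convex ℝ (hexagon A B g) :=
  (convex_setOf_abs_le (LinearMap.fst ℝ ℝ ℝ) A).inter
    ((convex_setOf_abs_le (LinearMap.snd ℝ ℝ ℝ) B).inter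
      (convex_setOf_abs_le (LinearMap.fst ℝ ℝ ℝ + LinearMap.snd ℝ ℝ ℝ) (A + B - 2 * g)))

theorem isCompact_hexagon (A B g : ℝ) : IsCompact (hexagon A B g) := by
  have hc : IsClosed (hexagon A B g) := by
    have h1 : IsClosed {p : ℝ × ℝ | |p.1| ≤ A} := isClosed_le (by fun_prop) continuous_const
    have h2 : IsClosed {p : ℝ × ℝ | |p.2| ≤ B} := isClosed_le (by fun_prop) continuous_const
    have h3 : IsClosed {p : ℝ × ℝ | |p.1 + p.2| ≤ A + B - 2 * g} :=
      isClosed_le (by fun_prop) continuous_const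
    exact h1.inter (h2.inter h3)
  refine (isCompact_Icc.prod isCompact_Icc).of_isClosed_subset hc
    (t := hexagon A B g) (s := Set.Icc (-A) A ×ˢ Set.Icc (-B) B) ?_
  rintro p ⟨h1, h2, -⟩
  exact ⟨abs_le.1 h1, abs_le.1 h2⟩

theorem interior_hexagon_nonempty {A B g : ℝ} (hg : 0 < g) (hA : g < A) (hB : g < B) :
    (interior (hexagon A B g)).Nonempty := by
  refine ⟨(0, 0), mem_interior.2 ⟨{p | |p.1| < A ∧ |p.2| < B ∧ |p.1 + p.2| < A + B - 2 * g},
    fun p hp => ⟨hp.1.le, hp.2.1.le, hp.2.2.le⟩, ?_, ?_⟩⟩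
  · have h1 : IsOpen {p : ℝ × ℝ | |p.1| < A} := isOpen_lt (by fun_prop) continuous_const
    have h2 : IsOpen {p : ℝ × ℝ | |p.2| < B} := isOpen_lt (by fun_prop) continuous_const
    have h3 : IsOpen {p : ℝ × ℝ | |p.1 + p.2| < A + B - 2 * g} :=
      isOpen_lt (by fun_prop) continuous_const
    exact h1.inter (h2.inter h3)
  · simp only [Set.mem_ofPred_eq, add_zero, abs_zero]
    exact ⟨by linarith, by linarith, by linarith⟩

theorem left_eq_of_convex_comb {a b s t M : ℝ} (ha : 0 < a) (hb : 0 < b) (hab : a + b = 1)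
    (hs : s ≤ M) (ht : t ≤ M) (h : a * s + b * t = M) : s = M := by
  refine le_antisymm hs ?_
  by_contra hlt
  push Not at hlt
  have : a * s + b * t < a * M + b * M :=
    add_lt_add_of_lt_of_le (by nlinarith) (by nlinarith)
  rw [← add_mul, hab] at this
  linarith

theorem not_mem_extremePoints_of_add_sub {P : Set (ℝ × ℝ)} {x d : ℝ × ℝ} (hd : d ≠ 0)
    (h1 : x + d ∈ P) (h2 : x - d ∈ P) : x ∉ Set.extremePoints ℝ P := by
  intro hx
  have := (mem_extremePoints_iff_left.1 hx).2 _ h1 _ h2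
    ⟨1 / 2, 1 / 2, by norm_num, by norm_num, by norm_num, by
      rw [← smul_add]; simp [← two_smul ℝ x, smul_smul]⟩
  exact hd (by simpa using this)

/-- If two of the three bounds are slack, the point moves both ways along the direction that fixes
the third, so an extreme point has two tight bounds. Conversely, tightness passes to the ends of any
segment through the point, and two tight bounds determine it. -/
theorem extremePoints_hexagon {A B g : ℝ} (hg : 0 < g) (hA : g < A) (hB : g < B) :
    Set.extremePoints ℝ (hexagon A B g) = {(A, B - 2 * g), (A - 2 * g, B), (-A, B),
      (-A, -(B - 2 * g)), (-(A - 2 * g), -B), (A, -B)} := by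
  ext ⟨s, t⟩
  simp only [Set.mem_insert_iff, Set.mem_singleton_iff, Prod.mk.injEq]
  constructor
  · intro hx
    obtain ⟨h1, h2, h3⟩ := extremePoints_subset hx
    simp only at h1 h2 h3
    have c1 : ¬(|t| < B ∧ |s + t| < A + B - 2 * g) := by
      rintro ⟨u1, u2⟩
      obtain ⟨δ, hδ, hδ'⟩ := exists_between (lt_min (sub_pos.2 u1) (sub_pos.2 u2))
      have d1 := hδ'.trans_le (min_le_left _ _)
      have d2 := hδ'.trans_le (min_le_right _ _)
      refine not_mem_extremePoints_of_add_sub (d := (0, δ)) (by simp [hδ.ne']) ?_ ?_ hx <;>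
        simp only [hexagon, Set.mem_ofPred_eq, Prod.mk_add_mk, Prod.mk_sub_mk, add_zero, sub_zero] <;>
        refine ⟨h1, ?_, ?_⟩ <;> rw [abs_le] <;>
        constructor <;> linarith [abs_le.1 (le_refl |t|), abs_le.1 (le_refl |s + t|)]
    have c2 : ¬(|s| < A ∧ |s + t| < A + B - 2 * g) := by
      rintro ⟨u1, u2⟩
      obtain ⟨δ, hδ, hδ'⟩ := exists_between (lt_min (sub_pos.2 u1) (sub_pos.2 u2))
      have d1 := hδ'.trans_le (min_le_left _ _)
      have d2 := hδ'.trans_le (min_le_right _ _)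
      refine not_mem_extremePoints_of_add_sub (d := (δ, 0)) (by simp [hδ.ne']) ?_ ?_ hx <;>
        simp only [hexagon, Set.mem_ofPred_eq, Prod.mk_add_mk, Prod.mk_sub_mk, add_zero, sub_zero] <;>
        refine ⟨?_, h2, ?_⟩ <;> rw [abs_le] <;>
        constructor <;> linarith [abs_le.1 (le_refl |s|), abs_le.1 (le_refl |s + t|)]
    have c3 : ¬(|s| < A ∧ |t| < B) := by
      rintro ⟨u1, u2⟩
      obtain ⟨δ, hδ, hδ'⟩ := exists_between (lt_min (sub_pos.2 u1) (sub_pos.2 u2))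
      have d1 := hδ'.trans_le (min_le_left _ _)
      have d2 := hδ'.trans_le (min_le_right _ _)
      refine not_mem_extremePoints_of_add_sub (d := (δ, -δ)) (by simp [hδ.ne']) ?_ ?_ hx <;>
        simp only [hexagon, Set.mem_ofPred_eq, Prod.mk_add_mk, Prod.mk_sub_mk]
      · refine ⟨?_, ?_, by convert h3 using 2; ring⟩ <;> rw [abs_le] <;>
          constructor <;> linarith [abs_le.1 (le_refl |s|), abs_le.1 (le_refl |t|)]
      · refine ⟨?_, ?_, by convert h3 using 2; ring⟩ <;> rw [abs_le] <;>
          constructor <;> linarith [abs_le.1 (le_refl |s|), abs_le.1 (le_refl |t|)]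
    have two : (|s| = A ∧ |t| = B) ∨ (|s| = A ∧ |s + t| = A + B - 2 * g) ∨
        (|t| = B ∧ |s + t| = A + B - 2 * g) := by
      by_contra hcon
      push Not at hcon
      rcases h1.lt_or_eq with u1 | u1 <;> rcases h2.lt_or_eq with u2 | u2 <;>
        rcases h3.lt_or_eq with u3 | u3 <;> tauto
    rcases two with ⟨u1, u2⟩ | ⟨u1, u2⟩ | ⟨u1, u2⟩ <;>
      rcases (abs_eq (by linarith)).1 u1 with v1 | v1 <;>
      rcases (abs_eq (by linarith)).1 u2 with v2 | v2
    · rw [v1, v2] at h3; linarith [abs_le.1 h3]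
    · exact Or.inr (Or.inr (Or.inr (Or.inr (Or.inr ⟨v1, v2⟩))))
    · exact Or.inr (Or.inr (Or.inl ⟨v1, v2⟩))
    · rw [v1, v2] at h3; linarith [abs_le.1 h3]
    · exact Or.inl ⟨v1, by linarith⟩
    · linarith [abs_le.1 h2]
    · linarith [abs_le.1 h2]
    · exact Or.inr (Or.inr (Or.inr (Or.inl ⟨v1, by linarith⟩)))
    · exact Or.inr (Or.inl ⟨by linarith, v1⟩)
    · linarith [abs_le.1 h1]
    · linarith [abs_le.1 h1]
    · exact Or.inr (Or.inr (Or.inr (Or.inr (Or.inl ⟨by linarith, v1⟩))))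
  · intro hx
    rw [mem_extremePoints_iff_left]
    have hmem : (s, t) ∈ hexagon A B g := by
      simp only [hexagon, Set.mem_ofPred_eq, abs_le]
      rcases hx with ⟨rfl, rfl⟩ | ⟨rfl, rfl⟩ | ⟨rfl, rfl⟩ | ⟨rfl, rfl⟩ | ⟨rfl, rfl⟩ | ⟨rfl, rfl⟩ <;>
        refine ⟨⟨?_, ?_⟩, ⟨?_, ?_⟩, ?_, ?_⟩ <;> linarith
    refine ⟨hmem, ?_⟩
    rintro ⟨s₁, t₁⟩ ⟨k1, k2, k3⟩ ⟨s₂, t₂⟩ ⟨l1, l2, l3⟩ ⟨a, b, ha, hb, hab, he⟩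
    simp only [abs_le] at k1 k2 k3 l1 l2 l3
    simp only [Prod.smul_mk, smul_eq_mul, Prod.mk_add_mk, Prod.mk.injEq] at he
    obtain ⟨e1, e2⟩ := he
    have S1 : s = A → s₁ = A := fun h =>
      left_eq_of_convex_comb ha hb hab k1.2 l1.2 (e1.trans h)
    have S2 : s = -A → s₁ = -A := fun h => by
      have := left_eq_of_convex_comb (s := -s₁) (t := -s₂) (M := A) ha hb hab (by linarith)
        (by linarith) (by linarith)
      linarith
    have T1 : t = B → t₁ = B := fun h =>
      left_eq_of_convex_comb ha hb hab k2.2 l2.2 (e2.trans h)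
    have T2 : t = -B → t₁ = -B := fun h => by
      have := left_eq_of_convex_comb (s := -t₁) (t := -t₂) (M := B) ha hb hab (by linarith)
        (by linarith) (by linarith)
      linarith
    have U1 : s + t = A + B - 2 * g → s₁ + t₁ = A + B - 2 * g := fun h =>
      left_eq_of_convex_comb ha hb hab k3.2 l3.2 (by linarith)
    have U2 : s + t = -(A + B - 2 * g) → s₁ + t₁ = -(A + B - 2 * g) := fun h => by
      have := left_eq_of_convex_comb (s := -(s₁ + t₁)) (t := -(s₂ + t₂)) (M := A + B - 2 * g)
        ha hb hab (by linarith) (by linarith) (by linarith)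
      linarith
    simp only [Prod.mk.injEq]
    rcases hx with ⟨h1, h2⟩ | ⟨h1, h2⟩ | ⟨h1, h2⟩ | ⟨h1, h2⟩ | ⟨h1, h2⟩ | ⟨h1, h2⟩
    · have := S1 h1; have := U1 (by linarith); constructor <;> linarith
    · have := T1 h2; have := U1 (by linarith); constructor <;> linarith
    · have := S2 h1; have := T1 h2; constructor <;> linarith
    · have := S2 h1; have := U2 (by linarith); constructor <;> linarith
    · have := T2 h2; have := U2 (by linarith); constructor <;> linarith
    · have := S1 h1; have := T2 h2; constructor <;> linarith

theorem isHexagon_hexagon {A B g : ℝ} (hg : 0 < g) (hA : g < A) (hB : g < B) :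
    IsHexagon (hexagon A B g) := by
  refine ⟨isCompact_hexagon A B g, convex_hexagon A B g, interior_hexagon_nonempty hg hA hB, ?_⟩
  rw [extremePoints_hexagon hg hA hB]
  repeat rw [Set.ncard_insert_of_notMem]
  · simp
  all_goals
    simp only [Set.mem_insert_iff, Set.mem_singleton_iff, Prod.mk.injEq, not_or, not_and]
    try and_intros
  all_goals
    intro _ _
    linarith

theorem IsHexagon.image {P : Set (ℝ × ℝ)} (h : IsHexagon P) (f : (ℝ × ℝ) ≃L[ℝ] (ℝ × ℝ)) :
    IsHexagon (f '' P) := by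
  refine ⟨h.1.image f.continuous, h.2.1.linear_image (f : (ℝ × ℝ) →ₗ[ℝ] (ℝ × ℝ)), ?_, ?_⟩
  · have := f.toHomeomorph.image_interior P
    change f '' interior P = interior (f '' P) at this
    rw [← this]
    exact h.2.2.1.image f
  · rw [← image_extremePoints, Set.ncard_image_of_injective _ f.injective, h.2.2.2]

theorem isParallelogram_Icc_prod {A B : ℝ} (hA : 0 < A) (hB : 0 < B) :
    IsParallelogram (Set.Icc (-A) A ×ˢ Set.Icc (-B) B) := by
  refine ⟨(-A, -B), (2 * A, 0), (0, 2 * B), ?_, ?_⟩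
  · rw [LinearIndependent.pair_iff]
    intro s t h
    simp only [Prod.smul_mk, smul_eq_mul, Prod.mk_add_mk, mul_zero, add_zero, zero_add,
      Prod.mk_eq_zero] at h
    exact ⟨by nlinarith [h.1], by nlinarith [h.2]⟩
  · have : ({(-A, -B), (-A, -B) + (2 * A, 0), (-A, -B) + (0, 2 * B),
        (-A, -B) + (2 * A, 0) + (0, 2 * B)} : Set (ℝ × ℝ)) = {-A, A} ×ˢ {-B, B} := by
      have e1 : -A + 2 * A = A := by ring
      have e2 : -B + 2 * B = B := by ring
      ext ⟨s, t⟩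
      simp only [Prod.mk_add_mk, add_zero, e1, e2, Set.mem_insert_iff, Set.mem_singleton_iff,
        Set.mem_prod, Prod.mk.injEq]
      tauto
    rw [this, convexHull_prod, convexHull_pair, convexHull_pair, segment_eq_Icc (by linarith),
      segment_eq_Icc (by linarith)]

theorem IsParallelogram.image {P : Set (ℝ × ℝ)} (h : IsParallelogram P)
    (f : (ℝ × ℝ) ≃L[ℝ] (ℝ × ℝ)) : IsParallelogram (f '' P) := by
  obtain ⟨a, u, v, hli, rfl⟩ := h
  refine ⟨f a, f u, f v, ?_, ?_⟩
  · rw [LinearIndependent.pair_iff] at hli ⊢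
    intro s t h
    refine hli s t (f.injective ?_)
    simpa using h
  · have := (f : (ℝ × ℝ) →ₗ[ℝ] (ℝ × ℝ)).image_convexHull {a, a + u, a + v, a + u + v}
    change f '' _ = convexHull ℝ (f '' _) at this
    rw [this]
    simp only [Set.image_insert_eq, Set.image_singleton, map_add]

end HilbertCusp

namespace HilbertCusp

variable {n : ℕ} {σ : QuadField n ≃ₐ[ℚ] QuadField n} {k : ℝ} {z z' v w : ZK n}

/-! ### The Voronoi cells of the slices -/

variable (n σ) in
/-- The Voronoi cell at level `k`: all the cubic inequalities are satisfied. -/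
def cell (k : ℝ) : Set (ℝ × ℝ) := {x | ∀ z : ZK n, 0 ≤ cubic n σ z (x.1, x.2, k)}

variable (n σ) in
/-- The polygon cut out at level `k` by the inequalities of the elements of `F`. -/
def polygon (F : Set (ZK n)) (k : ℝ) : Set (ℝ × ℝ) := {x | ∀ z ∈ F, 0 ≤ cubic n σ z (x.1, x.2, k)}

theorem continuous_cubic (z : ZK n) : Continuous (cubic n σ z) := by
  unfold cubic; fun_prop

theorem continuous_cubic_slice (z : ZK n) (k : ℝ) :
    Continuous fun x : ℝ × ℝ => cubic n σ z (x.1, x.2, k) :=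
  (continuous_cubic z).comp (by fun_prop)

theorem isClosed_polygon (F : Set (ZK n)) (k : ℝ) : IsClosed (polygon n σ F k) := by
  have : polygon n σ F k = ⋂ z ∈ F, {x : ℝ × ℝ | 0 ≤ cubic n σ z (x.1, x.2, k)} := by
    ext x; simp [polygon]
  rw [this]
  exact isClosed_biInter fun z _ => isClosed_le continuous_const (continuous_cubic_slice z k)

/-- On a ray from the axis the cubic is affine, with value `form z z > 0` on the axis when `z ≠ 0`.
So shrinking makes the inequalities strict, and stretching a point of a surface violates its
inequality. -/
theorem cubic_smul (z : ZK n) (t x₁ x₂ k : ℝ) :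
    cubic n σ z (t * x₁, t * x₂, k) =
      t * cubic n σ z (x₁, x₂, k) + (1 - t) * form n σ k z z := by
  simp only [cubic, form]; ring

theorem cubic_add_smul (z : ZK n) (t x₁ x₂ d₁ d₂ k : ℝ) :
    cubic n σ z (x₁ + t * d₁, x₂ + t * d₂, k) =
      cubic n σ z (x₁, x₂, k) + t * (2 * (emb n z * d₁ + k ^ 2 * (embConj n σ z * d₂))) := by
  simp only [cubic]; ring

/-- Moving away from the axis, one crosses the surface of `w`. -/
theorem not_mem_interior_of_cubic_eq_zero {R : Set (ℝ × ℝ × ℝ)} (hw : w ≠ 0)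
    (hR : ∀ q ∈ R, 0 ≤ cubic n σ w q) {q : ℝ × ℝ × ℝ} (hq : cubic n σ w q = 0) :
    q ∉ interior R := by
  intro hi
  have hc : ContinuousAt (fun t : ℝ => (t * q.1, t * q.2.1, q.2.2)) 1 := by fun_prop
  have hev : {t : ℝ | (t * q.1, t * q.2.1, q.2.2) ∈ interior R} ∈ nhds (1 : ℝ) :=
    hc.preimage_mem_nhds (by simpa using mem_interior_iff_mem_nhds.1 hi)
  obtain ⟨t, ht, ht1⟩ := Filter.nonempty_of_mem
    (Filter.inter_mem (mem_nhdsWithin_of_mem_nhds hev) (self_mem_nhdsWithin (s := Set.Ioi (1 : ℝ))))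
  have h2 := hR _ (interior_subset ht)
  change 0 ≤ cubic n σ w (t * q.1, t * q.2.1, q.2.2) at h2
  rw [cubic_smul] at h2
  change cubic n σ w (q.1, q.2.1, q.2.2) = 0 at hq
  rw [hq] at h2
  have := form_self_pos (σ := σ) q.2.2 hw
  have ht1' : 1 < t := ht1
  nlinarith

theorem not_mem_interior_polygon {F : Set (ZK n)} (hw : w ≠ 0) (hwF : w ∈ F) {x : ℝ × ℝ}
    (hq : cubic n σ w (x.1, x.2, k) = 0) : x ∉ interior (polygon n σ F k) := by
  intro hi
  have hc : ContinuousAt (fun t : ℝ => (t * x.1, t * x.2)) 1 := by fun_prop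
  have hev : {t : ℝ | (t * x.1, t * x.2) ∈ interior (polygon n σ F k)} ∈ nhds (1 : ℝ) :=
    hc.preimage_mem_nhds (by simpa using mem_interior_iff_mem_nhds.1 hi)
  obtain ⟨t, ht, ht1⟩ := Filter.nonempty_of_mem
    (Filter.inter_mem (mem_nhdsWithin_of_mem_nhds hev) (self_mem_nhdsWithin (s := Set.Ioi (1 : ℝ))))
  have h2 := interior_subset ht w hwF
  change 0 ≤ cubic n σ w (t * x.1, t * x.2, k) at h2
  rw [cubic_smul, hq] at h2
  have := form_self_pos (σ := σ) k hw
  have ht1' : 1 < t := ht1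
  nlinarith

theorem isOpen_forall_cubic_pos {F : Set (ZK n)} (hF : F.Finite) :
    IsOpen {q : ℝ × ℝ × ℝ | ∀ z ∈ F, 0 < cubic n σ z q} := by
  have : {q : ℝ × ℝ × ℝ | ∀ z ∈ F, 0 < cubic n σ z q} =
      ⋂ z ∈ F, {q : ℝ × ℝ × ℝ | 0 < cubic n σ z q} := by ext x; simp
  rw [this]
  exact hF.isOpen_biInter fun z _ => isOpen_lt continuous_const (continuous_cubic z)

theorem isOpen_forall_cubic_slice_pos {F : Set (ZK n)} (hF : F.Finite) (k : ℝ) :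
    IsOpen {x : ℝ × ℝ | ∀ z ∈ F, 0 < cubic n σ z (x.1, x.2, k)} :=
  (isOpen_forall_cubic_pos hF).preimage (f := fun x : ℝ × ℝ => (x.1, x.2, k)) (by fun_prop)

theorem frontier_polygon {F : Set (ZK n)} (hF : F.Finite) (h0 : ∀ w ∈ F, w ≠ 0) (k : ℝ) :
    frontier (polygon n σ F k) = ⋃ w ∈ F, polygon n σ F k ∩ slice (surface n σ w) k := by
  rw [(isClosed_polygon F k).frontier_eq]
  ext x
  simp only [Set.mem_sdiff, Set.mem_iUnion, Set.mem_inter_iff, exists_prop]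
  constructor
  · rintro ⟨hx, hi⟩
    by_contra hcon
    push Not at hcon
    refine hi (mem_interior.2 ⟨_, fun y hy w hw => (hy w hw).le,
      isOpen_forall_cubic_slice_pos hF k, fun w hw => ?_⟩)
    exact lt_of_le_of_ne (hx w hw) fun h => hcon w hw hx h.symm
  · rintro ⟨w, hw, hx, hs⟩
    exact ⟨hx, not_mem_interior_polygon (h0 w hw) hw hs⟩

/-- At the midpoint of `w`, and hence near it, the inequality of `w` is the only one that can fail.
-/
theorem isSide_polygon {F : Set (ZK n)} (hF : F.Finite) (h0 : ∀ w ∈ F, w ≠ 0) (hw : w ∈ F)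
    (hr : IsRelevant n σ k w) : IsSide (slice (surface n σ w) k) (polygon n σ F k) := by
  refine ⟨{x | ∀ z ∈ F \ {w}, 0 < cubic n σ z (x.1, x.2, k)},
    isOpen_forall_cubic_slice_pos hF.sdiff k,
    ⟨((mid n σ w k).1, (mid n σ w k).2.1), ?_, fun z hz => ?_⟩, ?_⟩
  · change cubic n σ w (mid n σ w k) = 0
    simp [cubic_mid, form]
  · change 0 < cubic n σ z (mid n σ w k)
    rw [cubic_mid]
    exact hr.2 z (h0 z hz.1) hz.2
  · rintro x ⟨hx, hx'⟩
    have hx0 : cubic n σ w (x.1, x.2, k) = 0 := hx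
    have hmem : x ∈ polygon n σ F k := fun z hz => by
      by_cases h : z = w
      · rw [h, hx0]
      · exact (hx' z ⟨hz, h⟩).le
    rw [frontier_polygon hF h0]
    exact Set.mem_biUnion hw ⟨hmem, hx⟩

/-- Surfaces of different elements meet every slice in different lines, so a point of the surface
of `z` can be moved along it, off finitely many other surfaces. -/
theorem exists_mem_surface_avoiding {F : Set (ZK n)} (hF : F.Finite) (h0 : ∀ w ∈ F, w ≠ 0)
    (hk : k ≠ 0) (hz : z ∉ F) {V : Set (ℝ × ℝ)} (hV : IsOpen V) {x : ℝ × ℝ} (hx : x ∈ V)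
    (hxz : cubic n σ z (x.1, x.2, k) = 0) :
    ∃ y ∈ V, cubic n σ z (y.1, y.2, k) = 0 ∧ ∀ w ∈ F, cubic n σ w (y.1, y.2, k) ≠ 0 := by
  obtain ⟨d, hd, hd'⟩ : ∃ d : ℝ × ℝ, (∀ t : ℝ, cubic n σ z (x.1 + t * d.1, x.2 + t * d.2, k) = 0) ∧
      ∀ w ∈ F, cubic n σ w (x.1, x.2, k) = 0 →
        emb n w * d.1 + k ^ 2 * (embConj n σ w * d.2) ≠ 0 := by
    by_cases hz0 : z = 0
    · refine ⟨x, fun t => by simp [hz0, cubic], fun w hw h1 h2 => ?_⟩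
      have := form_self_pos (σ := σ) k (h0 w hw)
      simp only [cubic] at h1
      simp only [form] at this
      nlinarith
    · refine ⟨(k ^ 2 * embConj n σ z, -emb n z), fun t => ?_, fun w hw h1 h2 => ?_⟩
      · rw [cubic_add_smul, hxz]; ring
      · have he := emb_ne_zero hz0
        have hk2 : k ^ 2 ≠ 0 := pow_ne_zero 2 hk
        have h3 : emb n w * embConj n σ z = embConj n σ w * emb n z := by
          have : k ^ 2 * (emb n w * embConj n σ z - embConj n σ w * emb n z) = 0 := by
            linear_combination h2
          exact sub_eq_zero.1 ((mul_eq_zero.1 this).resolve_left hk2)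
        -- If the lines are parallel, both embeddings of `w` are `l` times those of `z`. A common
        -- point then forces `l (l - 1) = 0`, that is, `w = 0` or `w = z`.
        set l := emb n w / emb n z with hl
        have e1 : emb n w = l * emb n z := by rw [hl, div_mul_cancel₀ _ he]
        have e2 : embConj n σ w = l * embConj n σ z := by
          rw [e1] at h3
          exact mul_right_cancel₀ he (by linear_combination -h3)
        have hzz := form_self_pos (σ := σ) k hz0
        have h4 : l * (l - 1) * form n σ k z z = 0 := by
          have : cubic n σ w (x.1, x.2, k) =
              l * cubic n σ z (x.1, x.2, k) + l * (l - 1) * form n σ k z z := by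
            simp only [cubic, form, e1, e2]; ring
          rw [h1, hxz] at this
          linarith
        rcases mul_eq_zero.1 ((mul_eq_zero.1 h4).resolve_right hzz.ne') with h5 | h5
        · rw [h5, zero_mul] at e1
          exact emb_ne_zero (h0 w hw) e1
        · have : l = 1 := by linarith
          rw [this, one_mul] at e1
          exact hz (emb_injective n e1 ▸ hw)
  have hfin : (⋃ w ∈ F, {t : ℝ | cubic n σ w (x.1 + t * d.1, x.2 + t * d.2, k) = 0}).Finite := by
    refine hF.biUnion fun w hw => ?_
    refine Set.Subsingleton.finite fun s hs t ht => ?_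
    have hs' : cubic n σ w (x.1 + s * d.1, x.2 + s * d.2, k) = 0 := hs
    have ht' : cubic n σ w (x.1 + t * d.1, x.2 + t * d.2, k) = 0 := ht
    rw [cubic_add_smul] at hs' ht'
    by_contra hst
    have h1 : (s - t) * (2 * (emb n w * d.1 + k ^ 2 * (embConj n σ w * d.2))) = 0 := by linarith
    have h2 := (mul_eq_zero.1 h1).resolve_left (sub_ne_zero.2 hst)
    rw [h2] at hs'
    exact hd' w hw (by linarith) (by linarith)
  have hnhds : {t : ℝ | (x.1 + t * d.1, x.2 + t * d.2) ∈ V} ∈ nhds (0 : ℝ) := by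
    have hc : ContinuousAt (fun t : ℝ => (x.1 + t * d.1, x.2 + t * d.2)) 0 := by fun_prop
    exact hc.preimage_mem_nhds (by simpa using hV.mem_nhds hx)
  obtain ⟨t, ht, ht'⟩ := ((infinite_of_mem_nhds 0 hnhds).sdiff hfin).nonempty
  refine ⟨_, ht, hd t, fun w hw h => ht' (Set.mem_biUnion hw h)⟩

theorem mem_of_isSide_slice {F : Set (ZK n)} (hF : F.Finite) (h0 : ∀ w ∈ F, w ≠ 0) (hk : k ≠ 0)
    {P : Set (ℝ × ℝ)} (hP : frontier P ⊆ ⋃ w ∈ F, slice (surface n σ w) k)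
    (hs : IsSide (slice (surface n σ z) k) P) : z ∈ F := by
  obtain ⟨V, hV, ⟨x, hxz, hxV⟩, hsub⟩ := hs
  by_contra hz
  obtain ⟨y, hyV, hyz, hy⟩ := exists_mem_surface_avoiding hF h0 hk hz hV hxV hxz
  obtain ⟨w, hw, hyw⟩ := Set.mem_iUnion₂.1 (hP (hsub ⟨hyz, hyV⟩))
  exact hy w hw hyw

/-! ### Coordinates adapted to a reduced basis -/

variable (n σ) in
/-- The linear coordinates `2 B(x, z)`, `2 B(x, z')`. -/
noncomputable def formCoord (k : ℝ) (z z' : ZK n) : ℝ × ℝ →ₗ[ℝ] ℝ × ℝ where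
  toFun x := (2 * (emb n z * x.1 + k ^ 2 * (embConj n σ z * x.2)),
    2 * (emb n z' * x.1 + k ^ 2 * (embConj n σ z' * x.2)))
  map_add' x y := by ext <;> simp only [Prod.fst_add, Prod.snd_add] <;> ring
  map_smul' t x := by
    ext <;> simp only [Prod.smul_fst, Prod.smul_snd, smul_eq_mul, RingHom.id_apply] <;> ring

theorem IsReducedPair.det_ne_zero (h : IsReducedPair n σ z z') :
    emb n z * embConj n σ z' - emb n z' * embConj n σ z ≠ 0 := by
  have h1 := h.pos
  have h2 := h.pos'
  rcases mul_neg_iff.1 h.neg with ⟨ha, hb⟩ | ⟨ha, hb⟩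
  · have := mul_pos h2 ha
    have := mul_neg_of_pos_of_neg h1 hb
    linarith
  · have := mul_neg_of_pos_of_neg h2 ha
    have := mul_pos h1 hb
    linarith

theorem IsReducedPair.formCoord_injective (h : IsReducedPair n σ z z') (hk : k ≠ 0) :
    Function.Injective (formCoord n σ k z z') := by
  rw [injective_iff_map_eq_zero]
  rintro ⟨x, y⟩ hxy
  simp only [formCoord, LinearMap.coe_mk, AddHom.coe_mk, Prod.mk_eq_zero] at hxy
  obtain ⟨h1, h2⟩ := hxy
  have hd := h.det_ne_zero
  have hx : (emb n z * embConj n σ z' - emb n z' * embConj n σ z) * x = 0 := by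
    linear_combination embConj n σ z' / 2 * h1 - embConj n σ z / 2 * h2
  have hy : (emb n z * embConj n σ z' - emb n z' * embConj n σ z) * (k ^ 2 * y) = 0 := by
    linear_combination emb n z / 2 * h2 - emb n z' / 2 * h1
  have hy' := (mul_eq_zero.1 hy).resolve_left hd
  exact Prod.ext ((mul_eq_zero.1 hx).resolve_left hd)
    ((mul_eq_zero.1 hy').resolve_left (pow_ne_zero 2 hk))

/-- `formCoord` as a continuous linear equivalence. -/
noncomputable def formEquiv (h : IsReducedPair n σ z z') (hk : k ≠ 0) :
    (ℝ × ℝ) ≃L[ℝ] (ℝ × ℝ) :=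
  (LinearEquiv.ofInjectiveEndo _ (h.formCoord_injective hk)).toContinuousLinearEquiv

theorem IsObtuse.cell_eq_polygon (h : IsObtuse n σ k z z') :
    cell n σ k = polygon n σ (six z z') k :=
  Set.Subset.antisymm (fun _ hx w _ => hx w) (fun _ hx => h.cubic_nonneg rfl hx)

/-- The inequalities of `v` and `-v` say that `|2 B(x, v)| ≤ B(v, v)`. For `v = z + z'` the bound is
`A + B - 2 g` with `g = -form z z'`. -/
theorem polygon_six (k : ℝ) (z z' : ZK n) : polygon n σ (six z z') k = formCoord n σ k z z' ⁻¹'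
    hexagon (form n σ k z z) (form n σ k z' z') (-form n σ k z z') := by
  ext ⟨x, y⟩
  simp only [polygon, six, Set.mem_insert_iff, Set.mem_singleton_iff, forall_eq_or_imp, forall_eq,
    hexagon, formCoord, Set.mem_preimage, Set.mem_ofPred_eq, abs_le, LinearMap.coe_mk,
    AddHom.coe_mk, cubic, form, map_add, map_neg]
  constructor
  · rintro ⟨h1, h2, h3, h4, h5, h6⟩
    refine ⟨⟨?_, ?_⟩, ⟨?_, ?_⟩, ?_, ?_⟩ <;> linarith
  · rintro ⟨⟨h1, h2⟩, ⟨h3, h4⟩, h5, h6⟩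
    refine ⟨?_, ?_, ?_, ?_, ?_, ?_⟩ <;> linarith

theorem IsObtuse.cell_eq_image (h : IsObtuse n σ k z z') (hk : k ≠ 0) :
    cell n σ k = (formEquiv h.toIsReducedPair hk).symm ''
      hexagon (form n σ k z z) (form n σ k z' z') (-form n σ k z z') := by
  rw [h.cell_eq_polygon, polygon_six, ContinuousLinearEquiv.image_symm_eq_preimage]
  rfl

theorem IsObtuse.isCompact_cell (h : IsObtuse n σ k z z') (hk : k ≠ 0) :
    IsCompact (cell n σ k) := by
  rw [h.cell_eq_image hk]
  exact (isCompact_hexagon _ _ _).image (ContinuousLinearEquiv.continuous _)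

theorem IsObtuse.isHexagon_cell (h : IsObtuse n σ k z z') (hk : k ≠ 0)
    (h1 : form n σ k z z' < 0) (h2 : 0 < form n σ k z (z + z'))
    (h3 : 0 < form n σ k z' (z + z')) : IsHexagon (cell n σ k) := by
  rw [h.cell_eq_image hk]
  rw [form_add_right] at h2 h3
  rw [form_comm k z' z] at h3
  exact (isHexagon_hexagon (by linarith) (by linarith) (by linarith)).image _

theorem IsReducedPair.isObtuse_of_orthogonal (h : IsReducedPair n σ z z')
    (h0 : form n σ k z z' = 0) : IsObtuse n σ k z z' ∧ 0 < form n σ k z (z + z') ∧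
      0 < form n σ k z' (z + z') := by
  have p1 := form_self_pos (σ := σ) k (ne_zero_of_emb_pos h.pos)
  have p2 := form_self_pos (σ := σ) k (ne_zero_of_emb_pos h.pos')
  have a1 : 0 < form n σ k z (z + z') := by rw [form_add_right, h0]; linarith
  have a2 : 0 < form n σ k z' (z + z') := by
    rw [form_add_right, form_comm k z' z, h0]; linarith
  exact ⟨⟨h, h0.le, a1.le, a2.le⟩, a1, a2⟩

theorem hexagon_zero (A B : ℝ) : hexagon A B 0 = Set.Icc (-A) A ×ˢ Set.Icc (-B) B := by
  ext ⟨s, t⟩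
  simp only [hexagon, Set.mem_ofPred_eq, abs_le, Set.mem_prod, Set.mem_Icc]
  constructor
  · rintro ⟨h1, h2, -⟩; exact ⟨h1, h2⟩
  · rintro ⟨h1, h2⟩
    exact ⟨h1, h2, by linarith [h1.1, h2.1], by linarith [h1.2, h2.2]⟩

/-- By orthogonality the inequality of `±(z + z')` is the sum of those of `±z` and `±z'`, so it is
redundant. -/
theorem IsReducedPair.cell_eq_polygon_of_orthogonal (h : IsReducedPair n σ z z')
    (h0 : form n σ k z z' = 0) : cell n σ k = polygon n σ {z, -z, z', -z'} k := by
  rw [(h.isObtuse_of_orthogonal h0).1.cell_eq_polygon]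
  ext ⟨x, y⟩
  simp only [polygon, six, Set.mem_insert_iff, Set.mem_singleton_iff, forall_eq_or_imp, forall_eq,
    Set.mem_ofPred_eq]
  simp only [cubic, form, map_add, map_neg] at h0 ⊢
  constructor
  · rintro ⟨h1, h2, h3, h4, h5, h6⟩
    exact ⟨h1, h4, h2, h5⟩
  · rintro ⟨h1, h2, h3, h4⟩
    refine ⟨?_, ?_, ?_, ?_, ?_, ?_⟩ <;> linarith

theorem IsReducedPair.isParallelogramBoundedBy_cell (h : IsReducedPair n σ z z') (hk : k ≠ 0)
    (h0 : form n σ k z z' = 0) : IsParallelogramBoundedBy n σ (cell n σ k) k z z' := by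
  obtain ⟨ho, a1, a2⟩ := h.isObtuse_of_orthogonal h0
  have n1 := ne_zero_of_emb_pos h.pos
  have n2 := ne_zero_of_emb_pos h.pos'
  have r1 := ho.isRelevant_left a1 a2
  have r2 := ho.symm.isRelevant_left (by rwa [add_comm]) (by rwa [add_comm])
  have hF : ({z, -z, z', -z'} : Set (ZK n)).Finite := Set.toFinite _
  have hne : ∀ w ∈ ({z, -z, z', -z'} : Set (ZK n)), w ≠ 0 := by
    rintro w (rfl | rfl | rfl | rfl)
    exacts [n1, neg_ne_zero.2 n1, n2, neg_ne_zero.2 n2]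
  have hrel : ∀ w ∈ ({z, -z, z', -z'} : Set (ZK n)), IsRelevant n σ k w := by
    rintro w (rfl | rfl | rfl | rfl)
    exacts [r1, r1.neg, r2, r2.neg]
  refine ⟨?_, ?_, ?_⟩
  · rw [ho.cell_eq_image hk, h0, neg_zero, hexagon_zero]
    exact (isParallelogram_Icc_prod (form_self_pos k n1) (form_self_pos k n2)).image _
  · rw [h.cell_eq_polygon_of_orthogonal h0]
    ext w
    refine ⟨fun hs => mem_of_isSide_slice hF hne hk ?_ hs,
      fun hw => isSide_polygon hF hne hw (hrel w hw)⟩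
    rw [frontier_polygon hF hne]
    exact Set.iUnion₂_mono fun w _ => Set.inter_subset_right
  · rw [h.cell_eq_polygon_of_orthogonal h0, frontier_polygon hF hne]

end HilbertCusp

namespace HilbertCusp

variable {n : ℕ} {σ : QuadField n ≃ₐ[ℚ] QuadField n} {z : ZK n} {L : Set (ZK n)} {E : ℝ}

/-! ### The solid cut out by two planes and finitely many cubic surfaces -/

variable (n σ) in
/-- The points with third coordinate in `[1, E)` that satisfy the cubic inequalities of `L`. -/
def solid (L : Set (ZK n)) (E : ℝ) : Set (ℝ × ℝ × ℝ) :=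
  {q | 1 ≤ q.2.2 ∧ q.2.2 < E ∧ ∀ z ∈ L, 0 ≤ cubic n σ z q}

variable (n σ) in
/-- The points with third coordinate in `[1, E]` that satisfy the cubic inequalities of `L`. -/
def closedSolid (L : Set (ZK n)) (E : ℝ) : Set (ℝ × ℝ × ℝ) :=
  {q | 1 ≤ q.2.2 ∧ q.2.2 ≤ E ∧ ∀ z ∈ L, 0 ≤ cubic n σ z q}

theorem isClosed_closedSolid (L : Set (ZK n)) (E : ℝ) : IsClosed (closedSolid n σ L E) := by
  have e : closedSolid n σ L E = {q : ℝ × ℝ × ℝ | 1 ≤ q.2.2} ∩ ({q : ℝ × ℝ × ℝ | q.2.2 ≤ E} ∩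
      ⋂ z ∈ L, {q : ℝ × ℝ × ℝ | 0 ≤ cubic n σ z q}) := by
    ext q; simp [closedSolid]
  have h1 : IsClosed {q : ℝ × ℝ × ℝ | 1 ≤ q.2.2} := isClosed_le continuous_const (by fun_prop)
  have h2 : IsClosed {q : ℝ × ℝ × ℝ | q.2.2 ≤ E} := isClosed_le (by fun_prop) continuous_const
  rw [e]
  exact h1.inter (h2.inter (isClosed_biInter fun z _ =>
    isClosed_le continuous_const (continuous_cubic z)))

theorem closure_solid (hL : L.Finite) (h0 : ∀ z ∈ L, z ≠ 0) (hE : 1 < E) :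
    closure (solid n σ L E) = closedSolid n σ L E := by
  refine Set.Subset.antisymm (closure_minimal (fun q hq => ⟨hq.1, hq.2.1.le, hq.2.2⟩)
    (isClosed_closedSolid L E)) ?_
  rintro ⟨x, y, k⟩ ⟨h1, h2, h3⟩
  simp only at h1 h2
  rcases h2.lt_or_eq with hlt | rfl
  · exact subset_closure ⟨h1, hlt, h3⟩
  -- A point of the top plane may leave the solid when its level is lowered. Shrunk towards the
  -- axis, it satisfies all inequalities strictly and can be lowered; then `t → 1`.
  have hpos : ∀ t ∈ Set.Ioo (0 : ℝ) 1, (t * x, t * y, k) ∈ closure (solid n σ L k) := by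
    intro t ht
    have hp : ∀ z ∈ L, 0 < cubic n σ z (t * x, t * y, k) := by
      intro z hz
      rw [cubic_smul]
      have a1 := mul_nonneg ht.1.le (h3 z hz)
      have a2 := mul_pos (sub_pos.2 ht.2) (form_self_pos (σ := σ) k (h0 z hz))
      linarith
    have hc : Continuous fun k' : ℝ => (t * x, t * y, k') := by fun_prop
    have hev : ∀ᶠ k' in nhdsWithin k (Set.Iio k), (t * x, t * y, k') ∈ solid n σ L k := by
      have e1 := nhdsWithin_le_nhds (s := Set.Iio k)
        (((isOpen_forall_cubic_pos (σ := σ) hL).preimage hc).mem_nhds hp)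
      have e2 := nhdsWithin_le_nhds (s := Set.Iio k) (Ioi_mem_nhds hE)
      filter_upwards [e1, e2, self_mem_nhdsWithin] with k' a1 a2 a3
      exact ⟨le_of_lt a2, a3, fun z hz => (a1 z hz).le⟩
    exact mem_closure_of_tendsto (hc.tendsto k |>.mono_left nhdsWithin_le_nhds) hev
  have hc : Continuous fun t : ℝ => (t * x, t * y, k) := by fun_prop
  have ht := (hc.tendsto 1).mono_left (nhdsWithin_le_nhds (s := Set.Iio (1 : ℝ)))
  simp only [one_mul] at ht
  refine isClosed_closure.mem_of_tendsto ht ?_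
  filter_upwards [nhdsWithin_le_nhds (s := Set.Iio (1 : ℝ)) (Ioi_mem_nhds zero_lt_one),
    self_mem_nhdsWithin] with t a1 a2
  exact hpos t ⟨a1, a2⟩

theorem frontier_solid (hL : L.Finite) (h0 : ∀ z ∈ L, z ≠ 0) :
    frontier (solid n σ L E) = closure (solid n σ L E) ∩
      (plane 1 ∪ plane E ∪ ⋃ z ∈ L, surface n σ z) := by
  ext q
  constructor
  · rintro ⟨hc, hi⟩
    refine ⟨hc, ?_⟩
    by_contra hcon
    simp only [Set.mem_union, Set.mem_iUnion, not_or, not_exists] at hcon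
    obtain ⟨⟨c1, c2⟩, c3⟩ := hcon
    have hsub : solid n σ L E ⊆ closedSolid n σ L E := fun q hq => ⟨hq.1, hq.2.1.le, hq.2.2⟩
    have hq : q ∈ closedSolid n σ L E := closure_minimal hsub (isClosed_closedSolid L E) hc
    have o1 : IsOpen {q : ℝ × ℝ × ℝ | 1 < q.2.2} := isOpen_lt continuous_const (by fun_prop)
    have o2 : IsOpen {q : ℝ × ℝ × ℝ | q.2.2 < E} := isOpen_lt (by fun_prop) continuous_const
    refine hi (mem_interior.2 ⟨_, ?_, o1.inter (o2.inter (isOpen_forall_cubic_pos (σ := σ) hL)),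
      lt_of_le_of_ne hq.1 (Ne.symm c1), lt_of_le_of_ne hq.2.1 c2,
      fun z hz => lt_of_le_of_ne (hq.2.2 z hz) fun h => c3 z hz h.symm⟩)
    rintro p ⟨p1, p2, p3⟩
    exact ⟨le_of_lt p1, p2, fun z hz => (p3 z hz).le⟩
  · rintro ⟨hc, hq⟩
    refine ⟨hc, fun hi => ?_⟩
    rcases hq with (hq | hq) | hq
    · have hcont : Continuous fun k' : ℝ => (q.1, q.2.1, k') := by fun_prop
      have hq1 : q.2.2 = 1 := hq
      have hmem : {k' : ℝ | (q.1, q.2.1, k') ∈ solid n σ L E} ∈ nhds (1 : ℝ) := by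
        refine hcont.continuousAt.preimage_mem_nhds ?_
        rw [← hq1]
        exact mem_interior_iff_mem_nhds.1 hi
      obtain ⟨k', a1, a2⟩ := Filter.nonempty_of_mem (Filter.inter_mem
        (mem_nhdsWithin_of_mem_nhds hmem) (self_mem_nhdsWithin (s := Set.Iio (1 : ℝ))))
      exact absurd a1.1 (not_le.2 a2)
    · exact (interior_subset hi).2.1.ne hq
    · obtain ⟨z, hz, hqz⟩ := Set.mem_iUnion₂.1 hq
      exact not_mem_interior_of_cubic_eq_zero (h0 z hz) (fun p hp => hp.2.2 z hz) hqz hi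

theorem isSide_plane_one (hL : L.Finite) (h0 : ∀ z ∈ L, z ≠ 0) (hE : 1 < E) :
    IsSide (plane 1) (solid n σ L E) := by
  have o2 : IsOpen {q : ℝ × ℝ × ℝ | q.2.2 < E} := isOpen_lt (by fun_prop) continuous_const
  refine ⟨_, o2.inter (isOpen_forall_cubic_pos (σ := σ) hL), ⟨(0, 0, 1), rfl, hE, fun z hz => ?_⟩,
    ?_⟩
  · have := form_self_pos (σ := σ) 1 (h0 z hz)
    simp only [form] at this
    simp only [cubic]
    linarith
  · rintro q ⟨hq, h1, h2⟩
    have hq1 : q.2.2 = 1 := hq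
    rw [frontier_solid hL h0]
    exact ⟨subset_closure ⟨hq1.ge, h1, fun z hz => (h2 z hz).le⟩, Or.inl (Or.inl hq)⟩

theorem isSide_plane_right (hL : L.Finite) (h0 : ∀ z ∈ L, z ≠ 0) (hE : 1 < E) :
    IsSide (plane E) (solid n σ L E) := by
  have o2 : IsOpen {q : ℝ × ℝ × ℝ | 1 < q.2.2} := isOpen_lt continuous_const (by fun_prop)
  refine ⟨_, o2.inter (isOpen_forall_cubic_pos (σ := σ) hL), ⟨(0, 0, E), rfl, hE, fun z hz => ?_⟩,
    ?_⟩
  · have := form_self_pos (σ := σ) E (h0 z hz)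
    simp only [form] at this
    simp only [cubic]
    linarith
  · rintro q ⟨hq, h1, h2⟩
    have hq1 : q.2.2 = E := hq
    rw [frontier_solid hL h0, closure_solid hL h0 hE]
    exact ⟨⟨le_of_lt h1, hq1.le, fun z hz => (h2 z hz).le⟩, Or.inl (Or.inr hq)⟩

theorem isSide_surface (hL : L.Finite) (h0 : ∀ z ∈ L, z ≠ 0) (hz : z ∈ L) {k : ℝ}
    (hk : k ∈ Set.Ioo 1 E) (hr : IsRelevant n σ k z) :
    IsSide (surface n σ z) (solid n σ L E) := by
  have o1 : IsOpen {q : ℝ × ℝ × ℝ | 1 < q.2.2} := isOpen_lt continuous_const (by fun_prop)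
  have o2 : IsOpen {q : ℝ × ℝ × ℝ | q.2.2 < E} := isOpen_lt (by fun_prop) continuous_const
  refine ⟨_, o1.inter (o2.inter (isOpen_forall_cubic_pos (σ := σ) (hL.sdiff (t := {z})))),
    ⟨mid n σ z k, ?_, hk.1, hk.2, fun w hw => ?_⟩, ?_⟩
  · change cubic n σ z (mid n σ z k) = 0
    simp [cubic_mid, form]
  · rw [cubic_mid]
    exact hr.2 w (h0 w hw.1) hw.2
  · rintro q ⟨hq, h1, h2, h3⟩
    rw [frontier_solid hL h0]
    refine ⟨subset_closure ⟨le_of_lt h1, h2, fun w hw => ?_⟩, Or.inr (Set.mem_biUnion hz hq)⟩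
    by_cases hwz : w = z
    · rw [hwz]; exact le_of_eq (Eq.symm hq)
    · exact (h3 w ⟨hw, hwz⟩).le

theorem mem_of_isSide_surface (hL : L.Finite) (h0 : ∀ z ∈ L, z ≠ 0) (hE : 1 < E)
    (hs : IsSide (surface n σ z) (solid n σ L E)) : z ∈ L := by
  obtain ⟨V, hV, ⟨q, hqz, hqV⟩, hsub⟩ := hs
  by_contra hz
  have hqc : q ∈ closedSolid n σ L E := by
    rw [← closure_solid hL h0 hE]
    exact frontier_subset_closure (hsub ⟨hqz, hqV⟩)
  -- A curve on the surface of `z` through `q`, found by solving the cubic for `x₁` at fixed `x₂`.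
  -- It leads to a level strictly inside `(1, E)`, away from the two planes, where the argument in a
  -- slice applies.
  obtain ⟨c, hc, hcq, hcz⟩ : ∃ c : ℝ → ℝ, Continuous c ∧ c q.2.2 = q.1 ∧
      ∀ k, cubic n σ z (c k, q.2.1, k) = 0 := by
    by_cases hz0 : z = 0
    · exact ⟨fun _ => q.1, continuous_const, rfl, fun k => by simp [cubic, hz0]⟩
    · have he := emb_ne_zero hz0
      refine ⟨fun k => -(emb n z ^ 2 + k ^ 2 * (2 * embConj n σ z * q.2.1 + embConj n σ z ^ 2)) /
        (2 * emb n z), by fun_prop, ?_, fun k => ?_⟩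
      · have hqz' : cubic n σ z q = 0 := hqz
        simp only [cubic] at hqz'
        field_simp
        linarith
      · simp only [cubic]
        field_simp
        ring
  have hmem : q.2.2 ∈ closure (Set.Ioo 1 E) := by
    rw [closure_Ioo hE.ne]; exact ⟨hqc.1, hqc.2.1⟩
  have hcont : Continuous fun k : ℝ => (c k, q.2.1, k) := by fun_prop
  have hVk : {k : ℝ | (c k, q.2.1, k) ∈ V} ∈ nhds q.2.2 :=
    hcont.continuousAt.preimage_mem_nhds (by rw [hcq]; exact hV.mem_nhds hqV)
  obtain ⟨k, hkV, hk⟩ := mem_closure_iff_nhds.1 hmem _ hVk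
  have hV' : IsOpen {x : ℝ × ℝ | (x.1, x.2, k) ∈ V} := hV.preimage (by fun_prop)
  have hk0 : k ≠ 0 := (zero_lt_one.trans hk.1).ne'
  obtain ⟨y, hyV, hyz, hy⟩ := exists_mem_surface_avoiding (x := (c k, q.2.1)) hL h0 hk0 hz hV' hkV
    (hcz k)
  have hfr := hsub ⟨hyz, hyV⟩
  rw [frontier_solid hL h0] at hfr
  rcases hfr.2 with (h | h) | h
  · exact hk.1.ne' h
  · exact hk.2.ne h
  · obtain ⟨w, hw, hyw⟩ := Set.mem_iUnion₂.1 h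
    exact hy w hw hyw

end HilbertCusp

namespace HilbertCusp

variable {n : ℕ} {σ : QuadField n ≃ₐ[ℚ] QuadField n} {k : ℝ} {z z' v w b : ZK n} {L : Set (ZK n)}

/-! ### Translations of a slice -/

variable (n σ) in
/-- The image of `z` in the plane under the two embeddings. -/
noncomputable def planeVec (z : ZK n) : ℝ × ℝ := (emb n z, embConj n σ z)

theorem planeVec_add (z w : ZK n) : planeVec n σ (z + w) = planeVec n σ z + planeVec n σ w := by
  simp [planeVec]

theorem cubic_add_planeVec (v z : ZK n) (x : ℝ × ℝ) (k : ℝ) :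
    cubic n σ v ((x + planeVec n σ z).1, (x + planeVec n σ z).2, k) =
      cubic n σ (v + z) (x.1, x.2, k) - cubic n σ z (x.1, x.2, k) := by
  simp only [cubic, planeVec, Prod.fst_add, Prod.snd_add, map_add]; ring

/-- Both points are closest to the origin in the same orbit, so they are equally far from it. -/
theorem cubic_eq_zero_of_add_mem_cell {x : ℝ × ℝ} (hx : x ∈ cell n σ k)
    (hx' : x + planeVec n σ b ∈ cell n σ k) : cubic n σ b (x.1, x.2, k) = 0 := by
  have h := hx' (-b)
  rw [cubic_add_planeVec, neg_add_cancel] at h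
  have h0 : cubic n σ 0 (x.1, x.2, k) = 0 := by simp [cubic]
  linarith [hx b]

theorem add_mem_cell {x : ℝ × ℝ} (hx : x ∈ cell n σ k) (h0 : cubic n σ b (x.1, x.2, k) = 0) :
    x + planeVec n σ b ∈ cell n σ k := by
  intro v
  rw [cubic_add_planeVec, h0, sub_zero]
  exact hx (v + b)

/-- Equivalent points of a cell are related by at most two side pairings. -/
theorem IsObtuse.exists_path (h : IsObtuse n σ k z z') (hL : six z z' ⊆ L) {x : ℝ × ℝ}
    (hx : x ∈ cell n σ k) (hx' : x + planeVec n σ b ∈ cell n σ k) :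
    b = 0 ∨ (b ∈ L ∧ cubic n σ b (x.1, x.2, k) = 0) ∨ ∃ u ∈ L, ∃ w ∈ L, b = u + w ∧
      cubic n σ u (x.1, x.2, k) = 0 ∧
      cubic n σ w ((x + planeVec n σ u).1, (x + planeVec n σ u).2, k) = 0 := by
  have h0 := cubic_eq_zero_of_add_mem_cell hx hx'
  rcases h.cubic_eq_zero (q := (x.1, x.2, k)) rfl (fun p _ => hx p) h0 with h1 | h1 |
    ⟨u, hu, w, hw, e, hf, h1, h2⟩
  · exact Or.inl h1
  · exact Or.inr (Or.inl ⟨hL h1, h0⟩)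
  · refine Or.inr (Or.inr ⟨u, hL hu, w, hL hw, e, h1, ?_⟩)
    rw [cubic_add_planeVec, h1, sub_zero, add_comm w u, ← e, h0]

theorem finite_setOf_abs_le (hn : 1 < n) (hsq : Squarefree n) (hσ : σ ≠ 1) (C : ℝ) :
    {z : ZK n | |emb n z| ≤ C ∧ |embConj n σ z| ≤ C}.Finite := by
  have hα := one_lt_emb_alpha hn
  have hα' := embConj_alpha_neg hn hσ
  set a := emb n (alpha n) with ha
  obtain ⟨N, hN⟩ := exists_nat_ge (2 * C)
  obtain ⟨M, hM⟩ := exists_nat_ge (C + N * a)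
  refine (((Set.finite_Icc (-(M : ℤ)) M).prod (Set.finite_Icc (-(N : ℤ)) N)).image
    (fun p : ℤ × ℤ => (p.1 : ZK n) + p.2 * alpha n)).subset ?_
  rintro z ⟨h1, h2⟩
  obtain ⟨s, t, rfl⟩ := exists_int_add_mul_alpha hsq hσ z
  simp only [map_add, map_mul, map_intCast, abs_le] at h1 h2
  have hd : 1 < emb n (alpha n) - embConj n σ (alpha n) := by linarith
  have hc : |(t : ℝ)| ≤ N := by
    have h3 : |(t : ℝ) * (emb n (alpha n) - embConj n σ (alpha n))| ≤ 2 * C := by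
      rw [abs_le]; constructor <;> linarith
    rw [abs_mul, abs_of_pos (by linarith : 0 < emb n (alpha n) - embConj n σ (alpha n))] at h3
    have := le_mul_of_one_le_right (abs_nonneg (t : ℝ)) hd.le
    linarith
  have hs : |(s : ℝ)| ≤ M := by
    rw [abs_le] at hc ⊢
    have e1 : (t : ℝ) * a ≤ N * a := mul_le_mul_of_nonneg_right hc.2 (by linarith)
    have e2 : -N * a ≤ (t : ℝ) * a := mul_le_mul_of_nonneg_right hc.1 (by linarith)
    constructor <;> linarith [h1.1, h1.2]
  rw [abs_le] at hs hc
  exact ⟨(s, t), ⟨⟨by exact_mod_cast hs.1, by exact_mod_cast hs.2⟩,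
    ⟨by exact_mod_cast hc.1, by exact_mod_cast hc.2⟩⟩, rfl⟩

/-- The translates of a cell cover the plane. -/
theorem exists_add_mem_cell (hn : 1 < n) (hsq : Squarefree n) (hσ : σ ≠ 1) (hk : 0 < k)
    (x : ℝ × ℝ) : ∃ z : ZK n, x + planeVec n σ z ∈ cell n σ k := by
  -- The square length along the orbit. Only finitely many values are at most `f 0`, so a minimum is
  -- attained, and the minimiser lies in the cell.
  set f : ZK n → ℝ := fun z => (x.1 + emb n z) ^ 2 + k ^ 2 * (x.2 + embConj n σ z) ^ 2 with hf
  have hfin : {z : ZK n | f z ≤ f 0}.Finite := by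
    set r := Real.sqrt (f 0) with hr
    have hf0 : 0 ≤ f 0 := by positivity
    have hr0 : 0 ≤ r := Real.sqrt_nonneg _
    have hr2 : r ^ 2 = f 0 := Real.sq_sqrt hf0
    refine (finite_setOf_abs_le hn hsq hσ (r + |x.1| + (r / k + |x.2|))).subset fun z hz => ?_
    have hz' : (x.1 + emb n z) ^ 2 + k ^ 2 * (x.2 + embConj n σ z) ^ 2 ≤ r ^ 2 := by
      rw [hr2]; exact hz
    have h1 : |x.1 + emb n z| ≤ r := by
      refine abs_le_of_sq_le_sq ?_ hr0
      nlinarith [sq_nonneg (k * (x.2 + embConj n σ z))]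
    have h2 : |k * (x.2 + embConj n σ z)| ≤ r := by
      refine abs_le_of_sq_le_sq ?_ hr0
      nlinarith [sq_nonneg (x.1 + emb n z)]
    rw [abs_mul, abs_of_pos hk, mul_comm, ← le_div_iff₀ hk] at h2
    have t1 : |emb n z| ≤ |x.1 + emb n z| + |x.1| := by
      have := abs_sub (x.1 + emb n z) x.1
      rwa [add_sub_cancel_left] at this
    have t2 : |embConj n σ z| ≤ |x.2 + embConj n σ z| + |x.2| := by
      have := abs_sub (x.2 + embConj n σ z) x.2
      rwa [add_sub_cancel_left] at this
    have p1 := abs_nonneg x.1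
    have p2 := abs_nonneg x.2
    have p3 : 0 ≤ r / k := by positivity
    exact ⟨by linarith, by linarith⟩
  obtain ⟨z, hz, hmin⟩ := Set.exists_min_image _ f hfin ⟨0, le_refl (f 0)⟩
  have hmin' : ∀ w, f z ≤ f w := fun w => by
    by_cases hw : f w ≤ f 0
    · exact hmin w hw
    · exact le_trans hz (not_le.1 hw).le
  refine ⟨z, fun w => ?_⟩
  have := hmin' (w + z)
  simp only [hf, map_add] at this
  simp only [cubic, planeVec, Prod.fst_add, Prod.snd_add]
  linarith

/-! ### The cusp group -/

theorem prod_ext {p q : ℍ × ℍ} (h1 : p.1.re = q.1.re) (h2 : p.1.im = q.1.im)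
    (h3 : p.2.re = q.2.re) (h4 : p.2.im = q.2.im) : p = q :=
  Prod.ext (UpperHalfPlane.ext (Complex.ext h1 h2)) (UpperHalfPlane.ext (Complex.ext h3 h4))

theorem smul_upper {A : SL(2, ℝ)} (hA : A 1 0 = 0) (z : ℍ) :
    (A • z).re = A 0 0 ^ 2 * z.re + A 0 0 * A 0 1 ∧ (A • z).im = A 0 0 ^ 2 * z.im := by
  have hdet : A 0 0 * A 1 1 = 1 := by
    have := A.det_coe
    rw [Matrix.det_fin_two, hA] at this
    linarith
  have hd : (A 1 1 : ℂ) ≠ 0 := by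
    intro h
    have : A 1 1 = 0 := by exact_mod_cast h
    rw [this] at hdet
    simp at hdet
  have hdet' : (A 0 0 : ℂ) * (A 1 1 : ℂ) = 1 := by exact_mod_cast hdet
  have h : ((A • z : ℍ) : ℂ) = ((A 0 0 ^ 2 : ℝ) : ℂ) * z + ((A 0 0 * A 0 1 : ℝ) : ℂ) := by
    rw [UpperHalfPlane.specialLinearGroup_apply]
    simp only [hA, Algebra.algebraMap_self, RingHom.id_apply, Complex.ofReal_zero, zero_mul,
      zero_add]
    rw [div_eq_iff hd]
    push_cast
    linear_combination (-((A 0 0 : ℂ) * z) - (A 0 1 : ℂ)) * hdet'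
  constructor
  · rw [← UpperHalfPlane.coe_re, h]
    simp [-Complex.ofReal_pow, -Complex.ofReal_mul]
  · rw [← UpperHalfPlane.coe_im, h]
    simp [-Complex.ofReal_pow, -Complex.ofReal_mul]

theorem sl2_ext {R : Type*} [CommRing R] {A B : SL(2, R)} (h00 : A 0 0 = B 0 0)
    (h01 : A 0 1 = B 0 1) (h10 : A 1 0 = B 1 0) (h11 : A 1 1 = B 1 1) : A = B :=
  Matrix.SpecialLinearGroup.ext _ _ (Fin.forall_fin_two.2
    ⟨Fin.forall_fin_two.2 ⟨h00, h01⟩, Fin.forall_fin_two.2 ⟨h10, h11⟩⟩)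

variable (n) in
/-- The matrix `(u, u⁻¹ b; 0, u⁻¹)`. -/
noncomputable def cuspMat (u : (ZK n)ˣ) (b : ZK n) : SL(2, ZK n) :=
  ⟨!![(u : ZK n), ((u⁻¹ : (ZK n)ˣ) : ZK n) * b; 0, ((u⁻¹ : (ZK n)ˣ) : ZK n)], by
    simp [Matrix.det_fin_two]⟩

variable (n) in
/-- The class of `(u, u⁻¹ b; 0, u⁻¹)`, which acts on the real parts by `x ↦ u² x + b`. -/
noncomputable def cuspElt (u : (ZK n)ˣ) (b : ZK n) : PSL2 n := toPSL n (cuspMat n u b)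

theorem cuspMat_zero_zero (u : (ZK n)ˣ) (b : ZK n) : cuspMat n u b 0 0 = u := rfl

theorem cuspMat_zero_one (u : (ZK n)ˣ) (b : ZK n) :
    cuspMat n u b 0 1 = ((u⁻¹ : (ZK n)ˣ) : ZK n) * b := rfl

theorem tau_eq (z : ZK n) : tau n z = cuspElt n 1 z :=
  congrArg (toPSL n) (sl2_ext rfl (by rw [cuspMat_zero_one, inv_one, Units.val_one, one_mul]; rfl)
    rfl (by change (1 : ZK n) = ((1⁻¹ : (ZK n)ˣ) : ZK n); rw [inv_one, Units.val_one]))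

theorem eta_eq (ε : (ZK n)ˣ) : eta n ε = cuspElt n ε 0 :=
  congrArg (toPSL n) (sl2_ext rfl (by rw [cuspMat_zero_one, mul_zero]; rfl) rfl rfl)

theorem cuspElt_neg (u : (ZK n)ˣ) (b : ZK n) : cuspElt n (-u) b = cuspElt n u b := by
  have h : cuspMat n (-u) b = -cuspMat n u b := by
    refine sl2_ext rfl ?_ ?_ ?_
    · change (((-u)⁻¹ : (ZK n)ˣ) : ZK n) * b = -(((u⁻¹ : (ZK n)ˣ) : ZK n) * b)
      rw [inv_neg, Units.val_neg, neg_mul]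
    · change (0 : ZK n) = -0
      rw [neg_zero]
    · change (((-u)⁻¹ : (ZK n)ˣ) : ZK n) = -((u⁻¹ : (ZK n)ˣ) : ZK n)
      rw [inv_neg, Units.val_neg]
  refine QuotientGroup.eq.2 ?_
  rw [h, inv_neg, neg_mul, inv_mul_cancel, Subgroup.mem_center_iff]
  intro A
  rw [mul_neg, neg_mul, mul_one, one_mul]

theorem act_toPSL (A : SL(2, ZK n)) (p : ℍ × ℍ) :
    act n σ (toPSL n A) p = (Matrix.SpecialLinearGroup.map (emb n) A • p.1,
      Matrix.SpecialLinearGroup.map (embConj n σ) A • p.2) := rfl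

theorem embConj_unit_mul_inv (u : (ZK n)ˣ) :
    embConj n σ u * embConj n σ ((u⁻¹ : (ZK n)ˣ) : ZK n) = 1 := by
  rw [← map_mul]; simp

theorem act_cuspElt (u : (ZK n)ˣ) (b : ZK n) (p : ℍ × ℍ) :
    (act n σ (cuspElt n u b) p).1.re = emb n u ^ 2 * p.1.re + emb n b ∧
    (act n σ (cuspElt n u b) p).1.im = emb n u ^ 2 * p.1.im ∧
    (act n σ (cuspElt n u b) p).2.re = embConj n σ u ^ 2 * p.2.re + embConj n σ b ∧
    (act n σ (cuspElt n u b) p).2.im = embConj n σ u ^ 2 * p.2.im := by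
  have h1 := smul_upper (A := Matrix.SpecialLinearGroup.map (emb n) (cuspMat n u b))
    (map_zero (emb n)) p.1
  have h2 := smul_upper (A := Matrix.SpecialLinearGroup.map (embConj n σ) (cuspMat n u b))
    (map_zero (embConj n σ)) p.2
  have e1 := emb_mul_emb_inv u
  have e2 := embConj_unit_mul_inv (σ := σ) u
  rw [cuspElt, act_toPSL]
  simp only [Matrix.SpecialLinearGroup.map_apply_coe, RingHom.mapMatrix_apply, Matrix.map_apply,
    cuspMat_zero_zero, cuspMat_zero_one, map_mul] at h1 h2
  refine ⟨?_, h1.2, ?_, h2.2⟩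
  · rw [h1.1, ← mul_assoc, e1, one_mul]
  · rw [h2.1, ← mul_assoc, e2, one_mul]

theorem toPSL_mem_cuspGroup_iff (A : SL(2, ZK n)) : toPSL n A ∈ cuspGroup n σ ↔ A 1 0 = 0 := by
  have h : toPSL n A ∈ cuspGroup n σ ↔
      ((Matrix.SpecialLinearGroup.toGL (Matrix.SpecialLinearGroup.map (emb n) A) •
        (OnePoint.infty : OnePoint ℝ)) = OnePoint.infty ∧
      (Matrix.SpecialLinearGroup.toGL (Matrix.SpecialLinearGroup.map (embConj n σ) A) •
        (OnePoint.infty : OnePoint ℝ)) = OnePoint.infty) := Prod.ext_iff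
  rw [h, OnePoint.smul_infty_eq_self_iff, OnePoint.smul_infty_eq_self_iff]
  constructor
  · rintro ⟨h1, -⟩
    exact emb_injective n (by simpa using h1)
  · intro h1
    simp [h1]

theorem mem_cuspGroup_iff {γ : PSL2 n} : γ ∈ cuspGroup n σ ↔ ∃ u b, γ = cuspElt n u b := by
  constructor
  · intro h
    obtain ⟨A, rfl⟩ := QuotientGroup.mk'_surjective _ γ
    have h0 := (toPSL_mem_cuspGroup_iff A).1 h
    have hdet : A 0 0 * A 1 1 = 1 := by
      have := A.det_coe
      rw [Matrix.det_fin_two, h0] at this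
      simpa using this
    refine ⟨Units.mkOfMulEqOne _ _ hdet, A 0 0 * A 0 1, ?_⟩
    refine congrArg (toPSL n) (sl2_ext rfl ?_ h0 rfl)
    change A 0 1 = A 1 1 * (A 0 0 * A 0 1)
    linear_combination (-A 0 1) * hdet
  · rintro ⟨u, b, rfl⟩
    exact (toPSL_mem_cuspGroup_iff _).2 rfl

theorem tau_mem_unipotents (z : ZK n) : tau n z ∈ unipotents n σ := by
  refine ⟨mem_cuspGroup_iff.2 ⟨1, z, tau_eq z⟩, _, rfl, 2, ?_⟩
  change (!![1, z; 0, 1] - 1 : Matrix (Fin 2) (Fin 2) (ZK n)) ^ 2 = 0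
  rw [Matrix.one_fin_two, sq]
  simp

/-- Nilpotency of `A - 1` kills its determinant `(a - 1)(d - 1)`; with `a d = 1` both diagonal
entries are `1`. -/
theorem mem_unipotents_iff {γ : PSL2 n} : γ ∈ unipotents n σ ↔ ∃ z, γ = tau n z := by
  constructor
  · rintro ⟨h, A, rfl, j, hj⟩
    have h0 := (toPSL_mem_cuspGroup_iff A).1 h
    have hdet : A 0 0 * A 1 1 = 1 := by
      have := A.det_coe
      rw [Matrix.det_fin_two, h0] at this
      simpa using this
    have h1 : (A 0 0 - 1) * (A 1 1 - 1) = 0 := by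
      have h2 : ((A : Matrix (Fin 2) (Fin 2) (ZK n)) - 1).det ^ j = 0 := by
        rw [← Matrix.det_pow, hj, Matrix.det_zero]
      have h3 := eq_zero_of_pow_eq_zero h2
      rw [Matrix.det_fin_two] at h3
      simpa [h0] using h3
    have h2 : A 0 0 = 1 ∧ A 1 1 = 1 := by
      rcases mul_eq_zero.1 h1 with h2 | h2
      · have h3 := sub_eq_zero.1 h2
        rw [h3, one_mul] at hdet
        exact ⟨h3, hdet⟩
      · have h3 := sub_eq_zero.1 h2
        rw [h3, mul_one] at hdet
        exact ⟨hdet, h3⟩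
    exact ⟨A 0 1, congrArg (toPSL n) (sl2_ext h2.1 rfl h0 h2.2)⟩
  · rintro ⟨z, rfl⟩
    exact tau_mem_unipotents z

end HilbertCusp

namespace HilbertCusp

variable {n : ℕ} {σ : QuadField n ≃ₐ[ℚ] QuadField n} {k h : ℝ} {z z' v w b : ZK n} {L : Set (ZK n)}
  {p q : ℍ × ℍ} {S : Set ℝ}

/-! ### The Dirichlet domains -/

variable (n σ) in
/-- The points that satisfy all the cubic inequalities. -/
def voronoi : Set (ℍ × ℍ) := {p | ∀ z : ZK n, 0 ≤ cubic n σ z (Psi p)}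

theorem mem_voronoi_iff : p ∈ voronoi n σ ↔ proj p ∈ cell n σ (p.1.im / p.2.im) := Iff.rfl

theorem delta_of_im_eq (h1 : p.1.im = q.1.im) (h2 : p.2.im = q.2.im) :
    delta p q = (p.1.re - q.1.re) ^ 2 / p.1.im ^ 2 + (p.2.re - q.2.re) ^ 2 / p.2.im ^ 2 := by
  have e1 : ‖(p.1 : ℂ) - (q.1 : ℂ)‖ ^ 2 = (p.1.re - q.1.re) ^ 2 := by
    rw [Complex.sq_norm, Complex.normSq_apply]
    simp [h1, sq]
  have e2 : ‖(p.2 : ℂ) - (q.2 : ℂ)‖ ^ 2 = (p.2.re - q.2.re) ^ 2 := by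
    rw [Complex.sq_norm, Complex.normSq_apply]
    simp [h2, sq]
  rw [delta, e1, e2, ← h1, ← h2, sq p.1.im, sq p.2.im]

theorem act_tau (z : ZK n) (p : ℍ × ℍ) :
    (act n σ (tau n z) p).1.re = p.1.re + emb n z ∧ (act n σ (tau n z) p).1.im = p.1.im ∧
    (act n σ (tau n z) p).2.re = p.2.re + embConj n σ z ∧
    (act n σ (tau n z) p).2.im = p.2.im := by
  rw [tau_eq]
  have := act_cuspElt (σ := σ) 1 z p
  simpa using this

theorem proj_act_tau (z : ZK n) (p : ℍ × ℍ) :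
    proj (act n σ (tau n z) p) = proj p + planeVec n σ z := by
  obtain ⟨h1, -, h3, -⟩ := act_tau (σ := σ) z p
  exact Prod.ext h1 h3

theorem level_act_tau (z : ZK n) (p : ℍ × ℍ) :
    (act n σ (tau n z) p).1.im / (act n σ (tau n z) p).2.im = p.1.im / p.2.im := by
  obtain ⟨-, h2, -, h4⟩ := act_tau (σ := σ) z p
  rw [h2, h4]

theorem act_tau_mem_voronoi (z : ZK n) (p : ℍ × ℍ) : act n σ (tau n z) p ∈ voronoi n σ ↔
    proj p + planeVec n σ z ∈ cell n σ (p.1.im / p.2.im) := by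
  rw [mem_voronoi_iff, proj_act_tau, level_act_tau]

theorem cubic_act_tau (v z : ZK n) (p : ℍ × ℍ) : cubic n σ v (Psi (act n σ (tau n z) p)) =
    cubic n σ (v + z) (Psi p) - cubic n σ z (Psi p) := by
  have e : Psi (act n σ (tau n z) p) =
      ((proj p + planeVec n σ z).1, (proj p + planeVec n σ z).2, p.1.im / p.2.im) := by
    rw [← proj_act_tau, ← level_act_tau z p]; rfl
  rw [e, cubic_add_planeVec]
  rfl

theorem mem_dirichletDomain_iff :
    p ∈ dirichletDomain n σ (unipotents n σ) (axisPoint p) ↔ p ∈ voronoi n σ := by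
  -- Multiplying the difference of the two distances by `y₁²` replaces `1 / y₂²` by `k²`, which is
  -- where the cubic comes from.
  have key : ∀ z : ZK n, delta (axisPoint p) (act n σ (tau n z) p) =
      delta (axisPoint p) p + cubic n σ z (Psi p) / p.1.im ^ 2 := by
    intro z
    obtain ⟨h1, h2, h3, h4⟩ := act_tau (σ := σ) z p
    have a1 : (axisPoint p).1.im = p.1.im := rfl
    have a2 : (axisPoint p).2.im = p.2.im := rfl
    have a3 : (axisPoint p).1.re = 0 := rfl
    have a4 : (axisPoint p).2.re = 0 := rfl
    rw [delta_of_im_eq (by rw [h2, a1]) (by rw [h4, a2]), delta_of_im_eq a1 a2, h1, h3, a1, a2, a3,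
      a4, cubic, Psi]
    have := p.1.im_pos.ne'
    have := p.2.im_pos.ne'
    field_simp
    ring
  constructor
  · intro hp z
    have := hp _ (tau_mem_unipotents z)
    rw [key z] at this
    have h2 : 0 ≤ cubic n σ z (Psi p) / p.1.im ^ 2 := by linarith
    have h3 : 0 < p.1.im ^ 2 := pow_pos p.1.im_pos 2
    rwa [le_div_iff₀ h3, zero_mul] at h2
  · intro hp γ hγ
    obtain ⟨z, rfl⟩ := mem_unipotents_iff.1 hγ
    rw [key z]
    have := div_nonneg (hp z) (sq_nonneg p.1.im)
    linarith

theorem mem_torus_iff {y₁ y₂ : ℝ} :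
    p ∈ torus n σ y₁ y₂ ↔ p.1.im = y₁ ∧ p.2.im = y₂ ∧ p ∈ voronoi n σ := by
  rw [← mem_dirichletDomain_iff, ← and_assoc]
  rfl

theorem regionU_eq : regionU n σ = voronoi n σ := by
  ext p
  simp only [regionU, Set.mem_iUnion, mem_torus_iff, exists_prop]
  constructor
  · rintro ⟨_, _, _, _, _, _, h⟩
    exact h
  · intro h
    exact ⟨_, _, p.1.im_pos, p.2.im_pos, rfl, rfl, h⟩

theorem mem_regionD_iff {ε : (ZK n)ˣ} :
    p ∈ regionD n ε ↔ p.1.im / p.2.im ∈ Set.Ico 1 (emb n ε ^ 4) := by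
  rw [Set.mem_Ico, one_le_div p.2.im_pos, div_lt_iff₀ p.2.im_pos]
  rfl

theorem mem_region_iff {ε : (ZK n)ˣ} : p ∈ region n σ ε ↔
    p ∈ voronoi n σ ∧ p.1.im / p.2.im ∈ Set.Ico 1 (emb n ε ^ 4) := by
  rw [region, Set.mem_inter_iff, regionU_eq, mem_regionD_iff]

variable (n σ) in
/-- The tori at height `h²` whose level lies in `S`. -/
def levelSection (h : ℝ) (S : Set ℝ) : Set (ℍ × ℍ) :=
  {p | p ∈ voronoi n σ ∧ p.1.im * p.2.im = h ^ 2 ∧ p.1.im / p.2.im ∈ S}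

theorem eq_sqrt_iff {y₁ y₂ : ℝ} (h1 : 0 < y₁) (h2 : 0 < y₂) (hh : 0 < h) (hk : 0 < k) :
    (y₁ = h * Real.sqrt k ∧ y₂ = h / Real.sqrt k) ↔ y₁ * y₂ = h ^ 2 ∧ y₁ / y₂ = k := by
  have hs := Real.sqrt_pos.2 hk
  have hs2 := Real.sq_sqrt hk.le
  constructor
  · rintro ⟨rfl, rfl⟩
    constructor
    · field_simp
    · field_simp
      exact hs2
  · rintro ⟨e1, rfl⟩
    have hy : y₁ = h * Real.sqrt (y₁ / y₂) := by
      refine (sq_eq_sq₀ h1.le (by positivity)).1 ?_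
      rw [mul_pow, hs2, ← e1]
      field_simp
    refine ⟨hy, ?_⟩
    rw [eq_div_iff hs.ne']
    have : h * (y₂ * Real.sqrt (y₁ / y₂)) = h * h := by
      calc _ = (h * Real.sqrt (y₁ / y₂)) * y₂ := by ring
        _ = h * h := by rw [← hy, e1, sq]
    exact mul_left_cancel₀ hh.ne' this

theorem mem_torus_sqrt_iff (hh : 0 < h) (hk : 0 < k) :
    p ∈ torus n σ (h * Real.sqrt k) (h / Real.sqrt k) ↔ p ∈ levelSection n σ h {k} := by
  rw [mem_torus_iff, ← and_assoc, eq_sqrt_iff p.1.im_pos p.2.im_pos hh hk, and_comm]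
  rfl

theorem iUnion_torus_eq (hh : 0 < h) (hS : ∀ k ∈ S, 0 < k) :
    ⋃ k ∈ S, torus n σ (h * Real.sqrt k) (h / Real.sqrt k) = levelSection n σ h S := by
  ext p
  simp only [Set.mem_iUnion, exists_prop]
  constructor
  · rintro ⟨k, hk, hp⟩
    obtain ⟨a, b, rfl⟩ := (mem_torus_sqrt_iff hh (hS k hk)).1 hp
    exact ⟨a, b, hk⟩
  · rintro ⟨a, b, hk⟩
    exact ⟨_, hk, (mem_torus_sqrt_iff hh (hS _ hk)).2 ⟨a, b, rfl⟩⟩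

theorem cuspSection_eq (hh : 0 < h) (ε : (ZK n)ˣ) :
    cuspSection n σ ε h = levelSection n σ h (Set.Ico 1 (emb n ε ^ 4)) :=
  iUnion_torus_eq hh fun _ hk => one_pos.trans_le hk.1

theorem mem_flatSection_iff {ε : (ZK n)ˣ} : p ∈ flatSection n σ ε h ↔
    p ∈ voronoi n σ ∧ p.2.im = h ∧ p.1.im / p.2.im ∈ Set.Ico 1 (emb n ε ^ 4) := by
  simp only [flatSection, Set.mem_iUnion, exists_prop, mem_torus_iff]
  constructor
  · rintro ⟨k, hk, h1, h2, h3⟩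
    refine ⟨h3, h2, ?_⟩
    have := p.2.im_pos
    rw [h1, ← h2, mul_comm, mul_div_cancel_right₀ _ this.ne']
    exact hk
  · rintro ⟨h1, h2, h3⟩
    refine ⟨_, h3, ?_, h2, h1⟩
    rw [← h2, mul_div_cancel₀ _ p.2.im_pos.ne']

/-! ### The map `Ψ` on a section -/

theorem continuous_Psi : Continuous Psi := by
  have h1 : Continuous fun p : ℍ × ℍ => p.1.re := UpperHalfPlane.continuous_re.comp continuous_fst
  have h2 : Continuous fun p : ℍ × ℍ => p.2.re := UpperHalfPlane.continuous_re.comp continuous_snd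
  have h3 : Continuous fun p : ℍ × ℍ => p.1.im := UpperHalfPlane.continuous_im.comp continuous_fst
  have h4 : Continuous fun p : ℍ × ℍ => p.2.im := UpperHalfPlane.continuous_im.comp continuous_snd
  exact h1.prodMk (h2.prodMk (h3.div h4 fun p => p.2.im_pos.ne'))

/-- A section of `Ψ` over the points of level at least `1`, with image at height `h²`. -/
noncomputable def liftPsi (hh : 0 < h) (q : ℝ × ℝ × ℝ) : ℍ × ℍ :=
  (⟨⟨q.1, h * Real.sqrt (max q.2.2 1)⟩,
      mul_pos hh (Real.sqrt_pos.2 (lt_max_of_lt_right one_pos))⟩,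
    ⟨⟨q.2.1, h / Real.sqrt (max q.2.2 1)⟩,
      div_pos hh (Real.sqrt_pos.2 (lt_max_of_lt_right one_pos))⟩)

/-- Clamping the level at `1` makes the section continuous on all of `ℝ³`, so closures can be
transported through it. -/
theorem continuous_liftPsi (hh : 0 < h) : Continuous (liftPsi hh) := by
  have hs : Continuous fun q : ℝ × ℝ × ℝ => Real.sqrt (max q.2.2 1) := by fun_prop
  have hs0 : ∀ q : ℝ × ℝ × ℝ, Real.sqrt (max q.2.2 1) ≠ 0 := fun q =>
    (Real.sqrt_pos.2 (lt_max_of_lt_right one_pos)).ne'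
  refine Continuous.prodMk ?_ ?_
  · rw [UpperHalfPlane.isOpenEmbedding_coe.continuous_iff]
    have : (fun q : ℝ × ℝ × ℝ => ((q.1 : ℂ) + (h * Real.sqrt (max q.2.2 1) : ℝ) * Complex.I)) =
        UpperHalfPlane.coe ∘ fun q => (liftPsi hh q).1 := by
      funext q
      exact (Complex.mk_eq_add_mul_I _ _).symm
    change Continuous (UpperHalfPlane.coe ∘ fun q => (liftPsi hh q).1)
    rw [← this]
    fun_prop
  · rw [UpperHalfPlane.isOpenEmbedding_coe.continuous_iff]
    have : (fun q : ℝ × ℝ × ℝ => ((q.2.1 : ℂ) + (h / Real.sqrt (max q.2.2 1) : ℝ) * Complex.I)) =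
        UpperHalfPlane.coe ∘ fun q => (liftPsi hh q).2 := by
      funext q
      exact (Complex.mk_eq_add_mul_I _ _).symm
    change Continuous (UpperHalfPlane.coe ∘ fun q => (liftPsi hh q).2)
    rw [← this]
    have hd : Continuous fun q : ℝ × ℝ × ℝ => h / Real.sqrt (max q.2.2 1) :=
      continuous_const.div hs hs0
    exact (Complex.continuous_ofReal.comp (by fun_prop)).add
      ((Complex.continuous_ofReal.comp hd).mul continuous_const)

theorem liftPsi_im (hh : 0 < h) {q : ℝ × ℝ × ℝ} (hq : 1 ≤ q.2.2) :
    (liftPsi hh q).1.im * (liftPsi hh q).2.im = h ^ 2 ∧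
      (liftPsi hh q).1.im / (liftPsi hh q).2.im = q.2.2 := by
  refine (eq_sqrt_iff (liftPsi hh q).1.im_pos (liftPsi hh q).2.im_pos hh (one_pos.trans_le hq)).1 ?_
  have e : max q.2.2 1 = q.2.2 := max_eq_left hq
  constructor
  · change h * Real.sqrt (max q.2.2 1) = _
    rw [e]
  · change h / Real.sqrt (max q.2.2 1) = _
    rw [e]

theorem Psi_liftPsi (hh : 0 < h) {q : ℝ × ℝ × ℝ} (hq : 1 ≤ q.2.2) : Psi (liftPsi hh q) = q :=
  Prod.ext rfl (Prod.ext rfl (liftPsi_im hh hq).2)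

theorem liftPsi_Psi (hh : 0 < h) (h1 : p.1.im * p.2.im = h ^ 2) (h2 : 1 ≤ p.1.im / p.2.im) :
    liftPsi hh (Psi p) = p := by
  have e : max (p.1.im / p.2.im) 1 = p.1.im / p.2.im := max_eq_left h2
  have := (eq_sqrt_iff p.1.im_pos p.2.im_pos hh (one_pos.trans_le h2)).2 ⟨h1, rfl⟩
  refine prod_ext rfl ?_ rfl ?_
  · change h * Real.sqrt (max (p.1.im / p.2.im) 1) = _
    rw [e, ← this.1]
  · change h / Real.sqrt (max (p.1.im / p.2.im) 1) = _
    rw [e, ← this.2]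

theorem levelSection_eq_image (hh : 0 < h) (hS : ∀ k ∈ S, 1 ≤ k) :
    levelSection n σ h S = liftPsi hh '' {q | q.2.2 ∈ S ∧ ∀ z, 0 ≤ cubic n σ z q} := by
  ext p
  constructor
  · rintro ⟨h1, h2, h3⟩
    exact ⟨Psi p, ⟨h3, h1⟩, liftPsi_Psi hh h2 (hS _ h3)⟩
  · rintro ⟨q, ⟨h1, h2⟩, rfl⟩
    have := liftPsi_im hh (hS _ h1)
    refine ⟨fun z => ?_, this.1, by rw [this.2]; exact h1⟩
    rw [Psi_liftPsi hh (hS _ h1)]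
    exact h2 z

theorem Psi_image_levelSection (hh : 0 < h) (hS : ∀ k ∈ S, 1 ≤ k) :
    Psi '' levelSection n σ h S = {q | q.2.2 ∈ S ∧ ∀ z, 0 ≤ cubic n σ z q} := by
  rw [levelSection_eq_image hh hS, Set.image_image]
  ext q
  constructor
  · rintro ⟨q, hq, rfl⟩
    simp only [Psi_liftPsi hh (hS _ hq.1)]
    exact hq
  · intro hq
    exact ⟨q, hq, Psi_liftPsi hh (hS _ hq.1)⟩

theorem isClosed_levelSection (hS : IsClosed S) : IsClosed (levelSection n σ h S) := by
  have e : levelSection n σ h S = (⋂ z : ZK n, {p : ℍ × ℍ | 0 ≤ cubic n σ z (Psi p)}) ∩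
      ({p : ℍ × ℍ | p.1.im * p.2.im = h ^ 2} ∩ (fun p : ℍ × ℍ => (Psi p).2.2) ⁻¹' S) := by
    ext p
    simp only [Set.mem_inter_iff, Set.mem_iInter]
    rfl
  have h3 : Continuous fun p : ℍ × ℍ => p.1.im := UpperHalfPlane.continuous_im.comp continuous_fst
  have h4 : Continuous fun p : ℍ × ℍ => p.2.im := UpperHalfPlane.continuous_im.comp continuous_snd
  rw [e]
  exact (isClosed_iInter fun z =>
    isClosed_le continuous_const ((continuous_cubic z).comp continuous_Psi)).inter
    ((isClosed_eq (h3.mul h4) continuous_const).inter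
      (hS.preimage (continuous_snd.comp (continuous_snd.comp continuous_Psi))))

theorem proj_image_torus (hh : 0 < h) (hk : 1 ≤ k) :
    proj '' torus n σ (h * Real.sqrt k) (h / Real.sqrt k) = cell n σ k := by
  have e : torus n σ (h * Real.sqrt k) (h / Real.sqrt k) = levelSection n σ h {k} := by
    ext p; exact mem_torus_sqrt_iff hh (one_pos.trans_le hk)
  have hS : ∀ k' ∈ ({k} : Set ℝ), 1 ≤ k' := by rintro k' rfl; exact hk
  have hP := Psi_image_levelSection (n := n) (σ := σ) hh hS
  rw [e]
  ext x
  constructor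
  · rintro ⟨p, hp, rfl⟩ z
    have := hp.1 z
    have hk' : p.1.im / p.2.im = k := hp.2.2
    rw [← hk']
    exact this
  · intro hx
    have : (x.1, x.2, k) ∈ Psi '' levelSection n σ h {k} := by
      rw [hP]; exact ⟨rfl, hx⟩
    obtain ⟨p, hp, hpx⟩ := this
    refine ⟨p, hp, ?_⟩
    have h1 := congrArg Prod.fst hpx
    have h2 := congrArg (fun q => q.2.1) hpx
    exact Prod.ext h1 h2

theorem slice_Psi_image_voronoi (hk : 0 < k) : slice (Psi '' voronoi n σ) k = cell n σ k := by
  ext x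
  constructor
  · rintro ⟨p, hp, hpx⟩ z
    rw [← hpx]
    exact hp z
  · intro hx
    refine ⟨(⟨⟨x.1, k⟩, hk⟩, ⟨⟨x.2, 1⟩, one_pos⟩), ?_, ?_⟩
    · intro z
      have e : Psi (⟨⟨x.1, k⟩, hk⟩, ⟨⟨x.2, 1⟩, one_pos⟩) = (x.1, x.2, k) :=
        Prod.ext rfl (Prod.ext rfl (div_one k))
      rw [e]
      exact hx z
    · exact Prod.ext rfl (Prod.ext rfl (div_one k))

end HilbertCusp

namespace HilbertCusp

variable {n : ℕ} {σ : QuadField n ≃ₐ[ℚ] QuadField n} {k h : ℝ} {z z' v w b : ZK n} {L : Set (ZK n)}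
  {p q : ℍ × ℍ} {S : Set ℝ} {ε : (ZK n)ˣ} {m : ℕ}

/-! ### The cusp section as a solid -/

theorem cubic_nonneg_of_sideList (hn : 1 < n) (hsq : Squarefree n) (hσ : σ ≠ 1)
    (hε : IsFundamentalUnit n ε) (hm : m ∈ stopIndices n σ ε) {q : ℝ × ℝ × ℝ}
    (hq : q.2.2 ∈ Set.Icc (1 : ℝ) (emb n ε ^ 4)) (hL : ∀ z ∈ sideList n σ m, 0 ≤ cubic n σ z q)
    (z : ZK n) : 0 ≤ cubic n σ z q := by
  obtain ⟨u, u', ho, hsub, -⟩ := exists_isObtuse hn hsq hσ hε hm hq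
  exact ho.cubic_nonneg rfl (fun p hp => hL p (hsub hp)) z

theorem solid_sideList_eq (hn : 1 < n) (hsq : Squarefree n) (hσ : σ ≠ 1)
    (hε : IsFundamentalUnit n ε) (hm : m ∈ stopIndices n σ ε) :
    solid n σ (sideList n σ m) (emb n ε ^ 4) =
      {q | q.2.2 ∈ Set.Ico (1 : ℝ) (emb n ε ^ 4) ∧ ∀ z, 0 ≤ cubic n σ z q} := by
  ext q
  constructor
  · rintro ⟨h1, h2, h3⟩
    exact ⟨⟨h1, h2⟩, cubic_nonneg_of_sideList hn hsq hσ hε hm ⟨h1, h2.le⟩ h3⟩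
  · rintro ⟨⟨h1, h2⟩, h3⟩
    exact ⟨h1, h2, fun z _ => h3 z⟩

theorem closedSolid_sideList_eq (hn : 1 < n) (hsq : Squarefree n) (hσ : σ ≠ 1)
    (hε : IsFundamentalUnit n ε) (hm : m ∈ stopIndices n σ ε) :
    closedSolid n σ (sideList n σ m) (emb n ε ^ 4) =
      {q | q.2.2 ∈ Set.Icc (1 : ℝ) (emb n ε ^ 4) ∧ ∀ z, 0 ≤ cubic n σ z q} := by
  ext q
  constructor
  · rintro ⟨h1, h2, h3⟩
    exact ⟨⟨h1, h2⟩, cubic_nonneg_of_sideList hn hsq hσ hε hm ⟨h1, h2⟩ h3⟩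
  · rintro ⟨⟨h1, h2⟩, h3⟩
    exact ⟨h1, h2, fun z _ => h3 z⟩

theorem Psi_image_cuspSection (hn : 1 < n) (hsq : Squarefree n) (hσ : σ ≠ 1)
    (hε : IsFundamentalUnit n ε) (hm : m ∈ stopIndices n σ ε) (hh : 0 < h) :
    Psi '' cuspSection n σ ε h = solid n σ (sideList n σ m) (emb n ε ^ 4) := by
  rw [cuspSection_eq hh, Psi_image_levelSection hh fun _ hk => hk.1,
    solid_sideList_eq hn hsq hσ hε hm]

theorem closure_solid_sideList (hn : 1 < n) (hsq : Squarefree n) (hσ : σ ≠ 1)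
    (hε : IsFundamentalUnit n ε) (hm : m ∈ stopIndices n σ ε) :
    closure (solid n σ (sideList n σ m) (emb n ε ^ 4)) =
      {q | q.2.2 ∈ Set.Icc (1 : ℝ) (emb n ε ^ 4) ∧ ∀ z, 0 ≤ cubic n σ z q} := by
  rw [closure_solid (finite_sideList n σ m)
    (fun z hz => ne_zero_of_mem_sideList hn hsq hσ hε hm hz)
    (one_lt_pow₀ hε.one_lt four_ne_zero), closedSolid_sideList_eq hn hsq hσ hε hm]

theorem closure_cuspSection (hn : 1 < n) (hsq : Squarefree n) (hσ : σ ≠ 1)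
    (hε : IsFundamentalUnit n ε) (hm : m ∈ stopIndices n σ ε) (hh : 0 < h) :
    closure (cuspSection n σ ε h) = levelSection n σ h (Set.Icc 1 (emb n ε ^ 4)) := by
  rw [cuspSection_eq hh]
  refine Set.Subset.antisymm (closure_minimal ?_ (isClosed_levelSection isClosed_Icc)) ?_
  · rintro p ⟨h1, h2, h3⟩
    exact ⟨h1, h2, Set.Ico_subset_Icc_self h3⟩
  · rw [levelSection_eq_image hh fun _ hk => hk.1, levelSection_eq_image hh fun _ hk => hk.1,
      ← closure_solid_sideList hn hsq hσ hε hm, ← solid_sideList_eq hn hsq hσ hε hm]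
    exact image_closure_subset_closure_image (continuous_liftPsi hh)

theorem slice_closure_eq_cell (hn : 1 < n) (hsq : Squarefree n) (hσ : σ ≠ 1)
    (hε : IsFundamentalUnit n ε) (hm : m ∈ stopIndices n σ ε) (hh : 0 < h)
    (hk : k ∈ Set.Icc (1 : ℝ) (emb n ε ^ 4)) :
    slice (closure (Psi '' cuspSection n σ ε h)) k = cell n σ k := by
  rw [Psi_image_cuspSection hn hsq hσ hε hm hh, closure_solid_sideList hn hsq hσ hε hm]
  ext x
  exact ⟨fun hx => hx.2, fun hx => ⟨hk, hx⟩⟩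

/-! ### The action of the cusp group on levels -/

theorem IsFundamentalUnit.abs_cases (hε : IsFundamentalUnit n ε) (u : (ZK n)ˣ) :
    |emb n u| = 1 ∨ emb n ε ≤ |emb n u| ∨ |emb n u| * emb n ε ≤ 1 := by
  rcases lt_trichotomy |emb n u| 1 with h | h | h
  · right; right
    have h1 := emb_mul_emb_inv u
    have h2 : |emb n u| * |emb n ((u⁻¹ : (ZK n)ˣ) : ZK n)| = 1 := by rw [← abs_mul, h1, abs_one]
    have h3 : 0 < |emb n u| := abs_pos.2 (emb_ne_zero u.ne_zero)
    have h4 : 1 < |emb n ((u⁻¹ : (ZK n)ˣ) : ZK n)| := by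
      by_contra hle
      push Not at hle
      have := mul_le_mul_of_nonneg_left hle h3.le
      linarith
    have h5 := mul_le_mul_of_nonneg_left (hε.le_abs h4) h3.le
    rwa [h2] at h5
  · exact Or.inl h
  · exact Or.inr (Or.inl (hε.le_abs h))

theorem cuspElt_eq_tau {u : (ZK n)ˣ} (hu : |emb n u| = 1) (b : ZK n) : cuspElt n u b = tau n b := by
  rw [tau_eq]
  rcases (abs_eq zero_le_one).1 hu with h | h
  · have : u = 1 := Units.ext (emb_injective n (by rw [h]; simp))
    rw [this]
  · have : u = -1 := Units.ext (emb_injective n (by rw [h]; simp))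
    rw [this, cuspElt_neg]

theorem sq_embConj_unit (hsq : Squarefree n) (hσ : σ ≠ 1) (u : (ZK n)ˣ) :
    embConj n σ u ^ 2 = (emb n u ^ 2)⁻¹ :=
  eq_inv_of_mul_eq_one_right (sq_emb_mul_sq_embConj_unit hsq hσ u)

theorem level_act_cuspElt (hsq : Squarefree n) (hσ : σ ≠ 1) (u : (ZK n)ˣ) (b : ZK n)
    (p : ℍ × ℍ) :
    (act n σ (cuspElt n u b) p).1.im / (act n σ (cuspElt n u b) p).2.im =
      emb n u ^ 4 * (p.1.im / p.2.im) := by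
  obtain ⟨-, h2, -, h4⟩ := act_cuspElt (σ := σ) u b p
  have := p.2.im_pos.ne'
  have hu : emb n u ≠ 0 := emb_ne_zero u.ne_zero
  rw [h2, h4, sq_embConj_unit hsq hσ]
  field_simp

theorem height_act_cuspElt (hsq : Squarefree n) (hσ : σ ≠ 1) (u : (ZK n)ˣ) (b : ZK n)
    (p : ℍ × ℍ) :
    (act n σ (cuspElt n u b) p).1.im * (act n σ (cuspElt n u b) p).2.im = p.1.im * p.2.im := by
  obtain ⟨-, h2, -, h4⟩ := act_cuspElt (σ := σ) u b p
  rw [h2, h4]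
  linear_combination (p.1.im * p.2.im) * sq_emb_mul_sq_embConj_unit hsq hσ u

theorem cubic_act_cuspElt (hsq : Squarefree n) (hσ : σ ≠ 1) (u : (ZK n)ˣ) (w : ZK n)
    (p : ℍ × ℍ) :
    cubic n σ ((u : ZK n) ^ 2 * w) (Psi (act n σ (cuspElt n u 0) p)) =
      emb n u ^ 4 * cubic n σ w (Psi p) := by
  obtain ⟨h1, -, h3, -⟩ := act_cuspElt (σ := σ) u 0 p
  have hl := level_act_cuspElt (σ := σ) hsq hσ u 0 p
  have hu : emb n u ≠ 0 := emb_ne_zero u.ne_zero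
  simp only [cubic, Psi]
  rw [hl, h1, h3]
  simp only [map_mul, map_pow, map_zero, add_zero, sq_embConj_unit hsq hσ]
  field_simp

theorem act_cuspElt_mem_voronoi_iff (hsq : Squarefree n) (hσ : σ ≠ 1) (u : (ZK n)ˣ) :
    act n σ (cuspElt n u 0) p ∈ voronoi n σ ↔ p ∈ voronoi n σ := by
  have hu : 0 < emb n u ^ 4 := by have := emb_ne_zero (n := n) u.ne_zero; positivity
  constructor
  · intro hp w
    have := hp ((u : ZK n) ^ 2 * w)
    rw [cubic_act_cuspElt hsq hσ] at this
    exact nonneg_of_mul_nonneg_right this hu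
  · intro hp w
    have e : (u : ZK n) ^ 2 * (((u⁻¹ : (ZK n)ˣ) : ZK n) ^ 2 * w) = w := by
      rw [← mul_assoc, ← mul_pow, Units.mul_inv, one_pow, one_mul]
    rw [← e, cubic_act_cuspElt hsq hσ]
    exact mul_nonneg hu.le (hp _)

theorem act_mul_apply (g g' : PSL2 n) (p : ℍ × ℍ) :
    act n σ (g * g') p = act n σ g (act n σ g' p) := by
  rw [map_mul]; rfl

theorem act_inv_apply (g : PSL2 n) (p : ℍ × ℍ) : act n σ g⁻¹ (act n σ g p) = p := by
  rw [← act_mul_apply, inv_mul_cancel, map_one]; rfl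

/-! ### The fundamental domain -/

theorem exists_mem_image_region (hn : 1 < n) (hsq : Squarefree n) (hσ : σ ≠ 1)
    (hε : IsFundamentalUnit n ε) (p : ℍ × ℍ) :
    ∃ g ∈ cuspGroup n σ, p ∈ act n σ g '' region n σ ε := by
  have hE : 1 < emb n ε ^ 4 := one_lt_pow₀ hε.one_lt four_ne_zero
  obtain ⟨j, hj1, hj2⟩ := exists_mem_Ico_zpow (div_pos p.1.im_pos p.2.im_pos) hE
  -- The level lies in `[ε^(4j), ε^(4j+4))`, and `u` multiplies it by `ε^(-4j)`.
  set u : (ZK n)ˣ := (ε ^ j)⁻¹ with hu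
  have hE0 : 0 < emb n ε := one_pos.trans hε.one_lt
  have hemb : emb n u = (emb n ε ^ j)⁻¹ := by
    have h1 : ((Units.map (emb n : ZK n →* ℝ)) u : ℝ) = emb n u := rfl
    rw [← h1, hu, map_inv, map_zpow, Units.val_inv_eq_inv_val, Units.val_zpow_eq_zpow_val]
    rfl
  have hu4 : emb n u ^ 4 = ((emb n ε ^ 4) ^ j)⁻¹ := by
    rw [hemb, inv_pow, ← zpow_natCast, ← zpow_natCast, ← zpow_mul, ← zpow_mul, mul_comm]
  set p' := act n σ (cuspElt n u 0) p with hp'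
  have hl : p'.1.im / p'.2.im = emb n u ^ 4 * (p.1.im / p.2.im) := level_act_cuspElt hsq hσ u 0 p
  have hEj : 0 < (emb n ε ^ 4) ^ j := by positivity
  have hl1 : p'.1.im / p'.2.im ∈ Set.Ico 1 (emb n ε ^ 4) := by
    rw [hl, hu4, inv_mul_eq_div, Set.mem_Ico, one_le_div hEj, div_lt_iff₀ hEj]
    refine ⟨hj1, hj2.trans_eq ?_⟩
    rw [zpow_add_one₀ (by positivity), mul_comm]
  obtain ⟨z, hz⟩ := exists_add_mem_cell hn hsq hσ (div_pos p'.1.im_pos p'.2.im_pos) (proj p')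
  have hmem : act n σ (tau n z * cuspElt n u 0) p ∈ region n σ ε := by
    rw [act_mul_apply, mem_region_iff, act_tau_mem_voronoi, level_act_tau]
    exact ⟨hz, hl1⟩
  refine ⟨(tau n z * cuspElt n u 0)⁻¹, ?_, _, hmem, act_inv_apply _ _⟩
  exact inv_mem (mul_mem (tau_mem_unipotents z).1 (mem_cuspGroup_iff.2 ⟨u, 0, rfl⟩))

theorem cubic_eq_zero_of_act_tau_mem (hp : p ∈ voronoi n σ) (hp' : act n σ (tau n b) p ∈ voronoi n σ) :
    cubic n σ b (Psi p) = 0 :=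
  cubic_eq_zero_of_add_mem_cell (x := proj p) hp ((act_tau_mem_voronoi b p).1 hp')

/-- The level is multiplied by `u⁴`, and both levels lie in the half-open interval `[1, ε⁴)`; so
`|u| = 1` and the element is a translation. -/
theorem exists_eq_tau_of_region (hsq : Squarefree n) (hσ : σ ≠ 1) (hε : IsFundamentalUnit n ε)
    {γ : PSL2 n} (hγ : γ ∈ cuspGroup n σ) (hp : p ∈ region n σ ε)
    (hp' : act n σ γ p ∈ region n σ ε) : ∃ b, γ = tau n b ∧ cubic n σ b (Psi p) = 0 := by
  obtain ⟨u, b, rfl⟩ := mem_cuspGroup_iff.1 hγ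
  rw [mem_region_iff] at hp hp'
  rw [level_act_cuspElt hsq hσ] at hp'
  obtain ⟨hp0, hp1, hp2⟩ := hp
  obtain ⟨hq0, hq1, hq2⟩ := hp'
  have hE : 1 < emb n ε := hε.one_lt
  have hu4 : emb n u ^ 4 = |emb n u| ^ 4 := by rw [pow_abs, abs_of_nonneg (by positivity)]
  rw [hu4] at hq1 hq2
  have hu : |emb n u| = 1 := by
    rcases hε.abs_cases u with h | h | h
    · exact h
    · exfalso
      have h1 : emb n ε ^ 4 ≤ |emb n u| ^ 4 := by gcongr
      nlinarith [pow_pos (one_pos.trans hE) 4]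
    · exfalso
      have h1 : (|emb n u| * emb n ε) ^ 4 ≤ 1 := pow_le_one₀ (by positivity) h
      rw [mul_pow] at h1
      have h2 : 0 < |emb n u| ^ 4 := pow_pos (abs_pos.2 (emb_ne_zero u.ne_zero)) 4
      have := mul_lt_mul_of_pos_left hp2 h2
      linarith
  rw [cuspElt_eq_tau hu] at hq0 ⊢
  exact ⟨b, rfl, cubic_eq_zero_of_act_tau_mem hp0 hq0⟩

theorem interior_image_inter_image (hsq : Squarefree n) (hσ : σ ≠ 1) (hε : IsFundamentalUnit n ε)
    {g g' : PSL2 n} (hg : g ∈ cuspGroup n σ) (hg' : g' ∈ cuspGroup n σ) (hne : g ≠ g') :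
    interior (act n σ g '' region n σ ε ∩ act n σ g' '' region n σ ε) = ∅ := by
  rw [Set.eq_empty_iff_forall_notMem]
  intro p hp
  have key : ∀ q ∈ act n σ g '' region n σ ε ∩ act n σ g' '' region n σ ε,
      ∃ b, b ≠ 0 ∧ g'⁻¹ * g = tau n b ∧ cubic n σ b (Psi (act n σ g⁻¹ q)) = 0 := by
    rintro q ⟨⟨r, hr, rfl⟩, ⟨r', hr', hrr'⟩⟩
    have h1 : act n σ (g'⁻¹ * g) r = r' := by
      rw [act_mul_apply, ← hrr', act_inv_apply]
    obtain ⟨b, hb, hb0⟩ := exists_eq_tau_of_region hsq hσ hε (mul_mem (inv_mem hg') hg) hr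
      (h1 ▸ hr')
    refine ⟨b, ?_, hb, by rw [act_inv_apply]; exact hb0⟩
    rintro rfl
    have h2 : tau n 0 = 1 := by
      have : tau n 0 = toPSL n 1 := congrArg (toPSL n) (sl2_ext rfl rfl rfl rfl)
      rw [this, map_one]
    rw [h2, inv_mul_eq_one] at hb
    exact hne hb.symm
  obtain ⟨u, c, hu⟩ := mem_cuspGroup_iff.1 (inv_mem hg)
  -- Pulled back by `g`, the overlap lies on the surface of a single `b ≠ 0`, determined by `g'⁻¹ *
  -- g`. Moving the first real part changes that cubic at a non-zero rate, so no open set fits.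
  set f : ℝ → ℍ × ℍ := fun t => (t +ᵥ p.1, p.2) with hf
  have hfc : Continuous f := by
    refine Continuous.prodMk ?_ continuous_const
    rw [UpperHalfPlane.isOpenEmbedding_coe.continuous_iff]
    have : (fun t : ℝ => (t : ℂ) + (p.1 : ℂ)) = UpperHalfPlane.coe ∘ fun t : ℝ => t +ᵥ p.1 := by
      funext t
      exact (UpperHalfPlane.coe_vadd t p.1).symm
    rw [← this]
    fun_prop
  have hf0 : f 0 = p := by simp [hf]
  have hev : f ⁻¹' (interior (act n σ g '' region n σ ε ∩ act n σ g' '' region n σ ε)) ∈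
      nhds (0 : ℝ) :=
    (isOpen_interior.preimage hfc).mem_nhds (by
      rw [Set.mem_preimage, hf0]
      exact hp)
  obtain ⟨t, ht, ht0⟩ := Filter.nonempty_of_mem
    (Filter.inter_mem (mem_nhdsWithin_of_mem_nhds hev) (self_mem_nhdsWithin (s := Set.Ioi (0 : ℝ))))
  have ht0' : 0 < t := ht0
  obtain ⟨b, hb, hb1, hb2⟩ := key p (interior_subset hp)
  obtain ⟨b', -, hb1', hb2'⟩ := key (f t) (interior_subset ht)
  have hbb : b' = b := by
    have e := act_tau (σ := σ) b p
    have e' := act_tau (σ := σ) b' p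
    rw [← hb1', hb1] at e'
    have := e.1.symm.trans e'.1
    exact (emb_injective n (by linarith)).symm
  rw [hbb, hu] at hb2'
  rw [hu] at hb2
  obtain ⟨e1, -, e3, -⟩ := act_cuspElt (σ := σ) u c p
  obtain ⟨e1', -, e3', -⟩ := act_cuspElt (σ := σ) u c (f t)
  have hl := level_act_cuspElt (σ := σ) hsq hσ u c p
  have hl' := level_act_cuspElt (σ := σ) hsq hσ u c (f t)
  have f1 : (f t).1.re = t + p.1.re := UpperHalfPlane.vadd_re t p.1
  have f2 : (f t).1.im = p.1.im := UpperHalfPlane.vadd_im t p.1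
  have f3 : (f t).2 = p.2 := rfl
  simp only [cubic, Psi] at hb2 hb2'
  rw [hl, e1, e3] at hb2
  rw [hl', e1', e3', f1, f2, f3] at hb2'
  have hzero : emb n b * (emb n u ^ 2 * t) = 0 := by linarith
  have hu0 : emb n u ≠ 0 := emb_ne_zero u.ne_zero
  exact mul_ne_zero (emb_ne_zero hb) (by positivity) hzero

theorem isFundamentalDomain_region (hn : 1 < n) (hsq : Squarefree n) (hσ : σ ≠ 1)
    (hε : IsFundamentalUnit n ε) :
    IsFundamentalDomain n σ (cuspGroup n σ) (region n σ ε) := by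
  refine ⟨Set.eq_univ_of_forall fun p => ?_,
    fun g hg g' hg' hne => interior_image_inter_image hsq hσ hε hg hg' hne⟩
  obtain ⟨g, hg, hp⟩ := exists_mem_image_region hn hsq hσ hε p
  exact Set.mem_biUnion hg hp

end HilbertCusp

namespace HilbertCusp

variable {n : ℕ} {σ : QuadField n ≃ₐ[ℚ] QuadField n} {k h : ℝ} {z z' v w b : ZK n} {L : Set (ZK n)}
  {p q : ℍ × ℍ} {S : Set ℝ} {ε : (ZK n)ˣ} {m : ℕ}

/-! ### Gluing maps -/

theorem perm_image_eq_of_iff {α : Type*} (g : Equiv.Perm α) {X Y : Set α}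
    (hXY : ∀ p, p ∈ X ↔ g p ∈ Y) : g '' X = Y := by
  ext q
  constructor
  · rintro ⟨p, hp, rfl⟩
    exact (hXY p).1 hp
  · intro hq
    exact ⟨g.symm q, (hXY _).2 (by rwa [Equiv.apply_symm_apply]), Equiv.apply_symm_apply _ _⟩

theorem act_tau_mem_levelSection (hp : p ∈ levelSection n σ h S) (hz : cubic n σ z (Psi p) = 0) :
    act n σ (tau n z) p ∈ levelSection n σ h S := by
  obtain ⟨h1, h2, h3⟩ := hp
  obtain ⟨-, e2, -, e4⟩ := act_tau (σ := σ) z p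
  refine ⟨fun v => ?_, by rw [e2, e4]; exact h2, by rw [level_act_tau]; exact h3⟩
  rw [cubic_act_tau, hz, sub_zero]
  exact h1 _

theorem act_tau_image_levelSection (z : ZK n) :
    act n σ (tau n z) '' (levelSection n σ h S ∩ Psi ⁻¹' surface n σ z) =
      levelSection n σ h S ∩ Psi ⁻¹' surface n σ (-z) := by
  refine perm_image_eq_of_iff _ fun p => ?_
  have h0 : cubic n σ 0 (Psi p) = 0 := by simp [cubic]
  have hs : act n σ (tau n z) p ∈ Psi ⁻¹' surface n σ (-z) ↔ cubic n σ z (Psi p) = 0 := by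
    change cubic n σ (-z) (Psi (act n σ (tau n z) p)) = 0 ↔ _
    rw [cubic_act_tau, neg_add_cancel, h0, zero_sub, neg_eq_zero]
  constructor
  · rintro ⟨hp, hz⟩
    exact ⟨act_tau_mem_levelSection hp hz, hs.2 hz⟩
  · rintro ⟨⟨h1, h2, h3⟩, hz⟩
    have hz' := hs.1 hz
    obtain ⟨-, e2, -, e4⟩ := act_tau (σ := σ) z p
    rw [e2, e4] at h2
    rw [level_act_tau] at h3
    refine ⟨⟨fun v => ?_, h2, h3⟩, hz'⟩
    have := h1 (v - z)
    rwa [cubic_act_tau, hz', sub_zero, sub_add_cancel] at this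

theorem act_eta_mem_iff (hsq : Squarefree n) (hσ : σ ≠ 1) (hε : IsFundamentalUnit n ε) :
    p ∈ levelSection n σ h (Set.Icc 1 (emb n ε ^ 4)) ∩ Psi ⁻¹' plane 1 ↔
      act n σ (eta n ε) p ∈ levelSection n σ h (Set.Icc 1 (emb n ε ^ 4)) ∩
        Psi ⁻¹' plane (emb n ε ^ 4) := by
  have hE : 1 ≤ emb n ε ^ 4 := one_le_pow₀ hε.one_lt.le
  have hE0 : emb n ε ^ 4 ≠ 0 := by linarith
  have hl := level_act_cuspElt (σ := σ) hsq hσ ε 0 p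
  have hh := height_act_cuspElt (σ := σ) hsq hσ ε 0 p
  have hv := act_cuspElt_mem_voronoi_iff (σ := σ) (p := p) hsq hσ ε
  rw [eta_eq]
  constructor
  · rintro ⟨⟨h1, h2, -⟩, h4⟩
    have h5 : p.1.im / p.2.im = 1 := h4
    rw [h5, mul_one] at hl
    exact ⟨⟨hv.2 h1, hh.trans h2, by rw [hl]; exact ⟨hE, le_rfl⟩⟩, hl⟩
  · rintro ⟨⟨h1, h2, -⟩, h4⟩
    have h5 : p.1.im / p.2.im = 1 := by
      have h6 : (act n σ (cuspElt n ε 0) p).1.im / (act n σ (cuspElt n ε 0) p).2.im =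
        emb n ε ^ 4 := h4
      rw [hl] at h6
      exact mul_left_cancel₀ hE0 (h6.trans (mul_one _).symm)
    exact ⟨⟨hv.1 h1, hh.symm.trans h2, by rw [h5]; exact ⟨le_rfl, hE⟩⟩, h5⟩

theorem act_mem_levelSection_tau_path (hn : 1 < n) (hsq : Squarefree n) (hσ : σ ≠ 1)
    (hε : IsFundamentalUnit n ε) (hm : m ∈ stopIndices n σ ε)
    (hp : p ∈ levelSection n σ h (Set.Icc 1 (emb n ε ^ 4)))
    (hp' : act n σ (tau n b) p ∈ levelSection n σ h (Set.Icc 1 (emb n ε ^ 4))) :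
    Relation.EqvGen (sectionGlue n σ ε (sideList n σ m)
      (levelSection n σ h (Set.Icc 1 (emb n ε ^ 4)))) p (act n σ (tau n b) p) := by
  obtain ⟨u, u', ho, hsub, -⟩ := exists_isObtuse hn hsq hσ hε hm hp.2.2
  rcases ho.exists_path hsub (x := proj p) hp.1 ((act_tau_mem_voronoi b p).1 hp'.1) with
    rfl | ⟨hb, hb0⟩ | ⟨s, hs, t, ht, rfl, hs0, ht0⟩
  · have e : act n σ (tau n 0) p = p := by
      obtain ⟨e1, e2, e3, e4⟩ := act_tau (σ := σ) 0 p
      rw [map_zero, add_zero] at e1 e3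
      exact prod_ext e1 e2 e3 e4
    rw [e]
    exact Relation.EqvGen.refl p
  · exact Relation.EqvGen.rel _ _ ⟨hp, hp', Or.inl ⟨b, hb, hb0, rfl⟩⟩
  · have hq := act_tau_mem_levelSection hp hs0
    have e : act n σ (tau n (s + t)) p = act n σ (tau n t) (act n σ (tau n s) p) := by
      obtain ⟨e1, e2, e3, e4⟩ := act_tau (σ := σ) (s + t) p
      obtain ⟨f1, f2, f3, f4⟩ := act_tau (σ := σ) s p
      obtain ⟨g1, g2, g3, g4⟩ := act_tau (σ := σ) t (act n σ (tau n s) p)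
      refine prod_ext ?_ ?_ ?_ ?_
      · rw [e1, g1, f1, map_add]; ring
      · rw [e2, g2, f2]
      · rw [e3, g3, f3, map_add]; ring
      · rw [e4, g4, f4]
    rw [e] at hp' ⊢
    refine Relation.EqvGen.trans _ _ _
      (Relation.EqvGen.rel _ _ ⟨hp, hq, Or.inl ⟨s, hs, hs0, rfl⟩⟩)
      (Relation.EqvGen.rel _ _ ⟨hq, hp', Or.inl ⟨t, ht, ?_, rfl⟩⟩)
    change cubic n σ t (proj p + planeVec n σ s |>.1, proj p + planeVec n σ s |>.2, _) = 0 at ht0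
    rw [← proj_act_tau, ← level_act_tau s p] at ht0
    exact ht0

/-- The level is multiplied by `u⁴` and stays in `[1, ε⁴]` without decreasing. Either `|u| = 1` and
the element is a translation, or `|u| = ε` and the level passes from `1` to `ε⁴`; then the element
acts as `η₁` followed by a translation in the top torus. -/
theorem eqvGen_of_act_eq (hn : 1 < n) (hsq : Squarefree n) (hσ : σ ≠ 1)
    (hε : IsFundamentalUnit n ε) (hm : m ∈ stopIndices n σ ε) {γ : PSL2 n}
    (hγ : γ ∈ cuspGroup n σ) (hp : p ∈ levelSection n σ h (Set.Icc 1 (emb n ε ^ 4)))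
    (hq : act n σ γ p ∈ levelSection n σ h (Set.Icc 1 (emb n ε ^ 4)))
    (hle : p.1.im / p.2.im ≤ (act n σ γ p).1.im / (act n σ γ p).2.im) :
    Relation.EqvGen (sectionGlue n σ ε (sideList n σ m)
      (levelSection n σ h (Set.Icc 1 (emb n ε ^ 4)))) p (act n σ γ p) := by
  obtain ⟨u, b, rfl⟩ := mem_cuspGroup_iff.1 hγ
  have hl := level_act_cuspElt (σ := σ) hsq hσ u b p
  have hE : 1 < emb n ε := hε.one_lt
  have hu4 : emb n u ^ 4 = |emb n u| ^ 4 := by rw [pow_abs, abs_of_nonneg (by positivity)]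
  have hk : 0 < p.1.im / p.2.im := one_pos.trans_le hp.2.2.1
  have hu0 : 0 < |emb n u| := abs_pos.2 (emb_ne_zero u.ne_zero)
  rcases hε.abs_cases u with hc | hc | hc
  · rw [cuspElt_eq_tau hc] at hq ⊢
    exact act_mem_levelSection_tau_path hn hsq hσ hε hm hp hq
  · have hq2 := hq.2.2.2
    rw [hl, hu4] at hq2
    have h1 : emb n ε ^ 4 ≤ |emb n u| ^ 4 := by gcongr
    have h2 : |emb n u| ^ 4 * 1 ≤ |emb n u| ^ 4 * (p.1.im / p.2.im) :=
      mul_le_mul_of_nonneg_left hp.2.2.1 (by positivity)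
    have hu : |emb n u| ^ 4 = emb n ε ^ 4 := le_antisymm (by linarith) h1
    have hk1 : p.1.im / p.2.im = 1 := by
      refine le_antisymm ?_ hp.2.2.1
      rw [hu] at hq2
      have : 0 < emb n ε ^ 4 := by positivity
      by_contra hcon
      push Not at hcon
      have := mul_lt_mul_of_pos_left hcon this
      linarith
    have huε : emb n u ^ 2 = emb n ε ^ 2 := by
      have : |emb n u| = emb n ε := (pow_left_inj₀ hu0.le (by linarith) four_ne_zero).1 hu
      rw [← sq_abs, this]
    have huε' : embConj n σ u ^ 2 = embConj n σ ε ^ 2 := by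
      rw [sq_embConj_unit hsq hσ, sq_embConj_unit hsq hσ, huε]
    have hη := ((act_eta_mem_iff (h := h) (p := p) hsq hσ hε).1 ⟨hp, hk1⟩).1
    have e : act n σ (cuspElt n u b) p = act n σ (tau n b) (act n σ (eta n ε) p) := by
      obtain ⟨e1, e2, e3, e4⟩ := act_cuspElt (σ := σ) u b p
      obtain ⟨f1, f2, f3, f4⟩ := act_cuspElt (σ := σ) ε 0 p
      rw [← eta_eq] at f1 f2 f3 f4
      obtain ⟨g1, g2, g3, g4⟩ := act_tau (σ := σ) b (act n σ (eta n ε) p)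
      rw [map_zero, add_zero] at f1 f3
      refine prod_ext ?_ ?_ ?_ ?_
      · rw [e1, g1, f1, huε]
      · rw [e2, g2, f2, huε]
      · rw [e3, g3, f3, huε']
      · rw [e4, g4, f4, huε']
    rw [e] at hq ⊢
    exact Relation.EqvGen.trans _ _ _
      (Relation.EqvGen.rel _ _ ⟨hp, hη, Or.inr ⟨hk1, rfl⟩⟩)
      (act_mem_levelSection_tau_path hn hsq hσ hε hm hη hq)
  · exfalso
    rw [hl, hu4] at hle
    have h1 : |emb n u| < 1 := by
      by_contra hcon
      push Not at hcon
      have := mul_lt_mul_of_pos_left hE hu0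
      linarith
    have h2 : |emb n u| ^ 4 < 1 := pow_lt_one₀ hu0.le h1 four_ne_zero
    have := mul_lt_mul_of_pos_right h2 hk
    linarith

theorem exists_act_eq_iff_eqvGen (hn : 1 < n) (hsq : Squarefree n) (hσ : σ ≠ 1)
    (hε : IsFundamentalUnit n ε) (hm : m ∈ stopIndices n σ ε)
    (hp : p ∈ levelSection n σ h (Set.Icc 1 (emb n ε ^ 4)))
    (hq : q ∈ levelSection n σ h (Set.Icc 1 (emb n ε ^ 4))) :
    (∃ γ ∈ cuspGroup n σ, act n σ γ p = q) ↔
      Relation.EqvGen (sectionGlue n σ ε (sideList n σ m)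
        (levelSection n σ h (Set.Icc 1 (emb n ε ^ 4)))) p q := by
  constructor
  · rintro ⟨γ, hγ, rfl⟩
    rcases le_total (p.1.im / p.2.im) ((act n σ γ p).1.im / (act n σ γ p).2.im) with hle | hle
    · exact eqvGen_of_act_eq hn hsq hσ hε hm hγ hp hq hle
    · have e := act_inv_apply (σ := σ) γ p
      have := eqvGen_of_act_eq (h := h) (p := act n σ γ p) hn hsq hσ hε hm (inv_mem hγ) hq
        (by rw [e]; exact hp) (by rw [e]; exact hle)
      rw [e] at this
      exact Relation.EqvGen.symm _ _ this
  · intro hg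
    clear hp hq
    induction hg with
    | rel x y hxy =>
      rcases hxy.2.2 with ⟨z, -, -, e⟩ | ⟨-, e⟩
      · exact ⟨_, (tau_mem_unipotents z).1, e.symm⟩
      · exact ⟨_, mem_cuspGroup_iff.2 ⟨ε, 0, eta_eq ε⟩, e.symm⟩
    | refl x => exact ⟨1, one_mem _, by rw [map_one]; rfl⟩
    | symm x y _ ih =>
      obtain ⟨γ, hγ, rfl⟩ := ih
      exact ⟨γ⁻¹, inv_mem hγ, act_inv_apply γ x⟩
    | trans x y w _ _ ih1 ih2 =>
      obtain ⟨γ, hγ, rfl⟩ := ih1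
      obtain ⟨γ', hγ', rfl⟩ := ih2
      exact ⟨γ' * γ, mul_mem hγ' hγ, act_mul_apply _ _ _⟩

/-! ### The Anosov diffeomorphism -/

/-- The linear map `(x₁, x₂) ↦ (a x₁, a⁻¹ x₂)`. -/
noncomputable def hyperbolicEquiv {a : ℝ} (ha : a ≠ 0) : (ℝ × ℝ) ≃L[ℝ] (ℝ × ℝ) :=
  LinearEquiv.toContinuousLinearEquiv
    { toFun := fun x => (a * x.1, a⁻¹ * x.2)
      invFun := fun x => (a⁻¹ * x.1, a * x.2)
      map_add' := fun x y => by ext <;> simp only [Prod.fst_add, Prod.snd_add] <;> ring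
      map_smul' := fun t x => by
        ext <;> simp only [Prod.smul_fst, Prod.smul_snd, smul_eq_mul, RingHom.id_apply] <;> ring
      left_inv := fun x => by ext <;> simp [ha]
      right_inv := fun x => by ext <;> simp [ha] }

theorem hyperbolicEquiv_apply {a : ℝ} (ha : a ≠ 0) (x : ℝ × ℝ) :
    hyperbolicEquiv ha x = (a * x.1, a⁻¹ * x.2) := rfl

theorem hyperbolicEquiv_symm_apply {a : ℝ} (ha : a ≠ 0) (x : ℝ × ℝ) :
    (hyperbolicEquiv ha).symm x = (a⁻¹ * x.1, a * x.2) := rfl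

theorem isAnosov_hyperbolicEquiv {a : ℝ} (ha : 1 < a) {Λ : Set (ℝ × ℝ)}
    (hΛ : hyperbolicEquiv (one_pos.trans ha).ne' '' Λ = Λ) :
    IsAnosov Λ (hyperbolicEquiv (one_pos.trans ha).ne') := by
  have ha0 : 0 < a := one_pos.trans ha
  refine ⟨hΛ, LinearMap.range (LinearMap.inr ℝ ℝ ℝ), LinearMap.range (LinearMap.inl ℝ ℝ ℝ),
    LinearMap.isCompl_range_inl_inr.symm, ?_, ?_, 1, one_pos, a⁻¹, inv_pos.2 ha0,
    inv_lt_one_of_one_lt₀ ha, ?_, ?_⟩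
  · ext x
    constructor
    · rintro ⟨_, ⟨t, rfl⟩, rfl⟩
      exact ⟨a⁻¹ * t, by simp [hyperbolicEquiv_apply]⟩
    · rintro ⟨t, rfl⟩
      exact ⟨(0, a * t), ⟨a * t, rfl⟩, by simp [hyperbolicEquiv_apply, ha0.ne']⟩
  · ext x
    constructor
    · rintro ⟨_, ⟨t, rfl⟩, rfl⟩
      exact ⟨a * t, by simp [hyperbolicEquiv_apply]⟩
    · rintro ⟨t, rfl⟩
      exact ⟨(a⁻¹ * t, 0), ⟨a⁻¹ * t, rfl⟩, by simp [hyperbolicEquiv_apply, ha0.ne']⟩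
  · rintro _ ⟨t, rfl⟩ j
    have e : (hyperbolicEquiv ha0.ne')^[j] (LinearMap.inr ℝ ℝ ℝ t) = (0, a⁻¹ ^ j * t) := by
      induction j with
      | zero => simp
      | succ j ih =>
        rw [Function.iterate_succ_apply', ih, hyperbolicEquiv_apply, pow_succ']
        simp [mul_assoc]
    rw [e]
    simp [Prod.norm_def, abs_of_pos ha0]
    positivity
  · rintro _ ⟨t, rfl⟩ j
    have e : (hyperbolicEquiv ha0.ne').symm^[j] (LinearMap.inl ℝ ℝ ℝ t) = (a⁻¹ ^ j * t, 0) := by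
      induction j with
      | zero => simp
      | succ j ih =>
        rw [Function.iterate_succ_apply', ih, hyperbolicEquiv_symm_apply, pow_succ']
        simp [mul_assoc]
    rw [e]
    simp [Prod.norm_def, abs_of_pos ha0]
    positivity

theorem exists_isAnosov (hsq : Squarefree n) (hσ : σ ≠ 1) (hε : IsFundamentalUnit n ε) :
    ∃ A : (ℝ × ℝ) ≃L[ℝ] (ℝ × ℝ), (∀ p, proj (act n σ (eta n ε) p) = A (proj p)) ∧
      IsAnosov (Set.range fun z : ZK n => (emb n z, embConj n σ z)) A := by
  have ha : 1 < emb n ε ^ 2 := one_lt_pow₀ hε.one_lt two_ne_zero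
  have hc := sq_embConj_unit hsq hσ ε
  refine ⟨hyperbolicEquiv (one_pos.trans ha).ne', fun p => ?_, isAnosov_hyperbolicEquiv ha ?_⟩
  · obtain ⟨h1, -, h3, -⟩ := act_cuspElt (σ := σ) ε 0 p
    rw [eta_eq, hyperbolicEquiv_apply]
    refine Prod.ext ?_ ?_
    · rw [map_zero, add_zero] at h1
      exact h1
    · rw [map_zero, add_zero, hc] at h3
      exact h3
  · have key : ∀ z : ZK n, hyperbolicEquiv (one_pos.trans ha).ne' (emb n z, embConj n σ z) =
        (emb n ((ε : ZK n) ^ 2 * z), embConj n σ ((ε : ZK n) ^ 2 * z)) := by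
      intro z
      rw [hyperbolicEquiv_apply, map_mul, map_mul, map_pow, map_pow, hc]
    ext x
    constructor
    · rintro ⟨_, ⟨z, rfl⟩, rfl⟩
      exact ⟨_, (key z).symm⟩
    · rintro ⟨z, rfl⟩
      refine ⟨_, ⟨((ε⁻¹ : (ZK n)ˣ) : ZK n) ^ 2 * z, rfl⟩, ?_⟩
      have e : (ε : ZK n) ^ 2 * (((ε⁻¹ : (ZK n)ˣ) : ZK n) ^ 2 * z) = z := by
        rw [← mul_assoc, ← mul_pow, Units.mul_inv, one_pow, one_mul]
      simp only
      rw [key, e]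

/-! ### Flat tori -/

theorem leafChart_add (y₁ y₂ : ℝ) (x x' : ℝ × ℝ) :
    leafChart y₁ y₂ (x + x') = leafChart y₁ y₂ x + leafChart y₁ y₂ x' := by
  ext i
  fin_cases i <;> simp [leafChart, add_div]

theorem leafChart_injective {y₁ y₂ : ℝ} (h1 : y₁ ≠ 0) (h2 : y₂ ≠ 0) :
    Function.Injective (leafChart y₁ y₂) := by
  intro x x' hx
  have e1 := congrArg (fun f : EuclideanSpace ℝ (Fin 2) => f 0) hx
  have e2 := congrArg (fun f : EuclideanSpace ℝ (Fin 2) => f 1) hx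
  simp only [leafChart, PiLp.toLp_apply, Matrix.cons_val_zero, Matrix.cons_val_one] at e1 e2
  exact Prod.ext ((div_left_inj' h1).1 e1) ((div_left_inj' h2).1 e2)

theorem continuous_leafChart (y₁ y₂ : ℝ) : Continuous (leafChart y₁ y₂) := by
  unfold leafChart
  fun_prop

variable (n σ) in
/-- The embedding of `ℤ_K` in the Euclidean plane of a leaf. -/
noncomputable def chartHom (y₁ y₂ : ℝ) : ZK n →+ EuclideanSpace ℝ (Fin 2) where
  toFun z := leafChart y₁ y₂ (planeVec n σ z)
  map_zero' := by
    ext i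
    fin_cases i <;> simp [leafChart, planeVec]
  map_add' z w := by rw [planeVec_add, leafChart_add]

theorem mem_leafLattice_iff {y₁ y₂ : ℝ} {f : EuclideanSpace ℝ (Fin 2)} :
    f ∈ leafLattice n σ y₁ y₂ ↔ ∃ z, leafChart y₁ y₂ (planeVec n σ z) = f := by
  have e : leafLattice n σ y₁ y₂ = LinearMap.range (chartHom n σ y₁ y₂).toIntLinearMap := by
    rw [leafLattice]
    exact Submodule.span_eq (LinearMap.range (chartHom n σ y₁ y₂).toIntLinearMap)
  rw [e]
  rfl

theorem exists_basis_leafLattice (hn : 1 < n) (hsq : Squarefree n) (hσ : σ ≠ 1) {y₁ y₂ : ℝ}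
    (h1 : y₁ ≠ 0) (h2 : y₂ ≠ 0) : ∃ B : Module.Basis (Fin 2) ℝ (EuclideanSpace ℝ (Fin 2)),
      leafLattice n σ y₁ y₂ = Submodule.span ℤ (Set.range B) := by
  have hα := one_lt_emb_alpha hn
  have hα' := embConj_alpha_neg hn hσ
  have hli : LinearIndependent ℝ ![leafChart y₁ y₂ (planeVec n σ 1),
      leafChart y₁ y₂ (planeVec n σ (alpha n))] := by
    rw [LinearIndependent.pair_iff]
    intro s t hst
    have e1 := congrArg (fun f : EuclideanSpace ℝ (Fin 2) => f 0) hst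
    have e2 := congrArg (fun f : EuclideanSpace ℝ (Fin 2) => f 1) hst
    simp [leafChart, planeVec] at e1 e2
    field_simp at e1 e2
    have ht : t * (emb n (alpha n) - embConj n σ (alpha n)) = 0 := by linarith
    have ht0 := (mul_eq_zero.1 ht).resolve_right (by linarith)
    rw [ht0] at e1
    exact ⟨by linarith, ht0⟩
  refine ⟨basisOfLinearIndependentOfCardEqFinrank hli (by simp), ?_⟩
  rw [coe_basisOfLinearIndependentOfCardEqFinrank]
  refine le_antisymm (Submodule.span_le.2 ?_) (Submodule.span_le.2 ?_)
  · rintro _ ⟨z, rfl⟩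
    obtain ⟨a, b, rfl⟩ := exists_int_add_mul_alpha hsq hσ z
    have e : leafChart y₁ y₂ (planeVec n σ (a + b * alpha n)) =
        a • leafChart y₁ y₂ (planeVec n σ 1) + b • leafChart y₁ y₂ (planeVec n σ (alpha n)) := by
      have h := map_add (chartHom n σ y₁ y₂) (a • 1) (b • alpha n)
      rw [map_zsmul, map_zsmul, zsmul_eq_mul, zsmul_eq_mul, mul_one] at h
      exact h
    change leafChart y₁ y₂ (planeVec n σ (a + b * alpha n)) ∈ _
    rw [e]
    refine add_mem (Submodule.smul_mem _ _ (Submodule.subset_span ⟨0, rfl⟩))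
      (Submodule.smul_mem _ _ (Submodule.subset_span ⟨1, rfl⟩))
  · rintro _ ⟨i, rfl⟩
    fin_cases i
    · exact mem_leafLattice_iff.2 ⟨1, rfl⟩
    · exact mem_leafLattice_iff.2 ⟨alpha n, rfl⟩

theorem delta_eq_dist_sq {y₁ y₂ : ℝ} (hp : p ∈ leaf y₁ y₂) (hq : q ∈ leaf y₁ y₂) :
    delta p q = dist (leafChart y₁ y₂ (proj p)) (leafChart y₁ y₂ (proj q)) ^ 2 := by
  rw [delta_of_im_eq (hp.1.trans hq.1.symm) (hp.2.trans hq.2.symm), hp.1, hp.2,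
    EuclideanSpace.dist_eq, Real.sq_sqrt (by positivity), Fin.sum_univ_two]
  simp only [leafChart, proj, PiLp.toLp_apply, Matrix.cons_val_zero, Matrix.cons_val_one,
    Real.dist_eq, sq_abs]
  rw [← sub_div, ← sub_div, div_pow, div_pow]

/-- The chart induces a continuous bijection from the glued cell, which is compact, to the quotient
by a discrete and hence closed subgroup, which is Hausdorff. Surjectivity holds because translates
of the cell cover the plane, injectivity because equivalent points are joined by side pairings. -/
theorem IsObtuse.isFlatTorus (hn : 1 < n) (hsq : Squarefree n) (hσ : σ ≠ 1) {y₁ y₂ : ℝ}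
    (h1 : 0 < y₁) (h2 : 0 < y₂) (ho : IsObtuse n σ (y₁ / y₂) z z') (hL : six z z' ⊆ L) :
    IsFlatTorus n σ L (cell n σ (y₁ / y₂)) y₁ y₂ := by
  obtain ⟨B, hB⟩ := exists_basis_leafLattice hn hsq hσ h1.ne' h2.ne'
  have hd : DiscreteTopology (leafLattice n σ y₁ y₂) := by rw [hB]; infer_instance
  have hz : IsZLattice ℝ (leafLattice n σ y₁ y₂) := by
    constructor
    rw [hB]
    exact IsZLattice.span_top
  refine ⟨⟨hd, hz⟩, fun p hp q hq => delta_eq_dist_sq hp hq, ?_⟩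
  set P := cell n σ (y₁ / y₂) with hP
  have hk : y₁ / y₂ ≠ 0 := (div_pos h1 h2).ne'
  have : CompactSpace P := isCompact_iff_compactSpace.1 (ho.isCompact_cell hk)
  have : DiscreteTopology (leafLattice n σ y₁ y₂).toAddSubgroup := hd
  have hclosed : IsClosed ((leafLattice n σ y₁ y₂).toAddSubgroup :
      Set (EuclideanSpace ℝ (Fin 2))) := AddSubgroup.isClosed_of_discrete
  set f : P → EuclideanSpace ℝ (Fin 2) ⧸ (leafLattice n σ y₁ y₂).toAddSubgroup :=
    fun x => QuotientAddGroup.mk (leafChart y₁ y₂ x) with hf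
  have hfc : Continuous f := continuous_quot_mk.comp
    ((continuous_leafChart y₁ y₂).comp continuous_subtype_val)
  have hrel : ∀ x x' : P, sliceGlue n σ L P (y₁ / y₂) x x' → f x = f x' := by
    rintro x x' ⟨b, -, -, hb⟩
    refine QuotientAddGroup.eq.2 ?_
    rw [hb]
    change -leafChart y₁ y₂ x + leafChart y₁ y₂ (x + planeVec n σ b) ∈ leafLattice n σ y₁ y₂
    rw [leafChart_add, neg_add_cancel_left]
    exact mem_leafLattice_iff.2 ⟨b, rfl⟩
  have hinj : ∀ x x' : P, f x = f x' → Relation.EqvGen (sliceGlue n σ L P (y₁ / y₂)) x x' := by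
    intro x x' hxx
    have hmem : -leafChart y₁ y₂ x + leafChart y₁ y₂ x' ∈ leafLattice n σ y₁ y₂ :=
      QuotientAddGroup.eq.1 hxx
    obtain ⟨b, hb⟩ := mem_leafLattice_iff.1 hmem
    have hx' : (x' : ℝ × ℝ) = x + planeVec n σ b := by
      refine leafChart_injective h1.ne' h2.ne' ?_
      rw [leafChart_add, hb, add_neg_cancel_left]
    rcases ho.exists_path hL x.2 (hx' ▸ x'.2) with rfl | ⟨hb, hb0⟩ | ⟨s, hs, t, ht, rfl, hs0, ht0⟩
    · have : x' = x := Subtype.ext (by rw [hx']; simp [planeVec])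
      rw [this]
      exact Relation.EqvGen.refl x
    · exact Relation.EqvGen.rel _ _ ⟨b, hb, hb0, hx'⟩
    · set y : P := ⟨x + planeVec n σ s, add_mem_cell x.2 hs0⟩
      refine Relation.EqvGen.trans _ y _ (Relation.EqvGen.rel _ _ ⟨s, hs, hs0, rfl⟩)
        (Relation.EqvGen.rel y x' ⟨t, ht, ht0, ?_⟩)
      rw [hx', planeVec_add, ← add_assoc]
      rfl
  have hsurj : Function.Surjective f := by
    intro y
    obtain ⟨y, rfl⟩ := QuotientAddGroup.mk_surjective y
    obtain ⟨b, hb⟩ := exists_add_mem_cell hn hsq hσ (div_pos h1 h2) (y 0 * y₁, y 1 * y₂)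
    refine ⟨⟨_, hb⟩, (QuotientAddGroup.eq.2 ?_).symm⟩
    have e : leafChart y₁ y₂ (y 0 * y₁, y 1 * y₂) = y := by
      ext i
      fin_cases i <;> simp [leafChart, h1.ne', h2.ne']
    change -y + leafChart y₁ y₂ ((y 0 * y₁, y 1 * y₂) + planeVec n σ b) ∈ leafLattice n σ y₁ y₂
    rw [leafChart_add, e, neg_add_cancel_left]
    exact mem_leafLattice_iff.2 ⟨b, rfl⟩
  set F : Quot (sliceGlue n σ L P (y₁ / y₂)) →
      EuclideanSpace ℝ (Fin 2) ⧸ (leafLattice n σ y₁ y₂).toAddSubgroup := Quot.lift f hrel with hF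
  have hFb : Function.Bijective F := by
    constructor
    · intro a a'
      induction a using Quot.ind
      induction a' using Quot.ind
      intro haa
      exact Quot.eqvGen_sound (hinj _ _ haa)
    · intro y
      obtain ⟨x, hx⟩ := hsurj y
      exact ⟨Quot.mk _ x, hx⟩
  have hFc : Continuous (Equiv.ofBijective F hFb) := continuous_quot_lift hrel hfc
  exact ⟨hFc.homeoOfEquivCompactToT2, fun x => rfl⟩

end HilbertCusp

namespace HilbertCusp

variable {n : ℕ} {σ : QuadField n ≃ₐ[ℚ] QuadField n} {h : ℝ} {ε : (ZK n)ˣ} {m : ℕ}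

/-! ### Decompositions of the fundamental domain -/

theorem region_eq_iUnion_cuspSection :
    region n σ ε = ⋃ h ∈ Set.Ioi (0 : ℝ), cuspSection n σ ε h := by
  ext p
  simp only [Set.mem_iUnion, exists_prop, mem_region_iff]
  constructor
  · rintro ⟨h1, h2⟩
    have hpos : 0 < p.1.im * p.2.im := mul_pos p.1.im_pos p.2.im_pos
    refine ⟨Real.sqrt (p.1.im * p.2.im), Real.sqrt_pos.2 hpos, ?_⟩
    rw [cuspSection_eq (Real.sqrt_pos.2 hpos)]
    exact ⟨h1, (Real.sq_sqrt hpos.le).symm, h2⟩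
  · rintro ⟨h, hh, hp⟩
    rw [cuspSection_eq hh] at hp
    exact ⟨hp.1, hp.2.2⟩

theorem pairwiseDisjoint_cuspSection :
    (Set.Ioi (0 : ℝ)).PairwiseDisjoint (cuspSection n σ ε) := by
  intro h hh h' hh' hne
  refine Set.disjoint_left.2 fun p hp hp' => hne ?_
  rw [cuspSection_eq hh] at hp
  rw [cuspSection_eq hh'] at hp'
  exact (pow_left_inj₀ (le_of_lt hh) (le_of_lt hh') two_ne_zero).1 (hp.2.1.symm.trans hp'.2.1)

theorem region_eq_iUnion_flatSection :
    region n σ ε = ⋃ h ∈ Set.Ioi (0 : ℝ), flatSection n σ ε h := by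
  ext p
  simp only [Set.mem_iUnion, exists_prop, mem_region_iff, mem_flatSection_iff]
  constructor
  · rintro ⟨h1, h2⟩
    exact ⟨_, p.2.im_pos, h1, rfl, h2⟩
  · rintro ⟨h, -, h1, -, h2⟩
    exact ⟨h1, h2⟩

theorem Psi_image_flatSection (hh : 0 < h) : Psi '' flatSection n σ ε h =
    {q | q.2.2 ∈ Set.Ico 1 (emb n ε ^ 4) ∧ ∀ z, 0 ≤ cubic n σ z q} := by
  ext q
  constructor
  · rintro ⟨p, hp, rfl⟩
    rw [mem_flatSection_iff] at hp
    exact ⟨hp.2.2, hp.1⟩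
  · rintro ⟨h1, h2⟩
    have hk : 0 < q.2.2 := one_pos.trans_le h1.1
    have e : h * q.2.2 / h = q.2.2 := mul_div_cancel_left₀ _ hh.ne'
    have hq : Psi (⟨⟨q.1, h * q.2.2⟩, mul_pos hh hk⟩, ⟨⟨q.2.1, h⟩, hh⟩) = q :=
      Prod.ext rfl (Prod.ext rfl e)
    refine ⟨_, mem_flatSection_iff.2 ⟨fun z => ?_, rfl, ?_⟩, hq⟩
    · rw [hq]; exact h2 z
    · change h * q.2.2 / h ∈ _
      rw [e]; exact h1

theorem Psi_image_cuspSection_eq (hh : 0 < h) : Psi '' cuspSection n σ ε h =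
    {q | q.2.2 ∈ Set.Ico 1 (emb n ε ^ 4) ∧ ∀ z, 0 ≤ cubic n σ z q} := by
  rw [cuspSection_eq hh, Psi_image_levelSection hh fun k hk => hk.1]

end HilbertCusp

/-! ### Assembly of the theorem -/

theorem mainTheorem1 (n : ℕ) (hn : 1 < n) (hsq : Squarefree n)
    (σ : QuadField n ≃ₐ[ℚ] QuadField n) (hσ : σ ≠ 1)
    (ε : (ZK n)ˣ) (hε : IsFundamentalUnit n ε) :
    -- `R_n` is a fundamental domain for `Δ`, and it is the disjoint union of the cusp sections
    IsFundamentalDomain n σ (cuspGroup n σ) (region n σ ε) ∧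
    (region n σ ε = ⋃ h ∈ Set.Ioi (0 : ℝ), cuspSection n σ ε h) ∧
    (Set.Ioi (0 : ℝ)).PairwiseDisjoint (cuspSection n σ ε) ∧
    (region n σ ε = ⋃ h ∈ Set.Ioi (0 : ℝ), flatSection n σ ε h) ∧
    (∀ h > 0, ∀ h' > 0, Psi '' flatSection n σ ε h' = Psi '' cuspSection n σ ε h) ∧
    -- the recursion stops, at a first index `m > 1`
    ∃ m : ℕ, 1 < m ∧ IsLeast (stopIndices n σ ε) m ∧
    ∀ h : ℝ, 0 < h →
      -- Sides
      (Psi '' cuspSection n σ ε h =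
        {q | 1 ≤ q.2.2 ∧ q.2.2 < emb n ε ^ 4 ∧ ∀ z ∈ sideList n σ m, 0 ≤ cubic n σ z q}) ∧
      IsSide (plane 1) (Psi '' cuspSection n σ ε h) ∧
      IsSide (plane (emb n ε ^ 4)) (Psi '' cuspSection n σ ε h) ∧
      {z : ZK n | IsSide (surface n σ z) (Psi '' cuspSection n σ ε h)} = sideList n σ m ∧
      frontier (Psi '' cuspSection n σ ε h) = closure (Psi '' cuspSection n σ ε h) ∩
        (plane 1 ∪ plane (emb n ε ^ 4) ∪ ⋃ z ∈ sideList n σ m, surface n σ z) ∧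
      -- Torus shapes
      (closure (cuspSection n σ ε h) = ⋃ k ∈ Set.Icc (1 : ℝ) (emb n ε ^ 4),
        torus n σ (h * Real.sqrt k) (h / Real.sqrt k)) ∧
      (Psi '' closure (cuspSection n σ ε h) = closure (Psi '' cuspSection n σ ε h)) ∧
      (∀ k ∈ Set.Icc (1 : ℝ) (emb n ε ^ 4),
        slice (closure (Psi '' cuspSection n σ ε h)) k =
          proj '' torus n σ (h * Real.sqrt k) (h / Real.sqrt k) ∧
        IsFlatTorus n σ (sideList n σ m) (slice (closure (Psi '' cuspSection n σ ε h)) k)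
          (h * Real.sqrt k) (h / Real.sqrt k)) ∧
      (∀ k ∈ Set.Icc (1 : ℝ) (emb n ε ^ 4),
        (∀ i, 1 ≤ i → i < m → k ≠ level n σ i) → (n % 4 ≠ 1 → k ≠ emb n ε ^ 4) →
        IsHexagon (slice (closure (Psi '' cuspSection n σ ε h)) k)) ∧
      (∀ i, 1 ≤ i → i < m → 1 ≤ level n σ i ∧ level n σ i < emb n ε ^ 4 ∧
        IsParallelogramBoundedBy n σ
          (slice (closure (Psi '' cuspSection n σ ε h)) (level n σ i)) (level n σ i)
          (zpair n σ i).1 (zpair n σ i).2) ∧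
      (n % 4 ≠ 1 → level n σ m = emb n ε ^ 4 ∧
        IsParallelogramBoundedBy n σ
          (slice (closure (Psi '' cuspSection n σ ε h)) (level n σ m)) (level n σ m)
          (zpair n σ m).1 (zpair n σ m).2) ∧
      (n % 4 = 1 → emb n ε ^ 4 < level n σ m ∧
        IsParallelogramBoundedBy n σ
          (slice (Psi '' regionU n σ) (level n σ m)) (level n σ m)
          (zpair n σ m).1 (zpair n σ m).2) ∧
      -- Gluing maps: the sides of `z` and `-z` are paired by `τ_z`
      (∀ z ∈ sideList n σ m, tau n z ∈ unipotents n σ ∧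
        act n σ (tau n z) '' (closure (cuspSection n σ ε h) ∩ Psi ⁻¹' surface n σ z) =
          closure (cuspSection n σ ε h) ∩ Psi ⁻¹' surface n σ (-z)) ∧
      -- the torus at `k = 1` is attached to the torus at `k = ε⁴` by `η₁`
      eta n ε ∈ cuspGroup n σ ∧
      act n σ (eta n ε) '' (closure (cuspSection n σ ε h) ∩ Psi ⁻¹' plane 1) =
        closure (cuspSection n σ ε h) ∩ Psi ⁻¹' plane (emb n ε ^ 4) ∧
      (∃ A : (ℝ × ℝ) ≃L[ℝ] (ℝ × ℝ), (∀ p, proj (act n σ (eta n ε) p) = A (proj p)) ∧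
        IsAnosov (Set.range fun z : ZK n => (emb n z, embConj n σ z)) A) ∧
      -- these side pairings generate all the identifications made by `Δ`
      (∀ p ∈ closure (cuspSection n σ ε h), ∀ q ∈ closure (cuspSection n σ ε h),
        (∃ γ ∈ cuspGroup n σ, act n σ γ p = q) ↔
          Relation.EqvGen
            (sectionGlue n σ ε (sideList n σ m) (closure (cuspSection n σ ε h))) p q) := by
  obtain ⟨m, hm⟩ : ∃ m, IsLeast (stopIndices n σ ε) m :=
    ⟨_, Nat.sInf_mem (exists_mem_stopIndices hn hsq hσ hε), fun _ h => Nat.sInf_le h⟩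
  refine ⟨isFundamentalDomain_region hn hsq hσ hε, region_eq_iUnion_cuspSection,
    pairwiseDisjoint_cuspSection, region_eq_iUnion_flatSection, fun h hh h' hh' => ?_, m,
    one_lt_of_mem_stopIndices hn hε hm.1, hm, fun h hh => ?_⟩
  · rw [Psi_image_flatSection hh', Psi_image_cuspSection_eq hh]
  replace hm := hm.1
  have hL := finite_sideList n σ m
  have h0 : ∀ z ∈ sideList n σ m, z ≠ 0 := fun z => ne_zero_of_mem_sideList hn hsq hσ hε hm
  have hE : 1 < emb n ε ^ 4 := one_lt_pow₀ hε.one_lt (by norm_num)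
  have hPsi := Psi_image_cuspSection (ε := ε) hn hsq hσ hε hm hh
  have hcl := closure_cuspSection hn hsq hσ hε hm hh
  have hslice : ∀ k ∈ Set.Icc (1 : ℝ) (emb n ε ^ 4),
      slice (closure (Psi '' cuspSection n σ ε h)) k = cell n σ k :=
    fun k hk => slice_closure_eq_cell hn hsq hσ hε hm hh hk
  have hpar : ∀ i, 1 ≤ level n σ i → IsParallelogramBoundedBy n σ (cell n σ (level n σ i))
      (level n σ i) (zpair n σ i).1 (zpair n σ i).2 := fun i hi =>
    (isReducedPair_zpair hn hsq hσ i).isParallelogramBoundedBy_cell (one_pos.trans_le hi).ne'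
      (isReducedPair_zpair hn hsq hσ i).form_orthLevel
  refine ⟨hPsi, ?_, ?_, ?_, ?_, ?_, ?_, fun k hk => ⟨?_, ?_⟩, fun k hk hk1 hk2 => ?_,
    fun i h1 h2 => ?_, fun h4 => ?_, fun h4 => ?_, fun z _ => ⟨tau_mem_unipotents z, ?_⟩, ?_, ?_,
    exists_isAnosov hsq hσ hε, fun p hp q hq => ?_⟩
  · rw [hPsi]; exact isSide_plane_one hL h0 hE
  · rw [hPsi]; exact isSide_plane_right hL h0 hE
  · ext z
    rw [hPsi]
    refine ⟨fun hz => mem_of_isSide_surface hL h0 hE hz, fun hz => ?_⟩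
    obtain ⟨k, hk, hr⟩ := exists_isRelevant hn hsq hσ hε hm hz
    exact isSide_surface hL h0 hz hk hr
  · rw [hPsi]; exact frontier_solid hL h0
  · rw [hcl, iUnion_torus_eq hh fun k hk => one_pos.trans_le hk.1]
  · rw [hcl, hPsi, closure_solid_sideList hn hsq hσ hε hm,
      Psi_image_levelSection hh fun k hk => hk.1]
  · rw [hslice k hk, proj_image_torus hh hk.1]
  · rw [hslice k hk]
    obtain ⟨z, z', ho, hsub, -⟩ := exists_isObtuse hn hsq hσ hε hm hk
    have hk0 : 0 < k := one_pos.trans_le hk.1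
    have h1 : 0 < h * Real.sqrt k := mul_pos hh (Real.sqrt_pos.2 hk0)
    have h2 : 0 < h / Real.sqrt k := div_pos hh (Real.sqrt_pos.2 hk0)
    have e : h * Real.sqrt k / (h / Real.sqrt k) = k :=
      ((eq_sqrt_iff h1 h2 hh hk0).1 ⟨rfl, rfl⟩).2
    have := IsObtuse.isFlatTorus hn hsq hσ h1 h2 (e.symm ▸ ho) hsub
    rwa [e] at this
  · rw [hslice k hk]
    obtain ⟨z, z', ho, -, hhex⟩ := exists_isObtuse hn hsq hσ hε hm hk
    obtain ⟨f1, f2, f3⟩ := hhex hk1 hk2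
    exact ho.isHexagon_cell (one_pos.trans_le hk.1).ne' f1 f2 f3
  · have hi1 := one_le_level hn hsq hσ h1
    have hi2 := level_lt_of_lt_stop hn hsq hσ hε hm h1 h2
    refine ⟨hi1, hi2, ?_⟩
    rw [hslice _ ⟨hi1, hi2.le⟩]
    exact hpar i hi1
  · have e := level_stop_of_ne_one hn hsq hσ hm h4
    refine ⟨e, ?_⟩
    rw [hslice _ ⟨e ▸ hE.le, e.le⟩]
    exact hpar m (e ▸ hE.le)
  · have e := lt_level_stop_of_one hn hsq hσ hε hm h4
    refine ⟨e, ?_⟩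
    rw [regionU_eq, slice_Psi_image_voronoi (one_pos.trans (hE.trans e))]
    exact hpar m (hE.trans e).le
  · rw [hcl]; exact act_tau_image_levelSection z
  · rw [mem_cuspGroup_iff, eta_eq]; exact ⟨ε, 0, rfl⟩
  · rw [hcl]; exact perm_image_eq_of_iff _ fun p => act_eta_mem_iff hsq hσ hε
  · rw [hcl] at hp hq ⊢
    exact exists_act_eq_iff_eqvGen hn hsq hσ hε hm hp hq
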